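/- Let $K$ be a totally real number field of degree $n$ with ring of integers $\mathcal O_K$ and real embeddings $\varphi_1,\dots,\varphi_n$, and let $\mathbb H_K\subset\mathbb C\otimes_{\mathbb Q}K\cong\mathbb C^n$ be the set of the points $z=x+iy$ with all $y_i=\varphi_i(y)>0$. The group $\Gamma_K=\mathrm{PSL}_2(\mathcal O_K)$ acts on $\mathbb H_K$ by linear fractional transformations. **Choices.** Fix an integral basis of $\mathcal O_K$; fundamental units $\varepsilon_1,\dots,\varepsilon_{n-1}$; an integral ideal $\mathfrak a_j$ of smallest norm in each of the $h$ ideal classes; cusps $\lambda_j=(\rho_j:\sigma_j)$ with $(\rho_j,\sigma_j)=\mathfrak a_j$ (and $\lambda_j=\infty$ for $\mathfrak a_j=\mathcal O_K$); matrices $A_j=\begin{pmatrix}\rho_j&\xi_j\\ \sigma_j&\eta_j\end{pmatrix}$ of determinant $1$ with $\xi_j,\eta_j\in\mathfrak a_j^{-1}$; and an integral basis of each $\mathfrak a_j^{-2}$. Such choices exist. Let $B_\Lambda=(\log|\varphi_i(\varepsilon_k)|)_{i,k}$, let $B_{\mathcal O_K}$ be the matrix of the embeddings of the basis of $\mathcal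 O_K$, $B_{(j)}$ that of the basis of $\mathfrak a_j^{-2}$, $C=\max_j\mathrm N(\mathfrak a_j)$, $r_i=\sum_k|\log|\varphi_i(\varepsilon_k)||$ and $D_i=C^{1/n}e^{r_i/2}$. **The domain.** For a cusp $\mu=(\rho:\sigma)$ with $\rho,\sigma\in\mathcal O_K$ not both $0$ put $$\Delta(z,\mu)=\mathrm N((\rho,\sigma))^{-1}\Big(\prod_{i}\big((\rho_i-\sigma_ix_i)^2y_i^{-1}+\sigma_i^2y_i\big)\Big)^{1/2},\qquad \Delta(z)=\inf_\mu\Delta(z,\mu).$$ Let $\mathcal F_j$ be the set of all $z\in\mathbb H_K$ with $\Delta(z)=\Delta(z,\lambda_j)$ such that $A_j^{-1}z=x'+iy'$ satisfies $x'\in B_{(j)}[-\tfrac12,\tfrac12)^n$ and $\log\big(y'\,\mathrm N(y')^{-1/n}\big)\in B_\Lambda[-1,1)^{n-1}$. Put $\mathcal F_K=\bigcup_{j=1}^h\mathcal F_j$. **The algorithm**, for input $z=x+iy\in\mathbb H_K$. 1. *Closest cusp.* If $\mathrm N(y)>C$ take $\mu=\infty$. Otherwise let $\lambda=(\rho:\sigma)$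 come from the first vector $\rho-\sigma z$ of an LLL-reduced basis (parameter $3/4$) of the lattice $\mathcal O_Kz+\mathcal O_K\subset\mathbb C^n$, put $d=\min\{\Delta(z,\lambda),\Delta(z,\infty),\Delta(z,0)\}$ and $a_i=D_id^{1/n}y_i^{-1/2}$. Run through the $\sigma\in\mathcal O_K$ whose coordinate vectors lie in the smallest box containing $B_{\mathcal O_K}^{-1}\big(\prod_i[-a_i,a_i]\big)$, keeping those with $|\sigma_i|\le a_i$ for all $i$ and $|\mathrm N(\sigma)|\le dC\,\mathrm N(y)^{-1/2}$. For each of them run through the $\rho\in\mathcal O_K$ whose coordinate vectors lie in the smallest box containing $B_{\mathcal O_K}^{-1}\big(\prod_i[\sigma_ix_i-y_ia_i,\sigma_ix_i+y_ia_i]\big)$, keeping those with $|\rho_i-\sigma_ix_i|\le y_ia_i$ for all $i$ and $(\rho,\sigma)\ne(0,0)$. Among the cusps $(\rho:\sigma)$ found, together with $\infty$, let $\mu$ be one with the smallest $\Delta(z,\mu)$. Norms of ideals $(\rho,\sigma)$ are computed as greatest common divisors of maximal minors, by Euclid's algorithm. 2. Find $j$ and $U\in\mathrm{SL}_2(\mathcal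 O_K)$ with $U\mu=\lambda_j$, by a search through matrices whose entries have coordinates bounded by $R=0,1,2,\dots$. 3. Put $w=A_j^{-1}Uz$, solve $B_\Lambda Y=\log\big(\mathrm{Im}(w)\,\mathrm N(\mathrm{Im}\,w)^{-1/n}\big)$, and put $\varepsilon=\prod_k\varepsilon_k^{b_k}$, where $-b_k$ is the integer nearest to $Y_k/2$. 4. Put $w'=\varepsilon^2w$, solve $B_{(j)}X=\mathrm{Re}(w')$, and let $\alpha\in\mathfrak a_j^{-2}$ have the coordinates $a_k$, where $-a_k$ is the integer nearest to $X_k$. 5. Return $A=A_j\begin{pmatrix}1&\alpha\\0&1\end{pmatrix}\begin{pmatrix}\varepsilon&0\\0&\varepsilon^{-1}\end{pmatrix}A_j^{-1}U$. (Here the integer nearest to $t$ is the integer $m$ with $t-\frac12<m\le t+\frac12$.) The running time is the number of steps of a machine with exact real arithmetic, for which the following cost one step each up to a constant depending only on $K$: arithmetic operations and comparisons on real numbers, integers and elements of $K$, evaluation of embeddings, logarithms, exponentials, real powers, rounding to an integer, and division with remainder. Data depending only on $K$ are precomputed. **Theorem.** For all such choices, $\mathcal F_K$ is a fundamental domain for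 $\Gamma_K$: $\mathbb H_K=\Gamma_K\mathcal F_K$, and $V\mathcal F_K^\circ\cap W\mathcal F_K^\circ=\emptyset$ for all $V\ne W$ in $\Gamma_K$. For every $z=x+iy\in\mathbb H_K$ the algorithm halts, and its result $A$ lies in $\Gamma_K$ and satisfies $Az\in\mathcal F_K$. For fixed $K$ (and fixed choices) its running time is bounded, for all $z\in\mathbb H_K$, by a polynomial in $\|x\|_\infty$, $\|y\|_\infty$ and $\|y^{-1}\|_\infty$, where $\|x\|_\infty=\max_i|\varphi_i(x)|$. -/

import Mathlib

open NumberField Module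
open scoped MatrixGroups UpperHalfPlane nonZeroDivisors

noncomputable section

namespace HilbertReduction

/-! ### Programs with a step count

The machine is an exact real-arithmetic machine (real RAM).  A program is a partial computation
(it may fail to halt) that threads a counter of the elementary operations done so far.
One step is: an arithmetic operation, a comparison or an equality test between real or complex
numbers, between integers, or between elements of the fixed field `K`; the evaluation of a real
embedding of `K`; a logarithm, an exponential or a real power; the rounding of a real number to an
integer; a division with remainder of integers.  A block of arithmetic on vectors and matrices
whose size depends only on `K` is charged at once, with a bound for the number of its operations.
Numbers that depend only on `K` are precomputed. -/

/-- Computations of a value of type `α`: from the value of the step counter at the start, the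
result together with the value of the counter at the end; undefined if there is no result. -/
abbrev Prog (α : Type*) := ℕ → Part (α × ℕ)

namespace Prog

/-- Return a value, at no cost. -/
def ret {α : Type*} (a : α) : Prog α := fun t => Part.some (a, t)

/-- Run `p`, then `f` on its result. -/
def bind {α β : Type*} (p : Prog α) (f : α → Prog β) : Prog β :=
  fun t => (p t).bind fun q => f q.1 q.2

/-- Charge `k` steps, then run `p`. -/
def charge {α : Type*} (k : ℕ) (p : Prog α) : Prog α := fun t => p (t + k)

/-- The loop over the entries of a list, with a state. -/
def forEach {α σ : Type*} (f : σ → α → Prog σ) : σ → List α → Prog σ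
  | s, [] => ret s
  | s, a :: l => bind (f s a) fun s' => forEach f s' l

/-- One round of an unbounded loop, on the state and the step counter. -/
def loopStep {σ β : Type*} (body : σ → Prog (β ⊕ σ)) : σ × ℕ →. (β × ℕ) ⊕ (σ × ℕ) :=
  fun p => (body p.1 p.2).map fun q =>
    match q with
    | (Sum.inl b, t') => Sum.inl (b, t')
    | (Sum.inr s', t') => Sum.inr (s', t')

/-- The unbounded loop: run `body` on the state until it answers with a final value `Sum.inl b`;
an answer `Sum.inr s` is the next state. -/
def loop {σ β : Type*} (body : σ → Prog (β ⊕ σ)) (s : σ) : Prog β :=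
  fun t => (loopStep body).fix (s, t)

end Prog

open Prog

/-! ### Finite enumerations and Euclid's algorithm -/

/-- The integers `lo, lo + 1, …, hi`. -/
def intRange (lo hi : ℤ) : List ℤ := (List.range (hi + 1 - lo).toNat).map fun k => lo + (k : ℤ)

/-- All vectors of length `m` whose `i`-th entry is taken from the list `L i`. -/
def choices {α : Type*} : (m : ℕ) → (Fin m → List α) → List (Fin m → α)
  | 0, _ => [fun i => i.elim0]
  | m + 1, L => (L 0).flatMap fun a =>
      (choices m fun i => L i.succ).map fun v => (Fin.cons a v : Fin (m + 1) → α)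

/-- Euclid's algorithm for the greatest common divisor, one step per division. -/
def euclid (a b : ℕ) : Prog ℕ :=
  loop (fun s : ℕ × ℕ => charge 1 <|
    if s.2 = 0 then ret (Sum.inl s.1) else ret (Sum.inr (s.2, s.1 % s.2))) (a, b)

/-- The nearest integer to `x`: the integer `m` with `x - 1/2 < m ≤ x + 1/2`. -/
def nearest (x : ℝ) : ℤ := ⌊x + 1 / 2⌋

/-- The left inverse `(Bᵀ B)⁻¹ Bᵀ` of a matrix with linearly independent columns; it is the inverse
of `B` if `B` is square. -/
def leftInv {ι : Type*} [Fintype ι] {m : ℕ} (B : Matrix ι (Fin m) ℝ) : Matrix (Fin m) ι ℝ :=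
  (B.transpose * B)⁻¹ * B.transpose

/-! ### Hilbert modular groups -/

section Field

variable (K : Type*) [Field K] [NumberField K]

/-- The degree `n` of `K` over `ℚ`. -/
abbrev deg : ℕ := finrank ℚ K

/-- The space `ℍ_K`.  For a totally real field `K` the algebra `ℂ ⊗ K` is identified with `ℂ ^ n`
by the real embeddings of `K`, and `ℍ_K` is then the set of the points all of whose coordinates
lie in the upper half-plane. -/
abbrev HK : Type _ := (K →+* ℝ) → ℍ

variable {K}

/-- The real part of a point of `ℍ_K`. -/
def xPart (z : HK K) : (K →+* ℝ) → ℝ := fun φ => (z φ).re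

/-- The imaginary part of a point of `ℍ_K`. -/
def yPart (z : HK K) : (K →+* ℝ) → ℝ := fun φ => (z φ).im

/-- The action of `SL₂(K)` on `ℍ_K` by linear fractional transformations. -/
def act (A : SL(2, K)) (z : HK K) : HK K :=
  fun φ => (Matrix.SpecialLinearGroup.map φ A) • z φ

/-- The inclusion of `SL₂(𝒪_K)` in `SL₂(K)`. -/
def toK (A : SL(2, 𝓞 K)) : SL(2, K) := Matrix.SpecialLinearGroup.map (algebraMap (𝓞 K) K) A

/-- The translation matrix `T ^ α`. -/
def translation (α : K) : SL(2, K) := ⟨!![1, α; 0, 1], by simp [Matrix.det_fin_two_of]⟩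

/-- The multiplier matrix `E(ε)`. -/
def multiplier (ε : (𝓞 K)ˣ) : SL(2, K) :=
  ⟨!![((ε : 𝓞 K) : K), 0; 0, ((ε : 𝓞 K) : K)⁻¹], by
    have h : ((ε : 𝓞 K) : K) ≠ 0 := by simp
    simp [Matrix.det_fin_two_of, h]⟩

/-- The set `F` tessellates `ℍ_K` under `Γ_K = PSL₂(𝒪_K)`: its translates cover `ℍ_K`, and the
translates of its interior by different elements of `PSL₂(𝒪_K)` are disjoint. -/
def IsFundamentalDomain (F : Set (HK K)) : Prop :=
  (∀ z : HK K, ∃ A : SL(2, 𝓞 K), act (toK A) z ∈ F) ∧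
  ∀ V W : SL(2, 𝓞 K),
    (QuotientGroup.mk V : Matrix.ProjectiveSpecialLinearGroup (Fin 2) (𝓞 K)) ≠
      QuotientGroup.mk W →
    Disjoint (act (toK V) '' interior F) (act (toK W) '' interior F)

/-- The right-hand side of the formula for the distance to the cusp `(ρ : σ)`, where `N` is
the norm of the ideal `(ρ, σ)`. -/
def distFormula (z : HK K) (ρ σ : 𝓞 K) (N : ℕ) : ℝ :=
  (N : ℝ)⁻¹ * √(∏ φ : K →+* ℝ,
    ((-φ (σ : K) * xPart z φ + φ (ρ : K)) ^ 2 * (yPart z φ)⁻¹ + φ (σ : K) ^ 2 * yPart z φ))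

/-- The distance `Δ(z, (ρ : σ))` of a point to the cusp `(ρ : σ)`. -/
def cuspDist (z : HK K) (ρ σ : 𝓞 K) : ℝ :=
  distFormula z ρ σ (Ideal.absNorm (Ideal.span {ρ, σ}))

/-- The invariant height `Δ(z)`: the infimum of the distances to all the cusps.  Every point of the
projective line over `K` is `(ρ : σ)` for some `ρ`, `σ` in `𝒪_K` that are not both `0`. -/
def height (z : HK K) : ℝ :=
  ⨅ p : {p : 𝓞 K × 𝓞 K // p ≠ 0}, cuspDist z p.1.1 p.1.2

variable (K)

/-- The choices on which the fundamental domain and the algorithm depend. -/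
structure ReductionData where
  /-- an integral basis of `𝒪_K` -/
  α : Basis (Fin (deg K)) ℤ (𝓞 K)
  /-- fundamental units -/
  ε : Fin (Units.rank K) → (𝓞 K)ˣ
  ε_spec : ∀ u : (𝓞 K)ˣ, ∃! b : Fin (Units.rank K) → ℤ,
    u = ∏ k, ε k ^ b k ∨ u = -∏ k, ε k ^ b k
  /-- an integral ideal in every ideal class, of smallest norm in its class -/
  𝔞 : Fin (classNumber K) → Ideal (𝓞 K)
  𝔞_mem : ∀ j, 𝔞 j ∈ (Ideal (𝓞 K))⁰
  𝔞_bij : Function.Bijective fun j => ClassGroup.mk0 ⟨𝔞 j, 𝔞_mem j⟩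
  𝔞_min : ∀ j, ∀ I : (Ideal (𝓞 K))⁰, ClassGroup.mk0 I = ClassGroup.mk0 ⟨𝔞 j, 𝔞_mem j⟩ →
    Ideal.absNorm (𝔞 j) ≤ Ideal.absNorm (I : Ideal (𝓞 K))
  /-- representatives `(ρ j : σ j)` of the cusps; the one of the trivial class is infinity -/
  ρ : Fin (classNumber K) → 𝓞 K
  σ : Fin (classNumber K) → 𝓞 K
  span_cusp : ∀ j, Ideal.span {ρ j, σ j} = 𝔞 j
  cusp_infty : ∀ j, 𝔞 j = ⊤ → σ j = 0
  /-- the second columns of the cusp normalizing matrices -/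
  ξ : Fin (classNumber K) → K
  η : Fin (classNumber K) → K
  ξ_mem : ∀ j, ξ j ∈ ((𝔞 j : FractionalIdeal (𝓞 K)⁰ K))⁻¹
  η_mem : ∀ j, η j ∈ ((𝔞 j : FractionalIdeal (𝓞 K)⁰ K))⁻¹
  det_cusp : ∀ j, (ρ j : K) * η j - ξ j * (σ j : K) = 1
  /-- integral bases of the fractional ideals `𝔞 j ^ (-2)` -/
  β : (j : Fin (classNumber K)) →
    Basis (Fin (deg K)) ℤ ((((𝔞 j : FractionalIdeal (𝓞 K)⁰ K))⁻¹ ^ 2 : FractionalIdeal (𝓞 K)⁰ K))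

namespace ReductionData

variable {K} (D : ReductionData K)

/-- The cusp normalizing matrix `A_j`. -/
def A (j : Fin (classNumber K)) : SL(2, K) :=
  ⟨!![(D.ρ j : K), D.ξ j; (D.σ j : K), D.η j], by
    rw [Matrix.det_fin_two_of]; exact D.det_cusp j⟩

/-- The basis matrix of the lattice `𝒪_K`. -/
def BO : Matrix (K →+* ℝ) (Fin (deg K)) ℝ := Matrix.of fun φ k => φ (D.α k : K)

/-- The basis matrix of the lattice `𝔞 j ^ (-2)`. -/
def Bβ (j : Fin (classNumber K)) : Matrix (K →+* ℝ) (Fin (deg K)) ℝ :=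
  Matrix.of fun φ k => φ (D.β j k : K)

/-- The matrix `B_Λ` of the logarithms of the fundamental units. -/
def BΛ : Matrix (K →+* ℝ) (Fin (Units.rank K)) ℝ :=
  Matrix.of fun φ k => Real.log |φ ((D.ε k : 𝓞 K) : K)|

/-- The vector `log (y / N(y) ^ (1/n))`. -/
def logNormalized (y : (K →+* ℝ) → ℝ) : (K →+* ℝ) → ℝ :=
  fun φ => Real.log (y φ * (∏ ψ, y ψ) ^ (-(1 / (deg K : ℝ))))

/-- `y` is reduced with respect to the squares of the units. -/
def UnitReduced (y : (K →+* ℝ) → ℝ) : Prop :=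
  ∃ Y : Fin (Units.rank K) → ℝ, (∀ k, Y k ∈ Set.Ico (-1 : ℝ) 1) ∧
    D.BΛ.mulVec Y = logNormalized y

/-- `x` is reduced with respect to the lattice `𝔞 j ^ (-2)`. -/
def TranslationReduced (j : Fin (classNumber K)) (x : (K →+* ℝ) → ℝ) : Prop :=
  ∃ X : Fin (deg K) → ℝ, (∀ k, X k ∈ Set.Ico (-(1 / 2) : ℝ) (1 / 2)) ∧ (D.Bβ j).mulVec X = x

/-- The set `𝒞_j` of the points that are reduced with respect to the cusp `(ρ j : σ j)`. -/
def cuspDomain (j : Fin (classNumber K)) : Set (HK K) :=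
  {z | D.TranslationReduced j (xPart (act (D.A j)⁻¹ z)) ∧
    D.UnitReduced (yPart (act (D.A j)⁻¹ z))}

/-- The set `ℱ_j` of the reduced points for the cusp `(ρ j : σ j)` to which this cusp is closest. -/
def domainPart (j : Fin (classNumber K)) : Set (HK K) :=
  {z | z ∈ D.cuspDomain j ∧ height z = cuspDist z (D.ρ j) (D.σ j)}

/-- The fundamental domain `ℱ_K`, the union of the sets `ℱ_j`. -/
def fundamentalDomain : Set (HK K) := ⋃ j, D.domainPart j

/-- The maximum `C` of the norms of the ideals `𝔞 j`. -/
def C : ℕ := Finset.univ.sup fun j => Ideal.absNorm (D.𝔞 j)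

/-- The absolute row sums of `B_Λ`. -/
def rowSum (φ : K →+* ℝ) : ℝ := ∑ k, |D.BΛ φ k|

/-- The constants `D_i = C ^ (1/n) exp (r_i / 2)`. -/
def boundConst (φ : K →+* ℝ) : ℝ :=
  (D.C : ℝ) ^ (1 / (deg K : ℝ)) * Real.exp (1 / 2 * D.rowSum φ)

/-- The element of `𝒪_K` with given integral coordinates. -/
def ofCoords (X : Fin (deg K) → ℤ) : 𝓞 K := ∑ k, X k • D.α k

/-! ### The search for the closest cusp -/

/-- The norm of the ideal `(ρ, σ)`: the greatest common divisor of the maximal minors of the integral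
matrix whose rows are the coordinates of `ρ α_i` and `σ α_i`. -/
def idealNorm (ρ σ : 𝓞 K) : Prog ℕ :=
  let row : Fin (deg K) ⊕ Fin (deg K) → Fin (deg K) → ℤ :=
    Sum.elim (fun i => D.α.repr (ρ * D.α i)) (fun i => D.α.repr (σ * D.α i))
  charge (4 * deg K ^ 2) <|
  forEach (fun g (s : Fin (deg K) → Fin (deg K) ⊕ Fin (deg K)) =>
      charge (4 * deg K ^ 3) <| euclid g (Matrix.det (Matrix.of fun i => row (s i))).natAbs)
    0 (choices (deg K) fun _ => (List.finRange (deg K)).map Sum.inl ++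
      (List.finRange (deg K)).map Sum.inr)

/-- The computation of the distance to the cusp `(ρ : σ)`. -/
def computeDist (z : HK K) (p : 𝓞 K × 𝓞 K) : Prog ℝ :=
  (D.idealNorm p.1 p.2).bind fun N =>
    charge (12 * deg K + 3) <| ret (distFormula z p.1 p.2 N)

/-- The vector `ρ - σ z` of the lattice `L_z = 𝒪_K z + 𝒪_K` in `ℂ ^ n`, for `p = (ρ, σ)`. -/
def latticeVec (z : HK K) (p : 𝓞 K × 𝓞 K) : EuclideanSpace ℂ (K →+* ℝ) :=
  WithLp.toLp 2 fun φ => (φ (p.1 : K) : ℂ) - (φ (p.2 : K) : ℂ) * (z φ : ℂ)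

/-- The Gram-Schmidt vectors of a basis of `L_z`, which is a lattice of rank `2n` over `ℤ`. -/
def gramVecs (z : HK K) (b : Fin (deg K + deg K) → 𝓞 K × 𝓞 K) :
    Fin (deg K + deg K) → EuclideanSpace ℂ (K →+* ℝ) :=
  InnerProductSpace.gramSchmidt ℝ fun i => latticeVec z (b i)

/-- The Gram-Schmidt coefficient of the vector `v` along the Gram-Schmidt vector `g`. -/
def gramCoeff (g v : EuclideanSpace ℂ (K →+* ℝ)) : ℝ :=
  (∑ φ, ((g φ).re * (v φ).re + (g φ).im * (v φ).im)) / ‖g‖ ^ 2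

/-- Size reduction: for `i = 0, 1, …` and `j = i - 1, …, 0`, subtract from `b i` the multiple of `b j`
that makes the coefficient along the `j`-th Gram-Schmidt vector at most `1/2` in absolute value. -/
def sizeReduce (z : HK K) (g : Fin (deg K + deg K) → EuclideanSpace ℂ (K →+* ℝ))
    (b : Fin (deg K + deg K) → 𝓞 K × 𝓞 K) : Prog (Fin (deg K + deg K) → 𝓞 K × 𝓞 K) :=
  forEach (fun b (q : Fin (deg K + deg K) × Fin (deg K + deg K)) => charge (20 * deg K + 10) <|
      ret (Function.update b q.1
        (b q.1 - nearest (gramCoeff (g q.2) (latticeVec z (b q.1))) • b q.2)))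
    b ((List.finRange (deg K + deg K)).flatMap fun i =>
      (((List.finRange (deg K + deg K)).filter fun j => j < i).reverse).map fun j => (i, j))

open scoped Classical in
/-- The LLL algorithm with the parameter `3/4` for the lattice `L_z`: size reduce the basis; if two
consecutive vectors violate the Lovász condition, swap the first such pair and start again.
The result is the first vector of the reduced basis. -/
def lll (z : HK K) : Prog (𝓞 K × 𝓞 K) :=
  loop (fun b : Fin (deg K + deg K) → 𝓞 K × 𝓞 K =>
      let g := gramVecs z b
      charge (100 * deg K ^ 3) <|
      (sizeReduce z g b).bind fun b' =>
      charge (100 * deg K ^ 2) <|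
      match ((List.finRange (deg K + deg K)).zip (List.finRange (deg K + deg K)).tail).find?
          fun q => decide
            (‖gramCoeff (g q.1) (latticeVec z (b' q.2)) • g q.1 + g q.2‖ ^ 2
              < 3 / 4 * ‖g q.1‖ ^ 2) with
      | none => ret (Sum.inl (b' ⟨0, Nat.add_pos_left finrank_pos _⟩))
      | some q => ret (Sum.inr (b' ∘ Equiv.swap q.1 q.2)))
    (Fin.append (fun i => (D.α i, 0)) (fun i => (0, D.α i)))

/-- The integral points of the smallest box that contains the preimage under the basis matrix of
`𝒪_K` of the parallelotope with centre `c` and half side lengths `r`. -/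
def boxPoints (c r : (K →+* ℝ) → ℝ) : List (Fin (deg K) → ℤ) :=
  let M := leftInv D.BO
  choices (deg K) fun k =>
    intRange ⌈(∑ φ, M k φ * c φ) - ∑ φ, |M k φ| * r φ⌉ ⌊(∑ φ, M k φ * c φ) + ∑ φ, |M k φ| * r φ⌋

open scoped Classical in
/-- The search for a closest cusp; the result is a pair `(ρ, σ)`.  A candidate together with its
distance is kept as the state of the two nested loops. -/
def closestCusp (z : HK K) : Prog (𝓞 K × 𝓞 K) :=
  let n := deg K
  let Ny := ∏ φ, yPart z φ
  charge (n + 1) <|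
  if (D.C : ℝ) < Ny then ret (1, 0) else
  (D.lll z).bind fun l =>
  (D.computeDist z l).bind fun d₁ =>
  (D.computeDist z (1, 0)).bind fun d₂ =>
  (D.computeDist z (0, 1)).bind fun d₃ =>
  let d := min d₁ (min d₂ d₃)
  let a : (K →+* ℝ) → ℝ := fun φ =>
    D.boundConst φ * d ^ (1 / (n : ℝ)) * yPart z φ ^ (-(1 / 2) : ℝ)
  charge (4 * n ^ 2 + 10 * n + 10) <|
  (forEach (fun best X =>
      let σ := D.ofCoords X
      charge (10 * n + 10) <|
      if |∏ φ : K →+* ℝ, φ (σ : K)| ≤ d * D.C * Ny ^ (-(1 / 2) : ℝ) ∧ ∀ φ, |φ (σ : K)| ≤ a φ then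
        charge (4 * n ^ 2 + 10 * n) <|
        forEach (fun (best : (𝓞 K × 𝓞 K) × ℝ) Y =>
            let ρ := D.ofCoords Y
            charge (10 * n + 10) <|
            if (∀ φ, |φ (ρ : K) - φ (σ : K) * xPart z φ| ≤ yPart z φ * a φ) ∧ (ρ, σ) ≠ 0 then
              (D.computeDist z (ρ, σ)).bind fun δ =>
                charge 1 <| if δ < best.2 then ret ((ρ, σ), δ) else ret best
            else ret best)
          best (D.boxPoints (fun φ => φ (σ : K) * xPart z φ) fun φ => yPart z φ * a φ)
      else ret best)
    (((1, 0), d₂) : (𝓞 K × 𝓞 K) × ℝ) (D.boxPoints 0 a)).bind fun best =>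
  ret best.1

/-! ### The reduction algorithm -/

open scoped Classical in
/-- Test whether the matrix with the entries `e` lies in `SL₂(𝒪_K)` and maps the cusp
`p = (ρ : σ)` to the `j`-th cusp representative. -/
def testCusp (p : 𝓞 K × 𝓞 K) (e : Fin 4 → 𝓞 K) (j : Fin (classNumber K)) :
    Option (Fin (classNumber K) × SL(2, 𝓞 K)) :=
  if h : e 0 * e 3 - e 1 * e 2 = 1 ∧
      (e 0 * p.1 + e 1 * p.2) * D.σ j = (e 2 * p.1 + e 3 * p.2) * D.ρ j then
    some (j, ⟨!![e 0, e 1; e 2, e 3], by rw [Matrix.det_fin_two_of]; exact h.1⟩)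
  else none

/-- Find the cusp representative `(ρ j : σ j)` that is equivalent to the cusp `p = (ρ : σ)`, and a matrix
in `SL₂(𝒪_K)` that maps `p` to it, by a search through the matrices whose entries have coordinates
of absolute value at most `R`, for `R = 0, 1, 2, …`. -/
def findRep (p : 𝓞 K × 𝓞 K) : Prog (Fin (classNumber K) × SL(2, 𝓞 K)) :=
  loop (fun R : ℕ =>
      let E := (choices (deg K) fun _ => intRange (-(R : ℤ)) (R : ℤ)).map D.ofCoords
      charge (1 + 3 * deg K * E.length) <|
      (forEach (fun found (q : (Fin 4 → 𝓞 K) × Fin (classNumber K)) => charge 20 <|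
          match found with
          | some r => ret (some r)
          | none => ret (D.testCusp p q.1 q.2))
        none ((choices 4 fun _ => E).product (List.finRange (classNumber K)))).bind fun found =>
      match found with
      | some r => ret (Sum.inl r)
      | none => ret (Sum.inr (R + 1)))
    0

/-- The reduction algorithm.  The result is a matrix over `K`. -/
def reduce (z : HK K) : Prog SL(2, K) :=
  (D.closestCusp z).bind fun μ =>
  (D.findRep μ).bind fun q =>
  let j := q.1
  let U := toK q.2
  charge (100 * deg K ^ 2 + 100) <|
  let w := act ((D.A j)⁻¹ * U) z
  let Y := (leftInv D.BΛ).mulVec (logNormalized (yPart w))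
  let b : Fin (Units.rank K) → ℤ := fun k => -nearest (Y k / 2)
  charge (∑ k, (1 + (b k).natAbs)) <|
  let ε := ∏ k, D.ε k ^ b k
  let w' := act (multiplier ε) w
  let X := (leftInv (D.Bβ j)).mulVec (xPart w')
  let α : K := ∑ k, (-nearest (X k)) • (D.β j k : K)
  charge (100 * deg K ^ 2 + 100) <|
  ret (D.A j * translation α * multiplier ε * (D.A j)⁻¹ * U)

end ReductionData

end Field

end HilbertReduction

end

/-! The distance `Δ(z, μ)` is built from the positive definite forms `|r - s w|² / Im w`, one for
each real embedding. They are invariant under the simultaneous action of `SL₂` on `w` and on `(r,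
s)`. Scaling a representative `(ρ, σ)` by `a` multiplies both the square root of their product and
the norm of the ideal `(ρ, σ)` by `|N(a)|`. So `Δ` is a function on cusps, and closest cusps are
carried to closest cusps by `SL₂(𝒪_K)`.

Covering is read off from the correctness of the algorithm. The class group and Dirichlet's unit
theorem give every cusp at distance at most `d` a representative that generates some `𝔞 j` and all
of whose local forms are at most `(D_i d^(1/n))²` (`exists_bounded_representative`). A closest cusp
therefore exists and lies in the searched boxes, except in the range `N(y) > C`, where infinity is
closest (`isClosest_infty`). After the closest cusp is moved to `λ_j` and then by `A_j⁻¹` to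
infinity, multiplication by squares of units and translation by `𝔞 j ^ (-2)` bring the point into
the half-open boxes. The conjugates of these moves by `A_j` are integral and fix `λ_j`
(`exists_stabilizer`), so the cusp stays closest (`exists_act_mem_domainPart`).

For disjointness, two different cusps are equidistant only on a closed set with empty interior
(`dense_cuspDist_ne`). If interiors of two translates meet, then with `A = W⁻¹ V` some point `v` of
the overlap avoids the finitely many such sets for the pairs `(λ_j, A⁻¹ λ_k)`. At `v` the closest
cusps agree, so `A` fixes some `λ_j` and its conjugate by `A_j` is upper triangular. The half-open
boxes force its unit to be `±1` and its translation to vanish, whence `A = ±1`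
(`eq_one_or_neg_one_of_mem_domainPart`).

Running times are handled by a Hoare logic with costs (`Spec`) and by the closure of polynomially
bounded functions under sums and products (`PolyBdd`). The bounds may be crude: Euclid's algorithm
and the rounds of LLL are bounded linearly where logarithms would do. LLL is used only to know that
it ends and returns a nonzero vector of bounded length. The boxes are controlled by `d ≤ Δ(z, ∞)`,
and correctness needs only that `d` is the distance to some cusp. The search for `U` stops early
because an equivalence between a bounded cusp and its `λ_j` with bounded entries exists
(`exists_balanced_representative`, `exists_bounded_conj`). Its entries bound the logarithms of `Im
w` and with them the exponents of the units. -/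

noncomputable section

namespace HilbertReduction

/-! ### Programs and enumerations -/

section

namespace Prog

/-- The program `p` halts with a result satisfying `Q`, after at most `T` steps. -/
def Spec {α : Type*} (p : Prog α) (T : ℝ) (Q : α → Prop) : Prop :=
  ∃ a c, (∀ t, (a, t + c) ∈ p t) ∧ (c : ℝ) ≤ T ∧ Q a

theorem Spec.ret {α : Type*} {a : α} {T : ℝ} {Q : α → Prop} (hT : 0 ≤ T) (h : Q a) :
    Spec (ret a) T Q :=
  ⟨a, 0, fun t => by simp [Prog.ret], by simpa using hT, h⟩

theorem Spec.mono {α : Type*} {p : Prog α} {T T' : ℝ} {Q Q' : α → Prop} (h : Spec p T Q)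
    (hT : T ≤ T') (hQ : ∀ a, Q a → Q' a) : Spec p T' Q' := by
  obtain ⟨a, c, h1, h2, h3⟩ := h
  exact ⟨a, c, h1, h2.trans hT, hQ a h3⟩

theorem Spec.charge {α : Type*} {p : Prog α} {k : ℕ} {T : ℝ} {Q : α → Prop}
    (h : Spec p (T - k) Q) : Spec (charge k p) T Q := by
  obtain ⟨a, c, h1, h2, h3⟩ := h
  refine ⟨a, k + c, fun t => ?_, by push_cast; linarith, h3⟩
  have := h1 (t + k)
  rwa [add_assoc] at this

/-- Costs add because in `Spec` the cost does not depend on the counter at the start. The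
continuation is given the remaining budget `T - T₁`. -/
theorem Spec.bind {α β : Type*} {p : Prog α} {f : α → Prog β} {T T₁ : ℝ} {Q : α → Prop}
    {R : β → Prop} (h : Spec p T₁ Q) (hf : ∀ a, Q a → Spec (f a) (T - T₁) R) :
    Spec (bind p f) T R := by
  obtain ⟨a, c, h1, h2, h3⟩ := h
  obtain ⟨b, c', h1', h2', h3'⟩ := hf a h3
  refine ⟨b, c + c', fun t => ?_, by push_cast; linarith, h3'⟩
  refine Part.mem_bind_iff.2 ⟨(a, t + c), h1 t, ?_⟩
  have := h1' (t + c)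
  rwa [add_assoc] at this

theorem Spec.bindRet {α β : Type*} {p : Prog α} {f : α → β} {T : ℝ} {R : β → Prop}
    (h : Spec p T fun a => R (f a)) : Spec (Prog.bind p fun a => Prog.ret (f a)) T R :=
  h.bind fun a ha => Spec.ret (by simp) ha

/-- The rule for loops over a list: `Inv` is kept, and each entry `a` establishes the fact `P a`,
which is kept by the later rounds. -/
theorem Spec.forEach {α σ : Type*} {f : σ → α → Prog σ} {T : ℝ} (Inv : σ → Prop)
    (P : α → σ → Prop) : ∀ {l : List α} {s : σ},
    (∀ s, Inv s → ∀ a ∈ l, Spec (f s a) T fun s' => Inv s' ∧ P a s' ∧ ∀ b, P b s → P b s') →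
    Inv s → Spec (forEach f s l) (l.length * T)
      fun s' => Inv s' ∧ (∀ a ∈ l, P a s') ∧ ∀ b, P b s → P b s'
  | [], s, _, hs => Spec.ret (by simp) ⟨hs, by simp, fun _ h => h⟩
  | a :: l, s, hf, hs => by
    refine (hf s hs a (by simp)).bind fun s' hs' => ?_
    refine (Spec.forEach Inv P (l := l) (fun s hs b hb => hf s hs b (by simp [hb])) hs'.1).mono
      (by push_cast [List.length_cons]; linarith) fun s'' hs'' => ⟨hs''.1, ?_, fun b hb => ?_⟩
    · rintro b hb
      rcases List.mem_cons.1 hb with rfl | hb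
      · exact hs''.2.2 _ hs'.2.1
      · exact hs''.2.1 b hb
    · exact hs''.2.2 _ (hs'.2.2 _ hb)

/-- The rule for unbounded loops: `Inv k` describes the states from which at most `k` further rounds
are needed after the present one. -/
theorem Spec.loop {σ β : Type*} {body : σ → Prog (β ⊕ σ)} {T : ℝ} (Inv : ℕ → σ → Prop)
    {Q : β → Prop}
    (h : ∀ k s, Inv k s → Spec (body s) T
      (Sum.elim Q fun s' => ∃ k', k = k' + 1 ∧ Inv k' s')) :
    ∀ (k : ℕ) (s : σ), Inv k s → Spec (loop body s) ((k + 1 : ℕ) * T) Q := by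
  intro k
  induction k with
  | zero =>
    intro s hs
    obtain ⟨r, c, h1, h2, h3⟩ := h 0 s hs
    rcases r with b | s'
    · refine ⟨b, c, fun t => ?_, by simpa using h2, h3⟩
      refine PFun.mem_fix_iff.2 (Or.inl ?_)
      exact (Part.mem_map_iff _).2 ⟨_, h1 t, rfl⟩
    -- With no further round allowed the body has to answer, since `0 = k' + 1` is impossible.
    · obtain ⟨k', hk', -⟩ := h3
      omega
  | succ k ih =>
    intro s hs
    obtain ⟨r, c, h1, h2, h3⟩ := h _ s hs
    have hc : (0 : ℝ) ≤ T := (Nat.cast_nonneg c).trans h2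
    rcases r with b | s'
    · refine ⟨b, c, fun t => ?_, ?_, h3⟩
      · refine PFun.mem_fix_iff.2 (Or.inl ?_)
        exact (Part.mem_map_iff _).2 ⟨_, h1 t, rfl⟩
      · push_cast; nlinarith [(Nat.cast_nonneg k : (0 : ℝ) ≤ k)]
    · obtain ⟨k', hk', h4⟩ := h3
      obtain rfl : k = k' := by omega
      obtain ⟨b, c', h1', h2', h3'⟩ := ih s' h4
      refine ⟨b, c + c', fun t => ?_, by push_cast at h2' ⊢; linarith, h3'⟩
      refine PFun.mem_fix_iff.2 (Or.inr ⟨(s', t + c), ?_, ?_⟩)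
      · exact (Part.mem_map_iff _).2 ⟨_, h1 t, rfl⟩
      · have := h1' (t + c)
        rwa [add_assoc] at this

end Prog

open Prog

theorem intRange_eq (lo hi : ℤ) :
    intRange lo hi = (List.range (hi + 1 - lo).toNat).map fun k : ℕ => lo + (k : ℤ) := by
  simp only [intRange, bind_pure_comp, List.map_eq_map, List.map_map, Function.comp_def]

theorem mem_intRange {lo hi k : ℤ} : k ∈ intRange lo hi ↔ lo ≤ k ∧ k ≤ hi := by
  simp only [intRange_eq, List.mem_map, List.mem_range]
  constructor
  · rintro ⟨a, h, rfl⟩; omega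
  · rintro ⟨h1, h2⟩
    exact ⟨(k - lo).toNat, by omega, by omega⟩

theorem length_intRange (lo hi : ℤ) : (intRange lo hi).length = (hi + 1 - lo).toNat := by
  simp [intRange_eq]

theorem mem_choices {α : Type*} : ∀ {m : ℕ} {L : Fin m → List α} {v : Fin m → α},
    v ∈ choices m L ↔ ∀ i, v i ∈ L i
  | 0, L, v => by
    simp only [choices, List.mem_singleton, IsEmpty.forall_iff, iff_true]
    exact Subsingleton.elim _ _
  | m + 1, L, v => by
    simp only [choices, List.mem_flatMap, List.mem_map, Fin.forall_fin_succ]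
    constructor
    · rintro ⟨a, ha, w, hw, rfl⟩
      exact ⟨by simpa using ha, by simpa using mem_choices.1 hw⟩
    · rintro ⟨h0, h1⟩
      exact ⟨v 0, h0, Fin.tail v, mem_choices.2 h1, Fin.cons_self_tail v⟩

theorem length_choices {α : Type*} : ∀ {m : ℕ} (L : Fin m → List α),
    (choices m L).length = ∏ i, (L i).length
  | 0, L => by simp [choices]
  | m + 1, L => by
    simp [choices, length_choices, Fin.prod_univ_succ, List.length_flatMap]

/-- Euclid's algorithm computes the greatest common divisor, in a number of steps at most linear in
the second argument. -/
theorem spec_euclid (a b : ℕ) : Spec (euclid a b) (b + 1) fun g => g = Nat.gcd a b := by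
  -- The second entry drops strictly in every round, so it serves as the measure.
  have key := Spec.loop (body := fun s : ℕ × ℕ => Prog.charge 1 <|
    if s.2 = 0 then Prog.ret (Sum.inl s.1 : ℕ ⊕ (ℕ × ℕ))
    else Prog.ret (Sum.inr (s.2, s.1 % s.2))) (T := 1)
    (fun k s => s.2 ≤ k ∧ Nat.gcd s.1 s.2 = Nat.gcd a b) (Q := fun g => g = Nat.gcd a b) ?_ b
    (a, b) ⟨le_rfl, rfl⟩
  · exact Spec.mono key (by simp) fun _ h => h
  · rintro k ⟨x, y⟩ ⟨h1, h2⟩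
    refine Spec.charge ?_
    dsimp only at h1 h2 ⊢
    split_ifs with hy
    · exact Spec.ret (by simp) (by simpa [hy] using h2)
    · refine Spec.ret (by simp) ?_
      have hlt : x % y < y := Nat.mod_lt _ (Nat.pos_of_ne_zero hy)
      refine ⟨k - 1, by omega, by dsimp only; omega, ?_⟩
      rw [← h2, Nat.gcd_comm y, ← Nat.gcd_rec, Nat.gcd_comm]

theorem nearest_le (x : ℝ) : (nearest x : ℝ) ≤ x + 1 / 2 := Int.floor_le _

theorem lt_nearest (x : ℝ) : x - 1 / 2 < nearest x := by
  have := Int.lt_floor_add_one (x + 1 / 2)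
  rw [nearest]; linarith

theorem abs_nearest_le (x : ℝ) : |(nearest x : ℝ)| ≤ |x| + 1 := by
  have h1 := nearest_le x
  have h2 := lt_nearest x
  have := abs_le.1 (le_refl |x|)
  rw [abs_le]; constructor <;> linarith

/-! ### Polynomially bounded functions -/

section PolyBdd

variable {K : Type*} [Field K] [NumberField K]

/-- The size of a point of `ℍ_K`. -/
def size (z : HK K) : ℝ := 1 + ‖xPart z‖ + ‖yPart z‖ + ‖(yPart z)⁻¹‖

theorem one_le_size (z : HK K) : 1 ≤ size z := by
  have h1 := norm_nonneg (xPart z)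
  have h2 := norm_nonneg (yPart z)
  have h3 := norm_nonneg (yPart z)⁻¹
  rw [size]; linarith

/-- Functions on `ℍ_K` that are bounded by a polynomial in the size of the point. -/
def PolyBdd (f : HK K → ℝ) : Prop := ∃ (c : ℝ) (k : ℕ), 0 ≤ c ∧ ∀ z, |f z| ≤ c * size z ^ k

namespace PolyBdd

variable {f g : HK K → ℝ}

theorem const (c : ℝ) : PolyBdd fun _ : HK K => c := ⟨|c|, 0, abs_nonneg _, by simp⟩

theorem mono (hg : PolyBdd g) (h : ∀ z, |f z| ≤ g z) : PolyBdd f := by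
  obtain ⟨c, k, hc, hk⟩ := hg
  exact ⟨c, k, hc, fun z => (h z).trans ((le_abs_self _).trans (hk z))⟩

theorem mono' (hg : PolyBdd g) (h0 : ∀ z, 0 ≤ f z) (h : ∀ z, f z ≤ g z) : PolyBdd f :=
  hg.mono fun z => by rw [abs_of_nonneg (h0 z)]; exact h z

protected theorem abs (hf : PolyBdd f) : PolyBdd fun z => |f z| := by
  obtain ⟨c, k, hc, hk⟩ := hf
  exact ⟨c, k, hc, fun z => by simpa using hk z⟩

theorem add (hf : PolyBdd f) (hg : PolyBdd g) : PolyBdd fun z => f z + g z := by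
  obtain ⟨c, k, hc, hk⟩ := hf
  obtain ⟨c', k', hc', hk'⟩ := hg
  refine ⟨c + c', max k k', by positivity, fun z => ?_⟩
  have h1 := one_le_size z
  calc |f z + g z| ≤ |f z| + |g z| := abs_add_le _ _
    _ ≤ c * size z ^ k + c' * size z ^ k' := add_le_add (hk z) (hk' z)
    _ ≤ c * size z ^ (max k k') + c' * size z ^ (max k k') := by
        gcongr
        · exact le_max_left _ _
        · exact le_max_right _ _
    _ = _ := by ring

theorem mul (hf : PolyBdd f) (hg : PolyBdd g) : PolyBdd fun z => f z * g z := by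
  obtain ⟨c, k, hc, hk⟩ := hf
  obtain ⟨c', k', hc', hk'⟩ := hg
  refine ⟨c * c', k + k', by positivity, fun z => ?_⟩
  have h1 := one_le_size z
  calc |f z * g z| = |f z| * |g z| := abs_mul _ _
    _ ≤ (c * size z ^ k) * (c' * size z ^ k') :=
        mul_le_mul (hk z) (hk' z) (abs_nonneg _) (by positivity)
    _ = _ := by ring

theorem pow (hf : PolyBdd f) : ∀ m : ℕ, PolyBdd fun z => f z ^ m
  | 0 => by simpa using const (K := K) 1
  | m + 1 => by simpa [pow_succ] using (hf.pow m).mul hf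

theorem prod {ι : Type*} {F : ι → HK K → ℝ} (s : Finset ι) (h : ∀ i ∈ s, PolyBdd (F i)) :
    PolyBdd fun z => ∏ i ∈ s, F i z := by
  classical
  induction s using Finset.induction_on with
  | empty => simpa using const (K := K) 1
  | insert a s ha ih =>
    simp only [Finset.prod_insert ha]
    exact (h a (by simp)).mul (ih fun i hi => h i (by simp [hi]))

theorem size : PolyBdd (HilbertReduction.size (K := K)) :=
  ⟨1, 1, zero_le_one, fun z => by
    rw [abs_of_nonneg (zero_le_one.trans (one_le_size z))]; simp⟩

end PolyBdd

theorem yPart_pos (z : HK K) (φ : K →+* ℝ) : 0 < yPart z φ := (z φ).im_pos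

theorem abs_xPart_le (z : HK K) (φ : K →+* ℝ) : |xPart z φ| ≤ size z := by
  have h1 := norm_le_pi_norm (xPart z) φ
  have h2 := norm_nonneg (yPart z)
  have h3 := norm_nonneg (yPart z)⁻¹
  rw [Real.norm_eq_abs] at h1
  rw [size]; linarith

theorem yPart_le (z : HK K) (φ : K →+* ℝ) : yPart z φ ≤ size z := by
  have h1 := norm_le_pi_norm (yPart z) φ
  have h2 := norm_nonneg (xPart z)
  have h3 := norm_nonneg (yPart z)⁻¹
  rw [Real.norm_eq_abs] at h1
  rw [size]; linarith [le_abs_self (yPart z φ)]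

theorem inv_yPart_le (z : HK K) (φ : K →+* ℝ) : (yPart z φ)⁻¹ ≤ size z := by
  have h1 := norm_le_pi_norm (yPart z)⁻¹ φ
  have h2 := norm_nonneg (xPart z)
  have h3 := norm_nonneg (yPart z)
  rw [Real.norm_eq_abs, Pi.inv_apply] at h1
  rw [size]; linarith [le_abs_self (yPart z φ)⁻¹]

/-- Polynomially bounded functions are bounded by polynomials in the three norms. -/
theorem PolyBdd.exists_mvPolynomial {f : HK K → ℝ} (hf : PolyBdd f) :
    ∃ P : MvPolynomial (Fin 3) ℝ, ∀ z : HK K,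
      f z ≤ MvPolynomial.eval ![‖xPart z‖, ‖yPart z‖, ‖(yPart z)⁻¹‖] P := by
  obtain ⟨c, k, hc, hk⟩ := hf
  refine ⟨MvPolynomial.C c * (1 + MvPolynomial.X 0 + MvPolynomial.X 1 + MvPolynomial.X 2) ^ k,
    fun z => (le_abs_self _).trans ((hk z).trans (le_of_eq ?_))⟩
  simp [HilbertReduction.size]

end PolyBdd

end

/-! ### Embeddings and basis matrices -/

section

open Prog

/-! ### Matrices with a left inverse -/

/-- Over `ℝ` the matrices `BᵀB` and `B` have the same kernel. This serves `B_Λ`, which is not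
square. -/
theorem isUnit_det_transpose_mul_self {ι : Type*} [Fintype ι] {m : ℕ} {B : Matrix ι (Fin m) ℝ}
    (h : Function.Injective B.mulVec) : IsUnit (B.transpose * B).det := by
  rw [← Matrix.isUnit_iff_isUnit_det, ← Matrix.mulVec_injective_iff_isUnit]
  intro v w hvw
  have h0 : (B.transpose * B).mulVec (v - w) = 0 := by
    rw [Matrix.mulVec_sub, sub_eq_zero]; exact hvw
  have h1 : v - w ∈ LinearMap.ker (B.transpose * B).mulVecLin := h0
  rw [Matrix.ker_mulVecLin_transpose_mul_self] at h1
  have h2 : B.mulVec (v - w) = B.mulVec 0 := by simpa using h1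
  exact sub_eq_zero.1 (h h2)

theorem leftInv_mul_of_isUnit {ι : Type*} [Fintype ι] {m : ℕ} {B : Matrix ι (Fin m) ℝ}
    (h : IsUnit (B.transpose * B).det) : leftInv B * B = 1 := by
  rw [leftInv, Matrix.mul_assoc, Matrix.nonsing_inv_mul _ h]

theorem leftInv_mulVec {ι : Type*} [Fintype ι] {m : ℕ} {B : Matrix ι (Fin m) ℝ}
    (h : IsUnit (B.transpose * B).det) (v : Fin m → ℝ) : (leftInv B).mulVec (B.mulVec v) = v := by
  rw [Matrix.mulVec_mulVec, leftInv_mul_of_isUnit h, Matrix.one_mulVec]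

section Field

variable {K : Type*} [Field K] [NumberField K]

/-! ### Real embeddings of a totally real field -/

section TotallyReal

variable [IsTotallyReal K]

variable (K) in
/-- The complex embeddings of a totally real field are its real embeddings. -/
def embeddingEquiv : (K →+* ℝ) ≃ (K →+* ℂ) where
  toFun φ := Complex.ofRealHom.comp φ
  invFun ψ := (IsTotallyReal.complexEmbedding_isReal ψ).embedding
  left_inv φ := by
    ext x
    have := (IsTotallyReal.complexEmbedding_isReal
      (Complex.ofRealHom.comp φ)).coe_embedding_apply x
    exact Complex.ofReal_injective this
  right_inv ψ := by
    ext x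
    exact (IsTotallyReal.complexEmbedding_isReal ψ).coe_embedding_apply x

variable (K) in
theorem card_embeddings : Fintype.card (K →+* ℝ) = deg K := by
  rw [Fintype.card_congr (embeddingEquiv K), Embeddings.card]

theorem norm_eq_prod (x : K) : ((Algebra.norm ℚ x : ℚ) : ℝ) = ∏ φ : K →+* ℝ, φ x := by
  have h := Algebra.norm_eq_prod_embeddings ℚ ℂ x
  have h2 : ((Algebra.norm ℚ x : ℚ) : ℂ) = ∏ φ : K →+* ℝ, ((φ x : ℝ) : ℂ) := by
    rw [← eq_ratCast (algebraMap ℚ ℂ), h]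
    exact (Fintype.prod_equiv ((embeddingEquiv K).trans (RingHom.equivRatAlgHom K ℂ)) _ _
      fun φ => rfl).symm
  exact_mod_cast h2

theorem trace_eq_sum (x : K) : ((Algebra.trace ℚ K x : ℚ) : ℝ) = ∑ φ : K →+* ℝ, φ x := by
  have h := trace_eq_sum_embeddings (K := ℚ) (L := K) ℂ (x := x)
  have h2 : ((Algebra.trace ℚ K x : ℚ) : ℂ) = ∑ φ : K →+* ℝ, ((φ x : ℝ) : ℂ) := by
    rw [← eq_ratCast (algebraMap ℚ ℂ), h]
    exact (Fintype.sum_equiv ((embeddingEquiv K).trans (RingHom.equivRatAlgHom K ℂ)) _ _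
      fun φ => rfl).symm
  exact_mod_cast h2

theorem absNorm_span_singleton_eq (x : 𝓞 K) :
    ((Ideal.absNorm (Ideal.span {x}) : ℕ) : ℝ) = |∏ φ : K →+* ℝ, φ (x : K)| := by
  rw [Ideal.absNorm_span_singleton, ← norm_eq_prod, ← Algebra.coe_norm_int]
  simp [Nat.cast_natAbs]

/-- The product is up to sign the norm of a nonzero ideal, a positive integer. Lower bounds for
single conjugates come from here. -/
theorem one_le_abs_prod {x : 𝓞 K} (hx : x ≠ 0) : 1 ≤ |∏ φ : K →+* ℝ, φ (x : K)| := by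
  rw [← absNorm_span_singleton_eq]
  have : Ideal.absNorm (Ideal.span {x}) ≠ 0 := by
    simpa [Ideal.absNorm_eq_zero_iff] using hx
  exact_mod_cast Nat.one_le_iff_ne_zero.2 this

theorem abs_prod_unit (u : (𝓞 K)ˣ) : |∏ φ : K →+* ℝ, φ ((u : 𝓞 K) : K)| = 1 := by
  rw [← absNorm_span_singleton_eq, Ideal.span_singleton_eq_top.2 u.isUnit]
  simp

/-- `BᵀB` is the trace matrix of the basis, and its determinant is the discriminant, which does not
vanish. -/
theorem isUnit_det_of_basis (b : Basis (Fin (deg K)) ℚ K) (B : Matrix (K →+* ℝ) (Fin (deg K)) ℝ)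
    (hB : ∀ φ k, B φ k = φ (b k)) : IsUnit (B.transpose * B).det := by
  have h : B.transpose * B = (Algebra.traceMatrix ℚ b).map (algebraMap ℚ ℝ) := by
    ext i j
    simp only [Matrix.mul_apply, Matrix.transpose_apply, hB, Matrix.map_apply,
      Algebra.traceMatrix_apply, Algebra.traceForm_apply, eq_ratCast, trace_eq_sum, map_mul]
  rw [h, ← RingHom.mapMatrix_apply, ← RingHom.map_det, isUnit_iff_ne_zero]
  have := Algebra.discr_not_zero_of_basis ℚ b
  rw [Algebra.discr_def] at this
  simpa using this

open scoped Classical in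
-- There are exactly `n` real embeddings, so `B` is square and its left inverse is also a right
-- inverse.
theorem mul_leftInv {B : Matrix (K →+* ℝ) (Fin (deg K)) ℝ}
    (h : IsUnit (B.transpose * B).det) : B * leftInv B = 1 := by
  exact (Matrix.mul_eq_one_comm_of_card_eq _ _ _ (by simp [card_embeddings])).1
    (leftInv_mul_of_isUnit h)

theorem mulVec_leftInv {B : Matrix (K →+* ℝ) (Fin (deg K)) ℝ}
    (h : IsUnit (B.transpose * B).det) (v : (K →+* ℝ) → ℝ) :
    B.mulVec ((leftInv B).mulVec v) = v := by
  classical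
  rw [Matrix.mulVec_mulVec, mul_leftInv h, Matrix.one_mulVec]

end TotallyReal

/-! ### The matrices of the reduction data -/

namespace ReductionData

variable (D : ReductionData K)

theorem BO_apply (φ : K →+* ℝ) (k : Fin (deg K)) : D.BO φ k = φ (D.α k : K) := rfl
theorem Bβ_apply (j) (φ : K →+* ℝ) (k : Fin (deg K)) : D.Bβ j φ k = φ (D.β j k : K) := rfl
theorem BΛ_apply (φ : K →+* ℝ) (k) : D.BΛ φ k = Real.log |φ ((D.ε k : 𝓞 K) : K)| := rfl

/-- The integral basis of `𝒪_K` as a basis of `K`. -/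
def αBasis : Basis (Fin (deg K)) ℚ K := D.α.localizationLocalization ℚ ℤ⁰ K

theorem αBasis_apply (k : Fin (deg K)) : D.αBasis k = (D.α k : K) := by
  simp [αBasis]

/-- The inclusion of the fractional ideal `𝔞 j ^ (-2)` in `K`. -/
def invSqIncl (j : Fin (classNumber K)) :
    ((((D.𝔞 j : FractionalIdeal (𝓞 K)⁰ K))⁻¹ ^ 2 : FractionalIdeal (𝓞 K)⁰ K)) →ₗ[ℤ] K :=
  (Submodule.subtype _).restrictScalars ℤ

theorem invSqIncl_apply (j : Fin (classNumber K)) (x) : D.invSqIncl j x = (x : K) := rfl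

/-- Independence over `ℤ` passes to the fraction field `ℚ`, and `n` independent elements of `K` form
a basis. -/
theorem exists_βBasis (j : Fin (classNumber K)) :
    ∃ b : Basis (Fin (deg K)) ℚ K, ∀ k, b k = (D.β j k : K) := by
  have h1 : LinearIndependent ℤ fun k => (D.β j k : K) :=
    (D.β j).linearIndependent.map' (D.invSqIncl j)
      (LinearMap.ker_eq_bot.2 Subtype.val_injective)
  have h2 : LinearIndependent ℚ fun k => (D.β j k : K) :=
    (LinearIndependent.iff_fractionRing ℤ ℚ).1 h1
  have : Nonempty (Fin (deg K)) := ⟨⟨0, finrank_pos⟩⟩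
  exact ⟨basisOfLinearIndependentOfCardEqFinrank h2 (by simp), fun k => by simp⟩

/-- The embeddings of the element with the coordinates `X`. -/
theorem embedding_ofCoords (X : Fin (deg K) → ℤ) (φ : K →+* ℝ) :
    φ (D.ofCoords X : K) = D.BO.mulVec (fun k => (X k : ℝ)) φ := by
  simp [ofCoords, Matrix.mulVec, dotProduct, BO_apply, mul_comm]

theorem ofCoords_repr (x : 𝓞 K) : D.ofCoords (fun k => D.α.repr x k) = x :=
  D.α.sum_repr x

theorem exists_coords_of_mem (j : Fin (classNumber K)) {x : K}
    (hx : x ∈ ((D.𝔞 j : FractionalIdeal (𝓞 K)⁰ K))⁻¹ ^ 2) :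
    ∃ X : Fin (deg K) → ℤ, x = ∑ k, X k • (D.β j k : K) := by
  refine ⟨fun k => (D.β j).repr ⟨x, hx⟩ k, ?_⟩
  have := congrArg (D.invSqIncl j) ((D.β j).sum_repr ⟨x, hx⟩)
  rw [map_sum] at this
  simp only [map_smul, invSqIncl_apply] at this
  exact this.symm

theorem sum_mem_inv_sq (j : Fin (classNumber K)) (X : Fin (deg K) → ℤ) :
    ∑ k, X k • (D.β j k : K) ∈ ((D.𝔞 j : FractionalIdeal (𝓞 K)⁰ K))⁻¹ ^ 2 := by
  have := (∑ k, X k • D.β j k).2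
  rw [← invSqIncl_apply, map_sum] at this
  simp only [map_smul, invSqIncl_apply] at this
  exact this

theorem embedding_sum_β (j : Fin (classNumber K)) (X : Fin (deg K) → ℤ) (φ : K →+* ℝ) :
    φ (∑ k, X k • (D.β j k : K)) = (D.Bβ j).mulVec (fun k => (X k : ℝ)) φ := by
  simp [Matrix.mulVec, dotProduct, Bβ_apply, mul_comm]

theorem BΛ_mulVec_int (b : Fin (Units.rank K) → ℤ) (φ : K →+* ℝ) :
    D.BΛ.mulVec (fun k => (b k : ℝ)) φ =
      Real.log |φ (((∏ k, D.ε k ^ b k : (𝓞 K)ˣ) : 𝓞 K) : K)| := by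
  have h : φ (((∏ k, D.ε k ^ b k : (𝓞 K)ˣ) : 𝓞 K) : K) =
      ∏ k, φ ((D.ε k : 𝓞 K) : K) ^ b k := by
    have h1 : ∀ u : (𝓞 K)ˣ, φ ((u : 𝓞 K) : K) =
        ((Units.map ((φ.comp (algebraMap (𝓞 K) K)) : 𝓞 K →* ℝ) u : ℝˣ) : ℝ) := fun u => rfl
    simp only [h1, map_prod, map_zpow, Units.coe_prod, Units.val_zpow_eq_zpow_val]
  rw [h, Finset.abs_prod, Real.log_prod]
  · simp [Matrix.mulVec, dotProduct, BΛ_apply, abs_zpow, mul_comm]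
  · intro k _
    rw [abs_zpow]
    exact zpow_ne_zero _ (by simp)

variable [IsTotallyReal K]

theorem isUnit_BO : IsUnit (D.BO.transpose * D.BO).det :=
  isUnit_det_of_basis D.αBasis _ fun φ k => by rw [αBasis_apply]; rfl

theorem isUnit_Bβ (j : Fin (classNumber K)) : IsUnit ((D.Bβ j).transpose * D.Bβ j).det := by
  obtain ⟨b, hb⟩ := D.exists_βBasis j
  exact isUnit_det_of_basis b _ fun φ k => by rw [hb]; rfl

open Units Units.dirichletUnitTheorem in
-- By `ε_spec` the units `ε k` generate the unit group together with `-1`, which is torsion. So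
-- modulo torsion the index is finite.
theorem isMaxRank : IsMaxRank D.ε := by
  rw [isMaxRank_iff_closure_finiteIndex, finiteIndex_iff_sup_torsion_finiteIndex]
  have : Subgroup.closure (Set.range D.ε) ⊔ torsion K = ⊤ := by
    rw [eq_top_iff]
    rintro u -
    obtain ⟨b, hb, -⟩ := D.ε_spec u
    have hp : ∏ k, D.ε k ^ b k ∈ Subgroup.closure (Set.range D.ε) :=
      Subgroup.prod_mem _ fun k _ => Subgroup.zpow_mem _ (Subgroup.subset_closure (Set.mem_range_self k)) _
    rcases hb with hb | hb
    · rw [hb]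
      exact Subgroup.mem_sup_left hp
    · have : u = (∏ k, D.ε k ^ b k) * (-1) := by rw [hb]; simp
      rw [this]
      refine Subgroup.mul_mem_sup hp ?_
      rw [torsion, CommGroup.mem_torsion]
      exact isOfFinOrder_iff_pow_eq_one.2 (Exists.intro 2 (And.intro (by norm_num) (by simp)))
  rw [this]
  infer_instance

/-- The place of a real embedding. -/
def place (φ : K →+* ℝ) : InfinitePlace K := InfinitePlace.mk (embeddingEquiv K φ)

theorem place_apply (φ : K →+* ℝ) (x : K) : place φ x = |φ x| := by
  simp [place, embeddingEquiv]

variable (K) in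
theorem place_bijective : Function.Bijective (place (K := K)) := by
  constructor
  · intro φ ψ h
    apply (embeddingEquiv K).injective
    rcases InfinitePlace.mk_eq_iff.1 h with h | h
    · exact h
    · rwa [ComplexEmbedding.isReal_iff.1 (IsTotallyReal.complexEmbedding_isReal _)] at h
  · intro w
    refine ⟨(embeddingEquiv K).symm w.embedding, ?_⟩
    simp [place]

open Units Units.dirichletUnitTheorem in
-- The logarithmic embedding omits the place `w₀`, whereas `B_Λ` has a row for every embedding. The
-- two agree in the other rows because all places are real and have multiplicity one.
theorem logEmbedding_sum (Y : Fin (Units.rank K) → ℝ) (φ : K →+* ℝ) (h : place φ ≠ w₀) :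
    (∑ k, Y k • logEmbedding K (Additive.ofMul (D.ε k))) ⟨place φ, h⟩ = D.BΛ.mulVec Y φ := by
  simp only [Finset.sum_apply, Pi.smul_apply, logEmbedding_component, _root_.smul_eq_mul,
    IsTotallyReal.mult_eq, Matrix.mulVec, dotProduct, BΛ_apply, place_apply, Nat.cast_one, one_mul]
  exact Finset.sum_congr rfl fun k _ => mul_comm _ _

open Units Units.dirichletUnitTheorem in
theorem BΛ_injective : Function.Injective D.BΛ.mulVec := by
  have hinj : ∀ Y, D.BΛ.mulVec Y = 0 → Y = 0 := by
    intro Y hY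
    have h := Fintype.linearIndependent_iff.1 D.isMaxRank Y ?_
    · exact funext h
    · ext ⟨w, hw⟩
      obtain ⟨φ, rfl⟩ := (place_bijective K).2 w
      rw [D.logEmbedding_sum Y φ hw, hY]
      rfl
  intro Y Y' h
  exact sub_eq_zero.1 (hinj _ (by rw [Matrix.mulVec_sub, sub_eq_zero]; exact h))

theorem isUnit_BΛ : IsUnit (D.BΛ.transpose * D.BΛ).det :=
  isUnit_det_transpose_mul_self D.BΛ_injective

/-- Units have norm `±1`, so every column of `B_Λ` has sum zero. Hence the row at `w₀` is determined
by the others. -/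
theorem sum_BΛ_mulVec (Y : Fin (Units.rank K) → ℝ) : ∑ φ, D.BΛ.mulVec Y φ = 0 := by
  simp only [Matrix.mulVec, dotProduct]
  rw [Finset.sum_comm]
  refine Finset.sum_eq_zero fun k _ => ?_
  rw [← Finset.sum_mul]
  simp only [BΛ_apply]
  rw [← Real.log_prod, ← Finset.abs_prod, abs_prod_unit]
  · simp
  · simp

open Units Units.dirichletUnitTheorem in
/-- The columns of `B_Λ` span the vectors with sum zero. -/
theorem exists_BΛ_mulVec_eq (v : (K →+* ℝ) → ℝ) (hv : ∑ φ, v φ = 0) :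
    ∃ Y, D.BΛ.mulVec Y = v := by
  classical
  let e := Equiv.ofBijective _ (place_bijective K)
  let b := basisOfIsMaxRank D.isMaxRank
  refine ⟨⇑(b.repr fun w => v (e.symm w.1)), ?_⟩
  set Y : Fin (Units.rank K) → ℝ := ⇑(b.repr fun w => v (e.symm w.1))
  have hsum : ∑ k, Y k • logEmbedding K (Additive.ofMul (D.ε k)) = fun w => v (e.symm w.1) := by
    have := b.sum_repr fun w => v (e.symm w.1)
    simpa [b] using this
  have h1 : ∀ φ, place φ ≠ w₀ → D.BΛ.mulVec Y φ = v φ := by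
    intro φ hφ
    rw [← D.logEmbedding_sum Y φ hφ, hsum]
    exact congrArg v (e.symm_apply_apply φ)
  ext φ
  -- At `w₀` the two vectors agree because both have sum zero and they agree everywhere else.
  by_cases hφ : place φ = w₀
  · have h2 := D.sum_BΛ_mulVec Y
    rw [← Finset.add_sum_erase _ _ (Finset.mem_univ φ)] at h2 hv
    rw [Finset.sum_congr rfl fun ψ hψ => h1 ψ fun h =>
      (Finset.mem_erase.1 hψ).1 ((place_bijective K).1 (h.trans hφ.symm))] at h2
    linarith
  · exact h1 φ hφ

theorem BΛ_leftInv {v : (K →+* ℝ) → ℝ} (hv : ∑ φ, v φ = 0) :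
    D.BΛ.mulVec ((leftInv D.BΛ).mulVec v) = v := by
  obtain ⟨Y, rfl⟩ := D.exists_BΛ_mulVec_eq v hv
  rw [leftInv_mulVec D.isUnit_BΛ]

end ReductionData

end Field

end

/-! ### The norm of an ideal with two generators -/

section

open Prog

/-- The sum of the absolute values of the entries of a matrix. -/
def entrySum {ι κ : Type*} [Fintype ι] [Fintype κ] (M : Matrix ι κ ℝ) : ℝ := ∑ i, ∑ j, |M i j|

theorem entrySum_nonneg {ι κ : Type*} [Fintype ι] [Fintype κ] (M : Matrix ι κ ℝ) :
    0 ≤ entrySum M :=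
  Finset.sum_nonneg fun _ _ => Finset.sum_nonneg fun _ _ => abs_nonneg _

theorem sum_abs_row_le {ι κ : Type*} [Fintype ι] [Fintype κ] (M : Matrix ι κ ℝ) (i : ι) :
    ∑ j, |M i j| ≤ entrySum M :=
  Finset.single_le_sum (f := fun i => ∑ j, |M i j|)
    (fun _ _ => Finset.sum_nonneg fun _ _ => abs_nonneg _) (Finset.mem_univ i)

theorem abs_mulVec_le {ι κ : Type*} [Fintype ι] [Fintype κ] (M : Matrix ι κ ℝ) {v : κ → ℝ} {B : ℝ}
    (hv : ∀ j, |v j| ≤ B) (hB : 0 ≤ B) (i : ι) : |M.mulVec v i| ≤ entrySum M * B := by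
  calc |M.mulVec v i| ≤ ∑ j, |M i j * v j| := Finset.abs_sum_le_sum_abs _ _
    _ ≤ ∑ j, |M i j| * B := Finset.sum_le_sum fun j _ => by
        rw [abs_mul]; exact mul_le_mul_of_nonneg_left (hv j) (abs_nonneg _)
    _ = (∑ j, |M i j|) * B := by rw [Finset.sum_mul]
    _ ≤ _ := mul_le_mul_of_nonneg_right (sum_abs_row_le M i) hB

section Field

variable {K : Type*} [Field K] [NumberField K]

theorem prod_le_pow_deg [IsTotallyReal K] {f : (K →+* ℝ) → ℝ} {B : ℝ} (h0 : ∀ φ, 0 ≤ f φ)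
    (h : ∀ φ, f φ ≤ B) : ∏ φ, f φ ≤ B ^ deg K := by
  rw [← card_embeddings K]
  exact (Finset.prod_le_prod (fun φ _ => h0 φ) fun φ _ => h φ).trans (by simp)

namespace ReductionData

variable (D : ReductionData K)

theorem abs_embedding_ofCoords_le {X : Fin (deg K) → ℤ} {R : ℝ} (hX : ∀ k, |(X k : ℝ)| ≤ R)
    (hR : 0 ≤ R) (φ : K →+* ℝ) : |φ (D.ofCoords X : K)| ≤ entrySum D.BO * R := by
  rw [embedding_ofCoords]
  exact abs_mulVec_le _ hX hR φ

section TotallyReal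

variable [IsTotallyReal K]

theorem repr_eq_leftInv (x : 𝓞 K) :
    (fun k => (D.α.repr x k : ℝ)) = (leftInv D.BO).mulVec fun φ => φ (x : K) := by
  have : (fun φ : K →+* ℝ => φ (x : K)) = D.BO.mulVec fun k => (D.α.repr x k : ℝ) := by
    ext φ
    rw [← embedding_ofCoords, ofCoords_repr]
  rw [this, leftInv_mulVec D.isUnit_BO]

theorem abs_repr_le {x : 𝓞 K} {B : ℝ} (hx : ∀ φ : K →+* ℝ, |φ (x : K)| ≤ B) (hB : 0 ≤ B)
    (k : Fin (deg K)) : |(D.α.repr x k : ℝ)| ≤ entrySum (leftInv D.BO) * B := by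
  rw [congrFun (D.repr_eq_leftInv x) k]
  exact abs_mulVec_le _ hx hB k

end TotallyReal

/-- The generators `ρ α_i`, `σ α_i` of the ideal `(ρ, σ)` as a module over `ℤ`. -/
def idealGen (ρ σ : 𝓞 K) : Fin (deg K) ⊕ Fin (deg K) → 𝓞 K :=
  Sum.elim (fun i => ρ * D.α i) (fun i => σ * D.α i)

/-- A maximal minor of the matrix of the coordinates of the generators. -/
def minor (ρ σ : 𝓞 K) (s : Fin (deg K) → Fin (deg K) ⊕ Fin (deg K)) : ℤ :=
  Matrix.det (Matrix.of fun i => Sum.elim (fun i => ⇑(D.α.repr (ρ * D.α i)))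
    (fun i => ⇑(D.α.repr (σ * D.α i))) (s i))

theorem minor_eq_det (ρ σ : 𝓞 K) (s : Fin (deg K) → Fin (deg K) ⊕ Fin (deg K)) :
    D.minor ρ σ s = D.α.det fun i => D.idealGen ρ σ (s i) := by
  rw [Basis.det_apply, ← Matrix.det_transpose, minor]
  congr 1
  ext i k
  rw [Matrix.transpose_apply, Basis.toMatrix_apply, Matrix.of_apply, idealGen]
  rcases s i with l | l <;> rfl

theorem exists_eq_sum_idealGen {ρ σ x : 𝓞 K} (hx : x ∈ Ideal.span {ρ, σ}) :
    ∃ c : Fin (deg K) ⊕ Fin (deg K) → ℤ, x = ∑ k, c k • D.idealGen ρ σ k := by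
  obtain ⟨a, b, rfl⟩ := Ideal.mem_span_pair.1 hx
  refine ⟨Sum.elim (D.α.repr a) (D.α.repr b), ?_⟩
  rw [Fintype.sum_sum_type]
  simp only [Sum.elim_inl, Sum.elim_inr, idealGen, mul_comm ρ, mul_comm σ, ← smul_mul_assoc,
    ← Finset.sum_mul, D.α.sum_repr]

theorem idealGen_mem (ρ σ : 𝓞 K) (k) : D.idealGen ρ σ k ∈ Ideal.span {ρ, σ} := by
  rcases k with k | k
  · exact Ideal.mul_mem_right _ _ (Ideal.subset_span (by simp))
  · exact Ideal.mul_mem_right _ _ (Ideal.subset_span (by simp))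

/-- Write the chosen generators in a `ℤ`-basis of the ideal. The coordinate matrix then factors as
the matrix of that basis, of determinant `± N`, times an integral matrix. The zero ideal is treated
separately, since it has no such basis. -/
theorem absNorm_dvd_minor (ρ σ : 𝓞 K) (s : Fin (deg K) → Fin (deg K) ⊕ Fin (deg K)) :
    Ideal.absNorm (Ideal.span {ρ, σ}) ∣ (D.minor ρ σ s).natAbs := by
  by_cases hI : Ideal.span {ρ, σ} = ⊥
  · have h0 : (fun i => D.idealGen ρ σ (s i)) = 0 := by
      ext i
      have := D.idealGen_mem ρ σ (s i)
      rw [hI, Ideal.mem_bot] at this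
      rw [this]; rfl
    have : Nonempty (Fin (deg K)) := ⟨⟨0, finrank_pos⟩⟩
    rw [minor_eq_det, h0, AlternatingMap.map_zero]
    simp
  · let c := Ideal.selfBasis D.α _ hI
    rw [minor_eq_det, ← Ideal.natAbs_det_basis_change D.α _ c]
    let w : Fin (deg K) → Ideal.span {ρ, σ} := fun i => ⟨_, D.idealGen_mem ρ σ (s i)⟩
    have h : D.α.toMatrix (fun i => D.idealGen ρ σ (s i)) =
        D.α.toMatrix (Subtype.val ∘ c) * c.toMatrix w := by
      ext k i
      have h1 : D.idealGen ρ σ (s i) = ∑ l, c.repr (w i) l • (c l : 𝓞 K) := by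
        have := congrArg ((Submodule.subtype (Ideal.span {ρ, σ})).restrictScalars ℤ)
          (c.sum_repr (w i))
        rw [map_sum] at this
        exact this.symm
      rw [Basis.toMatrix_apply, h1, map_sum, Finset.sum_apply', Matrix.mul_apply]
      refine Finset.sum_congr rfl fun l _ => ?_
      rw [map_smul, Finsupp.smul_apply, Basis.toMatrix_apply, Basis.toMatrix_apply, smul_eq_mul,
        mul_comm]
      rfl
    rw [Basis.det_apply, Basis.det_apply, h, Matrix.det_mul, Int.natAbs_mul]
    exact dvd_mul_right _ _

/-- Each basis vector of the ideal is an integral combination of the generators. Multilinear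
expansion of the determinant writes `± N` as an integral combination of the minors, including the
zero ones with repeated rows. -/
theorem dvd_absNorm_of_dvd_minor (ρ σ : 𝓞 K) (g : ℕ)
    (hg : ∀ s, g ∣ (D.minor ρ σ s).natAbs) : g ∣ Ideal.absNorm (Ideal.span {ρ, σ}) := by
  by_cases hI : Ideal.span {ρ, σ} = ⊥
  · rw [hI]; simp
  · let c := Ideal.selfBasis D.α _ hI
    rw [← Ideal.natAbs_det_basis_change D.α _ c]
    choose S hS using fun i => D.exists_eq_sum_idealGen (c i).2
    have h1 : (Subtype.val ∘ c : Fin (deg K) → 𝓞 K) =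
        fun i => ∑ k, S i k • D.idealGen ρ σ k := funext hS
    rw [← Int.natCast_dvd, h1]
    have h2 := D.α.det.toMultilinearMap.map_sum fun i k => S i k • D.idealGen ρ σ k
    rw [AlternatingMap.coe_multilinearMap] at h2
    rw [h2]
    refine Finset.dvd_sum fun s _ => ?_
    have h3 := D.α.det.toMultilinearMap.map_smul_univ (fun i => S i (s i))
      fun i => D.idealGen ρ σ (s i)
    rw [AlternatingMap.coe_multilinearMap] at h3
    rw [h3, ← minor_eq_det]
    exact Dvd.dvd.mul_left (Int.natCast_dvd.2 (hg s)) _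

theorem cuspDist_nonneg (z : HK K) (ρ σ : 𝓞 K) : 0 ≤ cuspDist z ρ σ :=
  mul_nonneg (by positivity) (Real.sqrt_nonneg _)

/-- The Leibniz expansion bounds each minor by `n! (E (1 + B))^n`, and this bounds the cost of each
run of Euclid's algorithm. -/
theorem exists_idealNorm_cost [IsTotallyReal K] : ∃ c : ℝ, 0 ≤ c ∧ ∀ (ρ σ : 𝓞 K) (B : ℝ), 0 ≤ B →
    (∀ φ : K →+* ℝ, |φ (ρ : K)| ≤ B) → (∀ φ : K →+* ℝ, |φ (σ : K)| ≤ B) →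
    Spec (D.idealNorm ρ σ) (c * (1 + B) ^ deg K)
      fun N => N = Ideal.absNorm (Ideal.span {ρ, σ}) := by
  set n := deg K with hn
  -- One factor bounds the embeddings of the basis elements `α_i`, the other the passage from
  -- embeddings to coordinates.
  let E := entrySum (leftInv D.BO) * entrySum D.BO
  have hE : 0 ≤ E := mul_nonneg (entrySum_nonneg _) (entrySum_nonneg _)
  let L := choices (deg K) fun _ => (List.finRange (deg K)).map Sum.inl ++
      (List.finRange (deg K)).map (Sum.inr : _ → Fin (deg K) ⊕ Fin (deg K))
  have hL : ∀ s, s ∈ L := fun s => mem_choices.2 fun i => by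
    rcases s i with k | k <;> simp
  let c₁ : ℝ := (4 * n ^ 3 : ℕ) + (n.factorial * E ^ n + 1)
  have hc₁ : 0 ≤ c₁ := by positivity
  refine ⟨(4 * n ^ 2 : ℕ) + L.length * c₁, by positivity, fun ρ σ B hB hρ hσ => ?_⟩
  have h1B : (1 : ℝ) ≤ (1 + B) ^ n := one_le_pow₀ (by linarith)
  have hEB : ∀ k, ∀ φ : K →+* ℝ, |φ (D.idealGen ρ σ k : K)| ≤ entrySum D.BO * B := by
    intro k φ
    have hα : ∀ i, |φ (D.α i : K)| ≤ entrySum D.BO := fun i =>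
      (Finset.single_le_sum (f := fun i => |D.BO φ i|) (fun _ _ => abs_nonneg _)
        (Finset.mem_univ i)).trans (sum_abs_row_le D.BO φ)
    rcases k with i | i
    · simp only [idealGen, Sum.elim_inl, map_mul, abs_mul]
      rw [mul_comm]
      exact mul_le_mul (hα i) (hρ φ) (abs_nonneg _) (entrySum_nonneg _)
    · simp only [idealGen, Sum.elim_inr, map_mul, abs_mul]
      rw [mul_comm]
      exact mul_le_mul (hα i) (hσ φ) (abs_nonneg _) (entrySum_nonneg _)
  have hminor : ∀ s, ((D.minor ρ σ s).natAbs : ℝ) ≤ n.factorial * E ^ n * (1 + B) ^ n := by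
    intro s
    have h1 : ((D.minor ρ σ s).natAbs : ℝ) = |((D.minor ρ σ s : ℤ) : ℝ)| := by
      rw [Nat.cast_natAbs, Int.cast_abs]
    have h2 : ((D.minor ρ σ s : ℤ) : ℝ) = Matrix.det (Matrix.of fun i k =>
        (D.α.repr (D.idealGen ρ σ (s i)) k : ℝ)) := by
      refine (RingHom.map_det (Int.castRingHom ℝ) _).trans (congrArg Matrix.det ?_)
      ext i k
      simp only [RingHom.mapMatrix_apply, Matrix.map_apply, Matrix.of_apply, idealGen,
        Int.coe_castRingHom]
      rcases s i with l | l <;> rfl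
    rw [h1, h2, mul_assoc, ← mul_pow]
    have h3 := Matrix.det_le (A := Matrix.of fun i k =>
        (D.α.repr (D.idealGen ρ σ (s i)) k : ℝ)) (abv := AbsoluteValue.abs) (x := E * (1 + B)) ?_
    · simpa [nsmul_eq_mul] using h3
    · intro i k
      have := D.abs_repr_le (hEB (s i)) (mul_nonneg (entrySum_nonneg _) hB) k
      refine this.trans ?_
      rw [← mul_assoc]
      exact mul_le_mul_of_nonneg_left (by linarith) hE
  unfold idealNorm
  refine Spec.charge ?_
  -- The ideal norm always divides the running value `g`, and `g` divides every minor already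
  -- treated. The start `g = 0` is divisible by everything; at the end the two divisibilities give
  -- equality.
  refine (Spec.forEach (T := c₁ * (1 + B) ^ n)
    (Inv := fun g => Ideal.absNorm (Ideal.span {ρ, σ}) ∣ g)
    (P := fun s g => g ∣ (D.minor ρ σ s).natAbs) ?_ (dvd_zero _)).mono ?_ ?_
  · intro g hg s _
    refine Spec.charge ?_
    refine (spec_euclid g (D.minor ρ σ s).natAbs).mono ?_ ?_
    · have := hminor s
      have h2 : (0 : ℝ) ≤ (4 * n ^ 3 : ℕ) := Nat.cast_nonneg _
      simp only [c₁]
      nlinarith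
    · rintro _ rfl
      exact ⟨Nat.dvd_gcd hg (D.absNorm_dvd_minor ρ σ s), Nat.gcd_dvd_right _ _,
        fun s' hs' => (Nat.gcd_dvd_left _ _).trans hs'⟩
  · have h2 : (0 : ℝ) ≤ (4 * n ^ 2 : ℕ) := Nat.cast_nonneg _
    change (L.length : ℝ) * _ ≤ _
    nlinarith
  · rintro g ⟨h1, h2, -⟩
    exact Nat.dvd_antisymm (D.dvd_absNorm_of_dvd_minor ρ σ g fun s => h2 s (hL s)) h1

theorem exists_computeDist_cost [IsTotallyReal K] : ∃ c : ℝ, 0 ≤ c ∧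
    ∀ (z : HK K) (p : 𝓞 K × 𝓞 K) (B : ℝ), 0 ≤ B →
    (∀ φ : K →+* ℝ, |φ (p.1 : K)| ≤ B) → (∀ φ : K →+* ℝ, |φ (p.2 : K)| ≤ B) →
    Spec (D.computeDist z p) (c * (1 + B) ^ deg K) fun δ => δ = cuspDist z p.1 p.2 := by
  obtain ⟨c, hc, h⟩ := D.exists_idealNorm_cost
  refine ⟨c + (12 * deg K + 3 : ℕ), by positivity, fun z p B hB h1 h2 => ?_⟩
  have h1B : (1 : ℝ) ≤ (1 + B) ^ deg K := one_le_pow₀ (by linarith)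
  refine (h p.1 p.2 B hB h1 h2).bind fun N hN => Spec.charge (Spec.ret ?_ ?_)
  · have h3 : (0 : ℝ) ≤ (12 * deg K + 3 : ℕ) := Nat.cast_nonneg _
    nlinarith
  · rw [hN]; rfl

end ReductionData

end Field

end

/-! ### The action and the distance to a cusp -/

section

open Prog

/-! ### The action on the upper half-plane -/

/-- The positive definite quadratic form `|r - s w| ^ 2 / Im w` of a point `w` of the upper
half-plane. -/
def pointForm (w : ℍ) (r s : ℝ) : ℝ := (-s * w.re + r) ^ 2 * w.im⁻¹ + s ^ 2 * w.im

theorem pointForm_eq (w : ℍ) (r s : ℝ) :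
    pointForm w r s = Complex.normSq ((r : ℂ) - s * w) / w.im := by
  have h := w.im_pos.ne'
  rw [pointForm, Complex.normSq_apply]
  simp
  field_simp
  ring

theorem pointForm_nonneg (w : ℍ) (r s : ℝ) : 0 ≤ pointForm w r s := by
  have := w.im_pos
  rw [pointForm]; positivity

theorem pointForm_pos (w : ℍ) {r s : ℝ} (h : r ≠ 0 ∨ s ≠ 0) : 0 < pointForm w r s := by
  have := w.im_pos
  rw [pointForm]
  by_cases hs : s = 0
  · have hr : r ≠ 0 := h.resolve_right (by simpa using hs)
    subst hs
    simp only [neg_zero, zero_mul, zero_add]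
    positivity
  · positivity

theorem sq_mul_im_le_pointForm (w : ℍ) (r s : ℝ) : s ^ 2 * w.im ≤ pointForm w r s := by
  have := w.im_pos
  have h : 0 ≤ (-s * w.re + r) ^ 2 * w.im⁻¹ := by positivity
  rw [pointForm]; linarith

theorem sq_le_im_mul_pointForm (w : ℍ) (r s : ℝ) :
    (r - s * w.re) ^ 2 ≤ w.im * pointForm w r s := by
  have h := w.im_pos
  rw [pointForm, mul_add]
  have h1 : w.im * ((-s * w.re + r) ^ 2 * w.im⁻¹) = (r - s * w.re) ^ 2 := by
    field_simp; ring
  rw [h1]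
  have : 0 ≤ w.im * (s ^ 2 * w.im) := by positivity
  linarith

theorem pointForm_smul (w : ℍ) (r s t : ℝ) :
    pointForm w (t * r) (t * s) = t ^ 2 * pointForm w r s := by
  simp only [pointForm]; ring

theorem denom_ne_zero_of_sl (g : SL(2, ℝ)) (w : ℍ) : ((g 1 0 : ℝ) : ℂ) * w + (g 1 1 : ℝ) ≠ 0 := by
  intro h
  have him := congrArg Complex.im h
  have hre := congrArg Complex.re h
  simp at him hre
  have hc : g 1 0 = 0 := him.resolve_right w.im_pos.ne'
  have hd : g 1 1 = 0 := by simpa [hc] using hre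
  have := g.det_coe
  rw [Matrix.det_fin_two, hc, hd] at this
  simp at this

theorem coe_sl_smul (g : SL(2, ℝ)) (w : ℍ) : ((g • w : ℍ) : ℂ) =
    (((g 0 0 : ℝ) : ℂ) * w + (g 0 1 : ℝ)) / (((g 1 0 : ℝ) : ℂ) * w + (g 1 1 : ℝ)) := by
  rw [UpperHalfPlane.coe_specialLinearGroup_apply]; simp

theorem im_sl_smul (g : SL(2, ℝ)) (w : ℍ) :
    (g • w).im = w.im / Complex.normSq (((g 1 0 : ℝ) : ℂ) * w + (g 1 1 : ℝ)) := by
  have hdet := g.det_coe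
  rw [Matrix.det_fin_two] at hdet
  rw [← UpperHalfPlane.coe_im, coe_sl_smul, Complex.div_im, ← sub_div]
  congr 1
  simp
  linear_combination w.im * hdet

/-- With `c, d` the lower row of `g`, the number `r - s w` is divided by `c w + d` and `Im w` by `|c
w + d|²`, so the quotient `|r - s w|² / Im w` is unchanged. -/
theorem pointForm_sl_smul (g : SL(2, ℝ)) (w : ℍ) (r s : ℝ) :
    pointForm (g • w) (g 0 0 * r + g 0 1 * s) (g 1 0 * r + g 1 1 * s) = pointForm w r s := by
  have hdet := g.det_coe
  rw [Matrix.det_fin_two] at hdet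
  have hdet' : ((g 0 0 : ℝ) : ℂ) * (g 1 1 : ℝ) - (g 0 1 : ℝ) * (g 1 0 : ℝ) = 1 := by
    exact_mod_cast hdet
  have hne := denom_ne_zero_of_sl g w
  have hn := Complex.normSq_pos.2 hne
  rw [pointForm_eq, pointForm_eq, im_sl_smul, coe_sl_smul]
  have : (((g 0 0 * r + g 0 1 * s : ℝ) : ℂ) - ((g 1 0 * r + g 1 1 * s : ℝ) : ℂ) *
      ((((g 0 0 : ℝ) : ℂ) * w + (g 0 1 : ℝ)) / (((g 1 0 : ℝ) : ℂ) * w + (g 1 1 : ℝ)))) =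
      (r - s * w) / (((g 1 0 : ℝ) : ℂ) * w + (g 1 1 : ℝ)) := by
    push_cast
    field_simp
    linear_combination (r - s * (w : ℂ)) * hdet'
  rw [this, Complex.normSq_div]
  rw [div_div_div_cancel_right₀ hn.ne']

/-- The imaginary part of `g • w` is bounded by `|a w + b| ^ 2 / Im w`. -/
theorem im_sl_smul_le (g : SL(2, ℝ)) (w : ℍ) :
    (g • w).im ≤ Complex.normSq (((g 0 0 : ℝ) : ℂ) * w + (g 0 1 : ℝ)) / w.im := by
  have hdet := g.det_coe
  rw [Matrix.det_fin_two] at hdet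
  have hn := Complex.normSq_pos.2 (denom_ne_zero_of_sl g w)
  have h := w.im_pos
  rw [im_sl_smul, div_le_div_iff₀ hn h]
  -- For `u = a w + b` and `v = c w + d` this is `|u v̄|² = (Im u v̄)² + (Re u v̄)²`, where `Im u v̄
  -- = Im w` since the determinant is `1`.
  have key : Complex.normSq (((g 0 0 : ℝ) : ℂ) * w + (g 0 1 : ℝ)) *
      Complex.normSq (((g 1 0 : ℝ) : ℂ) * w + (g 1 1 : ℝ)) = w.im ^ 2 +
      ((g 0 0 * w.re + g 0 1) * (g 1 0 * w.re + g 1 1) + g 0 0 * g 1 0 * w.im ^ 2) ^ 2 := by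
    simp only [Complex.normSq_apply]
    simp
    linear_combination (w.im ^ 2 * (g 0 0 * g 1 1 - g 0 1 * g 1 0 + 1)) * hdet
  rw [key]
  nlinarith [sq_nonneg ((g 0 0 * w.re + g 0 1) * (g 1 0 * w.re + g 1 1) +
    g 0 0 * g 1 0 * w.im ^ 2)]

section Field

variable {K : Type*} [Field K] [NumberField K]

theorem act_mul (A B : SL(2, K)) (z : HK K) : act (A * B) z = act A (act B z) := by
  ext φ
  simp only [act, map_mul, mul_smul]

theorem act_one (z : HK K) : act 1 z = z := by
  ext φ
  simp only [act, map_one, one_smul]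

theorem continuous_act (A : SL(2, K)) : Continuous (act A) :=
  continuous_pi fun φ => (continuous_const_smul _).comp (continuous_apply φ)

/-- The linear action of `SL₂(𝒪_K)` on pairs. -/
def mulPair (A : SL(2, 𝓞 K)) (p : 𝓞 K × 𝓞 K) : 𝓞 K × 𝓞 K :=
  (A 0 0 * p.1 + A 0 1 * p.2, A 1 0 * p.1 + A 1 1 * p.2)

theorem mulPair_mul (A B : SL(2, 𝓞 K)) (p : 𝓞 K × 𝓞 K) :
    mulPair (A * B) p = mulPair A (mulPair B p) := by
  simp only [mulPair, Matrix.SpecialLinearGroup.coe_mul, Matrix.mul_apply, Fin.sum_univ_two]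
  ext <;> ring_nf

theorem mulPair_one (p : 𝓞 K × 𝓞 K) : mulPair 1 p = p := by
  simp [mulPair]

theorem mulPair_inv_mulPair (A : SL(2, 𝓞 K)) (p : 𝓞 K × 𝓞 K) :
    mulPair A⁻¹ (mulPair A p) = p := by
  rw [← mulPair_mul, inv_mul_cancel, mulPair_one]

theorem mulPair_mulPair_inv (A : SL(2, 𝓞 K)) (p : 𝓞 K × 𝓞 K) :
    mulPair A (mulPair A⁻¹ p) = p := by
  rw [← mulPair_mul, mul_inv_cancel, mulPair_one]

theorem mulPair_zero (A : SL(2, 𝓞 K)) : mulPair A 0 = 0 := by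
  ext <;> simp [mulPair]

theorem mulPair_ne_zero (A : SL(2, 𝓞 K)) {p : 𝓞 K × 𝓞 K} (hp : p ≠ 0) : mulPair A p ≠ 0 := by
  intro h
  apply hp
  rw [← mulPair_inv_mulPair A p, h, mulPair_zero]

theorem span_mulPair_le (A : SL(2, 𝓞 K)) (p : 𝓞 K × 𝓞 K) :
    Ideal.span {(mulPair A p).1, (mulPair A p).2} ≤ Ideal.span {p.1, p.2} := by
  rw [Ideal.span_le]
  have h1 : p.1 ∈ Ideal.span {p.1, p.2} := Ideal.subset_span (by simp)
  have h2 : p.2 ∈ Ideal.span {p.1, p.2} := Ideal.subset_span (by simp)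
  rintro x (rfl | rfl)
  · exact add_mem (Ideal.mul_mem_left _ _ h1) (Ideal.mul_mem_left _ _ h2)
  · exact add_mem (Ideal.mul_mem_left _ _ h1) (Ideal.mul_mem_left _ _ h2)

theorem span_mulPair (A : SL(2, 𝓞 K)) (p : 𝓞 K × 𝓞 K) :
    Ideal.span {(mulPair A p).1, (mulPair A p).2} = Ideal.span {p.1, p.2} := by
  refine le_antisymm (span_mulPair_le A p) ?_
  have := span_mulPair_le A⁻¹ (mulPair A p)
  rwa [mulPair_inv_mulPair] at this

/-! ### The distances to the cusps -/

theorem cuspDist_eq (z : HK K) (ρ σ : 𝓞 K) :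
    cuspDist z ρ σ = (Ideal.absNorm (Ideal.span {ρ, σ}) : ℝ)⁻¹ *
      √(∏ φ : K →+* ℝ, pointForm (z φ) (φ (ρ : K)) (φ (σ : K))) := rfl

/-- Each local form is invariant, and so is the ideal generated by the pair, because `A` and its
inverse are integral. -/
theorem cuspDist_mulPair (A : SL(2, 𝓞 K)) (z : HK K) (p : 𝓞 K × 𝓞 K) :
    cuspDist (act (toK A) z) (mulPair A p).1 (mulPair A p).2 = cuspDist z p.1 p.2 := by
  rw [cuspDist_eq, cuspDist_eq, span_mulPair]
  congr 3
  ext φ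
  rw [← pointForm_sl_smul (Matrix.SpecialLinearGroup.map φ (toK A)) (z φ)]
  simp [act, mulPair, toK]

theorem ne_zero_embedding {p : 𝓞 K × 𝓞 K} (hp : p ≠ 0) (φ : K →+* ℝ) :
    φ (p.1 : K) ≠ 0 ∨ φ (p.2 : K) ≠ 0 := by
  by_contra h
  push Not at h
  apply hp
  ext
  · simpa using h.1
  · simpa using h.2

theorem span_ne_bot {p : 𝓞 K × 𝓞 K} (hp : p ≠ 0) : Ideal.span {p.1, p.2} ≠ ⊥ := by
  intro h
  apply hp
  rw [Ideal.span_eq_bot] at h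
  exact Prod.ext (h _ (by simp)) (h _ (by simp))

theorem absNorm_span_pos {p : 𝓞 K × 𝓞 K} (hp : p ≠ 0) :
    0 < Ideal.absNorm (Ideal.span {p.1, p.2}) :=
  Nat.pos_of_ne_zero (by rw [Ne, Ideal.absNorm_eq_zero_iff]; exact span_ne_bot hp)

theorem span_mul_pair (a ρ σ : 𝓞 K) :
    Ideal.span {a * ρ, a * σ} = Ideal.span {a} * Ideal.span {ρ, σ} := by
  rw [Ideal.span_mul_span']
  congr 1
  simp [Set.singleton_mul, Set.image_pair]

/-- The pairs `p` and `q` represent the same point of the projective line. -/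
def SameCusp (p q : 𝓞 K × 𝓞 K) : Prop := p.1 * q.2 = q.1 * p.2

theorem SameCusp.symm {p q : 𝓞 K × 𝓞 K} (h : SameCusp p q) : SameCusp q p := Eq.symm h

theorem sameCusp_mulPair (A : SL(2, 𝓞 K)) {p q : 𝓞 K × 𝓞 K} (h : SameCusp p q) :
    SameCusp (mulPair A p) (mulPair A q) := by
  have hdet := A.det_coe
  rw [Matrix.det_fin_two] at hdet
  simp only [SameCusp, mulPair] at h ⊢
  linear_combination (A 0 0 * A 1 1 - A 0 1 * A 1 0) * h

/-- Representatives of the same cusp are proportional. -/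
theorem SameCusp.exists_mul_eq {p q : 𝓞 K × 𝓞 K} (h : SameCusp p q) (hp : p ≠ 0) (hq : q ≠ 0) :
    ∃ a b : 𝓞 K, a ≠ 0 ∧ b ≠ 0 ∧ a * p.1 = b * q.1 ∧ a * p.2 = b * q.2 := by
  rw [SameCusp] at h
  by_cases h2 : p.2 = 0
  · have h1 : p.1 ≠ 0 := fun h1 => hp (Prod.ext h1 h2)
    have h4 : q.2 = 0 := by
      rw [h2, mul_zero] at h
      exact (mul_eq_zero.1 h).resolve_left h1
    have h3 : q.1 ≠ 0 := fun h3 => hq (Prod.ext h3 h4)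
    exact ⟨q.1, p.1, h3, h1, mul_comm _ _, by rw [h2, h4, mul_zero, mul_zero]⟩
  · have h4 : q.2 ≠ 0 := by
      intro h4
      rw [h4, mul_zero] at h
      have h3 := (mul_eq_zero.1 h.symm).resolve_right h2
      exact hq (Prod.ext h3 h4)
    exact ⟨q.2, p.2, h4, h2, by rw [mul_comm, h, mul_comm], mul_comm _ _⟩

section TotallyReal

variable [IsTotallyReal K]

/-- The root of the product of the forms and the norm of the ideal both acquire the factor `|N(a)|`.
-/
theorem cuspDist_mul (z : HK K) {a : 𝓞 K} (ha : a ≠ 0) (ρ σ : 𝓞 K) :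
    cuspDist z (a * ρ) (a * σ) = cuspDist z ρ σ := by
  have h1 := one_le_abs_prod ha
  have hpos : 0 < |∏ φ : K →+* ℝ, φ (a : K)| := by linarith
  have h2 : ∏ φ : K →+* ℝ, pointForm (z φ) (φ ((a * ρ : 𝓞 K) : K)) (φ ((a * σ : 𝓞 K) : K)) =
      |∏ φ : K →+* ℝ, φ (a : K)| ^ 2 *
        ∏ φ : K →+* ℝ, pointForm (z φ) (φ (ρ : K)) (φ (σ : K)) := by
    rw [sq_abs, ← Finset.prod_pow, ← Finset.prod_mul_distrib]
    refine Finset.prod_congr rfl fun φ _ => ?_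
    simp only [map_mul, pointForm_smul]
  rw [cuspDist_eq, cuspDist_eq, span_mul_pair, map_mul, Nat.cast_mul, absNorm_span_singleton_eq,
    h2, Real.sqrt_mul (sq_nonneg _), Real.sqrt_sq hpos.le, mul_inv]
  field_simp

theorem SameCusp.cuspDist_eq {p q : 𝓞 K × 𝓞 K} (h : SameCusp p q) (hp : p ≠ 0) (hq : q ≠ 0)
    (z : HK K) : cuspDist z p.1 p.2 = cuspDist z q.1 q.2 := by
  obtain ⟨a, b, ha, hb, h1, h2⟩ := h.exists_mul_eq hp hq
  rw [← cuspDist_mul z ha, h1, h2, cuspDist_mul z hb]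

end TotallyReal

/-- The cusp represented by `p` is a closest cusp of `z`. -/
def IsClosest (z : HK K) (p : 𝓞 K × 𝓞 K) : Prop :=
  p ≠ 0 ∧ ∀ q : 𝓞 K × 𝓞 K, q ≠ 0 → cuspDist z p.1 p.2 ≤ cuspDist z q.1 q.2

/-- Distances are nonnegative, so the real infimum in `height` is a true lower bound and not the
default value of an unbounded set. -/
theorem isClosest_iff {z : HK K} {p : 𝓞 K × 𝓞 K} (hp : p ≠ 0) :
    IsClosest z p ↔ height z = cuspDist z p.1 p.2 := by
  have hbdd : BddBelow (Set.range fun p : {p : 𝓞 K × 𝓞 K // p ≠ 0} => cuspDist z p.1.1 p.1.2) :=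
    ⟨0, by rintro _ ⟨q, rfl⟩; exact ReductionData.cuspDist_nonneg z _ _⟩
  have : Nonempty {p : 𝓞 K × 𝓞 K // p ≠ 0} := ⟨⟨p, hp⟩⟩
  constructor
  · intro h
    exact le_antisymm (ciInf_le hbdd ⟨p, hp⟩) (le_ciInf fun q => h.2 q.1 q.2)
  · intro h
    refine ⟨hp, fun q hq => ?_⟩
    rw [← h]
    exact ciInf_le hbdd ⟨q, hq⟩

theorem IsClosest.mulPair {z : HK K} {p : 𝓞 K × 𝓞 K} (h : IsClosest z p) (A : SL(2, 𝓞 K)) :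
    IsClosest (act (toK A) z) (mulPair A p) := by
  refine ⟨mulPair_ne_zero A h.1, fun q hq => ?_⟩
  rw [cuspDist_mulPair, ← mulPair_mulPair_inv A q, cuspDist_mulPair]
  exact h.2 _ (mulPair_ne_zero _ hq)

theorem IsClosest.sameCusp [IsTotallyReal K] {z : HK K} {p q : 𝓞 K × 𝓞 K} (h : IsClosest z p)
    (hpq : SameCusp p q) (hq : q ≠ 0) : IsClosest z q :=
  ⟨hq, fun r hr => by rw [← hpq.cuspDist_eq h.1 hq]; exact h.2 r hr⟩

end Field

end

/-! ### Units and bounded representatives of cusps -/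

section

open Prog

section Field

variable {K : Type*} [Field K] [NumberField K]

theorem unit_embedding_ne_zero (u : (𝓞 K)ˣ) (φ : K →+* ℝ) : φ ((u : 𝓞 K) : K) ≠ 0 := by
  simp

namespace ReductionData

variable (D : ReductionData K)

theorem logNormalized_apply {y : (K →+* ℝ) → ℝ} (hy : ∀ φ, 0 < y φ) (φ : K →+* ℝ) :
    logNormalized y φ = Real.log (y φ) - 1 / (deg K : ℝ) * ∑ ψ, Real.log (y ψ) := by
  have hN : 0 < ∏ ψ, y ψ := Finset.prod_pos fun ψ _ => hy ψ
  rw [logNormalized, Real.log_mul (hy φ).ne' (Real.rpow_pos_of_pos hN _).ne', Real.log_rpow hN,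
    Real.log_prod fun ψ _ => (hy ψ).ne']
  ring

section TotallyReal

variable [IsTotallyReal K]

theorem deg_pos : (0 : ℝ) < deg K := by exact_mod_cast (finrank_pos : 0 < finrank ℚ K)

theorem sum_logNormalized {y : (K →+* ℝ) → ℝ} (hy : ∀ φ, 0 < y φ) :
    ∑ φ, logNormalized y φ = 0 := by
  have := deg_pos (K := K)
  simp only [logNormalized_apply hy, Finset.sum_sub_distrib, Finset.sum_const, Finset.card_univ,
    card_embeddings, nsmul_eq_mul]
  field_simp
  ring

theorem sum_log_unit (u : (𝓞 K)ˣ) : ∑ φ : K →+* ℝ, Real.log |φ ((u : 𝓞 K) : K)| = 0 := by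
  rw [← Real.log_prod fun φ _ => abs_ne_zero.2 (unit_embedding_ne_zero u φ), ← Finset.abs_prod,
    abs_prod_unit, Real.log_one]

/-- The square of a unit has norm `1`, so the normalizing factor does not change. -/
theorem logNormalized_unit_sq_mul {y : (K →+* ℝ) → ℝ} (hy : ∀ φ, 0 < y φ) (u : (𝓞 K)ˣ)
    (φ : K →+* ℝ) : logNormalized (fun φ => φ ((u : 𝓞 K) : K) ^ 2 * y φ) φ =
      2 * Real.log |φ ((u : 𝓞 K) : K)| + logNormalized y φ := by
  have hu : ∀ φ : K →+* ℝ, 0 < φ ((u : 𝓞 K) : K) ^ 2 := fun φ =>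
    pow_pos_of_ne_zero φ
  have h : ∀ φ : K →+* ℝ, Real.log (φ ((u : 𝓞 K) : K) ^ 2 * y φ) =
      2 * Real.log |φ ((u : 𝓞 K) : K)| + Real.log (y φ) := fun φ => by
    rw [Real.log_mul (hu φ).ne' (hy φ).ne', ← sq_abs, Real.log_pow]
    norm_num
  rw [logNormalized_apply (fun φ => mul_pos (hu φ) (hy φ)), logNormalized_apply hy]
  simp only [h, Finset.sum_add_distrib, ← Finset.mul_sum, sum_log_unit]
  ring
where
  pow_pos_of_ne_zero (φ : K →+* ℝ) : 0 < φ ((u : 𝓞 K) : K) ^ 2 :=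
    sq_pos_of_ne_zero (unit_embedding_ne_zero u φ)

/-- The unit of the reduction step. -/
def reducingUnit (y : (K →+* ℝ) → ℝ) : (𝓞 K)ˣ :=
  ∏ k, D.ε k ^ (-nearest ((leftInv D.BΛ).mulVec (logNormalized y) k / 2))

/-- Multiplication by the square of `∏ ε_k ^ b_k` shifts the coordinates `Y` by `2 b`. With `-b_k`
nearest to `Y_k / 2` the result lies in `[-1, 1)`, with the closed end on the correct side. -/
theorem unitReduced_reducingUnit {y : (K →+* ℝ) → ℝ} (hy : ∀ φ, 0 < y φ) :
    D.UnitReduced fun φ => φ ((D.reducingUnit y : 𝓞 K) : K) ^ 2 * y φ := by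
  set Y := (leftInv D.BΛ).mulVec (logNormalized y) with hY
  set b : Fin (Units.rank K) → ℤ := fun k => -nearest (Y k / 2) with hb
  have hu : D.reducingUnit y = ∏ k, D.ε k ^ b k := rfl
  refine ⟨(2 : ℝ) • (fun k => (b k : ℝ)) + Y, fun k => ?_, ?_⟩
  · have h1 := nearest_le (Y k / 2)
    have h2 := lt_nearest (Y k / 2)
    simp only [Pi.add_apply, Pi.smul_apply, smul_eq_mul, hb, Int.cast_neg, Set.mem_Ico]
    constructor <;> linarith
  · ext φ
    rw [logNormalized_unit_sq_mul hy, Matrix.mulVec_add, Matrix.mulVec_smul, Pi.add_apply,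
      Pi.smul_apply, BΛ_mulVec_int, ← hu, hY, D.BΛ_leftInv (sum_logNormalized hy), smul_eq_mul]

/-- Coordinates of absolute value at most `1` keep each entry of `B_Λ Y` below the row sum `r_φ`.
Applied to squared lengths, this is the origin of the factor `exp (r_i / 2)` in `D_i`. -/
theorem UnitReduced.le {y : (K →+* ℝ) → ℝ} (h : D.UnitReduced y) (hy : ∀ φ, 0 < y φ)
    (φ : K →+* ℝ) : y φ ≤ (∏ ψ, y ψ) ^ (1 / (deg K : ℝ)) * Real.exp (D.rowSum φ) := by
  obtain ⟨Y, hY, h⟩ := h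
  have hN : 0 < ∏ ψ, y ψ := Finset.prod_pos fun ψ _ => hy ψ
  have h1 : logNormalized y φ ≤ D.rowSum φ := by
    rw [← h, rowSum, Matrix.mulVec, dotProduct]
    refine Finset.sum_le_sum fun k _ => ?_
    have h2 : |Y k| ≤ 1 := abs_le.2 ⟨(hY k).1, (hY k).2.le⟩
    refine (le_abs_self _).trans ?_
    rw [abs_mul]
    exact mul_le_of_le_one_right (abs_nonneg _) h2
  rw [logNormalized, Real.log_le_iff_le_exp (mul_pos (hy φ) (Real.rpow_pos_of_pos hN _)),
    Real.rpow_neg hN.le, ← div_eq_mul_inv, div_le_iff₀ (Real.rpow_pos_of_pos hN _)] at h1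
  linarith

/-- Every point of the projective line is represented by generators of one of the ideals `𝔞 j`. -/
theorem exists_cusp_representative {p : 𝓞 K × 𝓞 K} (hp : p ≠ 0) :
    ∃ (j : Fin (classNumber K)) (q : 𝓞 K × 𝓞 K), q ≠ 0 ∧ SameCusp p q ∧
      Ideal.span {q.1, q.2} = D.𝔞 j := by
  have hI := span_ne_bot hp
  obtain ⟨j, hj⟩ := D.𝔞_bij.2
    (ClassGroup.mk0 ⟨Ideal.span {p.1, p.2}, mem_nonZeroDivisors_of_ne_zero hI⟩)
  obtain ⟨x, y, hx, hy, hxy⟩ := ClassGroup.mk0_eq_mk0_iff.1 hj.symm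
  dsimp only at hxy
  -- From `x (ρ, σ) = y 𝔞_j` it follows that `x r / y` is integral for every `r` in the ideal. The
  -- images of `ρ` and `σ` under this scaling generate `𝔞_j`.
  have hmem : ∀ r ∈ Ideal.span {p.1, p.2}, ∃ s, x * r = y * s := by
    intro r hr
    have : x * r ∈ Ideal.span {y} * D.𝔞 j := by
      rw [← hxy]
      exact Ideal.mul_mem_mul (Ideal.mem_span_singleton_self x) hr
    obtain ⟨s, -, hs⟩ := Ideal.mem_span_singleton_mul.1 this
    exact ⟨s, hs.symm⟩
  obtain ⟨ρ', h1⟩ := hmem p.1 (Ideal.subset_span (by simp))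
  obtain ⟨σ', h2⟩ := hmem p.2 (Ideal.subset_span (by simp))
  have hspan : Ideal.span {ρ', σ'} = D.𝔞 j := by
    have h3 : Ideal.span {y} * Ideal.span {ρ', σ'} = Ideal.span {y} * D.𝔞 j := by
      rw [← hxy, ← span_mul_pair, ← span_mul_pair, h1, h2]
    exact mul_left_cancel₀ (by simpa using hy) h3
  refine ⟨j, (ρ', σ'), ?_, ?_, hspan⟩
  · intro h
    simp only [Prod.mk_eq_zero] at h
    apply nonZeroDivisors.ne_zero (D.𝔞_mem j)
    rw [← hspan, h.1, h.2]
    simp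
  · have : x * y * (p.1 * σ') = x * y * (ρ' * p.2) := by
      linear_combination (y * σ') * h1 - (y * ρ') * h2
    exact mul_left_cancel₀ (mul_ne_zero hx hy) this

theorem absNorm_𝔞_le (j : Fin (classNumber K)) : Ideal.absNorm (D.𝔞 j) ≤ D.C :=
  Finset.le_sup (f := fun j => Ideal.absNorm (D.𝔞 j)) (Finset.mem_univ j)

theorem absNorm_𝔞_pos (j : Fin (classNumber K)) : 0 < Ideal.absNorm (D.𝔞 j) :=
  Nat.pos_of_ne_zero (by
    rw [Ne, Ideal.absNorm_eq_zero_iff]; exact nonZeroDivisors.ne_zero (D.𝔞_mem j))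

theorem C_pos : (0 : ℝ) < D.C := by
  obtain ⟨j, -⟩ := D.𝔞_bij.2 1
  exact_mod_cast (D.absNorm_𝔞_pos j).trans_le (D.absNorm_𝔞_le j)

theorem boundConst_pos (φ : K →+* ℝ) : 0 < D.boundConst φ :=
  mul_pos (Real.rpow_pos_of_pos D.C_pos _) (Real.exp_pos _)

theorem cusp_ne_zero (j : Fin (classNumber K)) : (D.ρ j, D.σ j) ≠ 0 := by
  intro h
  simp only [Prod.mk_eq_zero] at h
  apply nonZeroDivisors.ne_zero (D.𝔞_mem j)
  rw [← D.span_cusp, h.1, h.2]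
  simp

/-- Every cusp at distance at most `d` has a representative in a bounded region. -/
theorem exists_bounded_representative {z : HK K} {p : 𝓞 K × 𝓞 K} (hp : p ≠ 0) {d : ℝ}
    (hd : cuspDist z p.1 p.2 ≤ d) :
    ∃ q : 𝓞 K × 𝓞 K, q ≠ 0 ∧ SameCusp p q ∧
      (∏ φ : K →+* ℝ, pointForm (z φ) (φ (q.1 : K)) (φ (q.2 : K))) ≤ (D.C * d) ^ 2 ∧
      (∀ φ : K →+* ℝ, pointForm (z φ) (φ (q.1 : K)) (φ (q.2 : K)) ≤
        (D.boundConst φ * d ^ (1 / (deg K : ℝ))) ^ 2) ∧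
      ∃ j, Ideal.span {q.1, q.2} = D.𝔞 j := by
  obtain ⟨j, q, hq, hpq, hspan⟩ := D.exists_cusp_representative hp
  have hd0 : 0 ≤ d := (cuspDist_nonneg z p.1 p.2).trans hd
  rw [hpq.cuspDist_eq hp hq, cuspDist_eq, hspan] at hd
  set t : (K →+* ℝ) → ℝ := fun φ => pointForm (z φ) (φ (q.1 : K)) (φ (q.2 : K)) with ht
  have htpos : ∀ φ, 0 < t φ := fun φ => pointForm_pos _ (ne_zero_embedding hq φ)
  have hT : 0 < ∏ φ, t φ := Finset.prod_pos fun φ _ => htpos φ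
  have hprod : ∏ φ, t φ ≤ (D.C * d) ^ 2 := by
    have hN : (0 : ℝ) < Ideal.absNorm (D.𝔞 j) := by exact_mod_cast D.absNorm_𝔞_pos j
    have hNC : (Ideal.absNorm (D.𝔞 j) : ℝ) ≤ D.C := by exact_mod_cast D.absNorm_𝔞_le j
    rw [inv_mul_le_iff₀ hN] at hd
    rw [← Real.sq_sqrt hT.le]
    refine pow_le_pow_left₀ (Real.sqrt_nonneg _) (hd.trans ?_) 2
    exact mul_le_mul_of_nonneg_right hNC hd0
  -- Scaling the pair by `u` multiplies the vector `t` of local forms by `u²` and keeps its product.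
  -- The unit is chosen to balance this vector, so that the bound on the product bounds every entry.
  let u := D.reducingUnit t
  have hut : ∀ φ : K →+* ℝ, pointForm (z φ) (φ (((u : 𝓞 K) * q.1 : 𝓞 K) : K))
      (φ (((u : 𝓞 K) * q.2 : 𝓞 K) : K)) = φ ((u : 𝓞 K) : K) ^ 2 * t φ := fun φ => by
    simp only [map_mul, pointForm_smul, ht]
  have hprod2 : ∏ φ : K →+* ℝ, φ ((u : 𝓞 K) : K) ^ 2 * t φ = ∏ φ, t φ := by
    rw [Finset.prod_mul_distrib, Finset.prod_pow, ← sq_abs, abs_prod_unit]; simp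
  refine ⟨((u : 𝓞 K) * q.1, (u : 𝓞 K) * q.2), ?_, ?_, ?_, ?_, j, ?_⟩
  · intro h
    simp only [Prod.mk_eq_zero, Units.mul_right_eq_zero] at h
    exact hq (Prod.ext h.1 h.2)
  · simp only [SameCusp] at hpq ⊢
    linear_combination (u : 𝓞 K) * hpq
  · simp only [hut]
    rw [hprod2]; exact hprod
  · intro φ
    simp only [hut]
    have h1 := (D.unitReduced_reducingUnit htpos).le D
      (fun φ => mul_pos (sq_pos_of_ne_zero (unit_embedding_ne_zero u φ)) (htpos φ)) φ
    refine h1.trans ?_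
    change (∏ φ : K →+* ℝ, φ ((u : 𝓞 K) : K) ^ 2 * t φ) ^ _ * _ ≤ _
    rw [hprod2, boundConst]
    have h2 : (∏ φ, t φ) ^ (1 / (deg K : ℝ)) ≤
        ((D.C : ℝ) ^ (1 / (deg K : ℝ)) * d ^ (1 / (deg K : ℝ))) ^ 2 := by
      have hCd := mul_nonneg D.C_pos.le hd0
      rw [← Real.mul_rpow D.C_pos.le hd0, ← Real.rpow_natCast _ 2, ← Real.rpow_mul hCd, mul_comm (1 / _),
        Real.rpow_mul hCd, Real.rpow_natCast]
      exact Real.rpow_le_rpow hT.le hprod (by positivity)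
    have h3 : Real.exp (D.rowSum φ) = Real.exp (1 / 2 * D.rowSum φ) ^ 2 := by
      rw [← Real.exp_nat_mul]; congr 1; push_cast; ring
    rw [h3]
    calc _ ≤ ((D.C : ℝ) ^ (1 / (deg K : ℝ)) * d ^ (1 / (deg K : ℝ))) ^ 2 *
          Real.exp (1 / 2 * D.rowSum φ) ^ 2 := mul_le_mul_of_nonneg_right h2 (sq_nonneg _)
      _ = _ := by ring
  · rw [span_mul_pair, Ideal.span_singleton_eq_top.2 u.isUnit, Ideal.top_mul, hspan]

theorem cuspDist_infty (z : HK K) :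
    cuspDist z 1 0 = (∏ φ, yPart z φ) ^ (-(1 / 2) : ℝ) := by
  have h : ∀ φ : K →+* ℝ, pointForm (z φ) (φ ((1 : 𝓞 K) : K)) (φ ((0 : 𝓞 K) : K)) =
      (yPart z φ)⁻¹ := fun φ => by simp [pointForm, yPart]
  have h1 : Ideal.span {(1 : 𝓞 K), 0} = ⊤ := by
    rw [Ideal.eq_top_iff_one]; exact Ideal.subset_span (by simp)
  have hN : 0 ≤ ∏ φ, yPart z φ := Finset.prod_nonneg fun φ _ => (yPart_pos z φ).le
  rw [cuspDist_eq, h1]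
  simp only [h, Finset.prod_inv_distrib, Ideal.absNorm_top, Nat.cast_one, inv_one, one_mul]
  rw [Real.sqrt_inv, Real.sqrt_eq_rpow, Real.rpow_neg hN]

/-- If the norm of the imaginary part exceeds `C`, the cusp at infinity is closest. -/
theorem isClosest_infty {z : HK K} (hz : (D.C : ℝ) < ∏ φ, yPart z φ) :
    IsClosest z ((1, 0) : 𝓞 K × 𝓞 K) := by
  have hN : 0 < ∏ φ, yPart z φ := Finset.prod_pos fun φ _ => yPart_pos z φ
  have h10 : ((1, 0) : 𝓞 K × 𝓞 K) ≠ 0 := by simp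
  refine ⟨h10, fun p hp => ?_⟩
  obtain ⟨q, hq, hpq, hprod, -⟩ := D.exists_bounded_representative (z := z) hp le_rfl
  by_cases hq2 : q.2 = 0
  · refine le_of_eq (SameCusp.cuspDist_eq ?_ h10 hp z)
    have hq1 : q.1 ≠ 0 := fun h => hq (Prod.ext h hq2)
    have hp2 : p.2 = 0 := by
      rw [SameCusp, hq2, mul_zero] at hpq
      exact (mul_eq_zero.1 hpq.symm).resolve_left hq1
    simp [SameCusp, hp2]
  · have h1 := one_le_abs_prod hq2
    -- Here `σ ≠ 0`, so `|N(σ)| ≥ 1` and `Δ(z, p) ≥ N(y)^(1/2) / C`. This exceeds `Δ(z, ∞) =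
    -- N(y)^(-1/2)` since `N(y) > C`.
    have h2 : (∏ φ, yPart z φ) ≤ (D.C * cuspDist z p.1 p.2) ^ 2 := by
      refine le_trans ?_ hprod
      calc (∏ φ, yPart z φ) ≤ |∏ φ : K →+* ℝ, φ (q.2 : K)| ^ 2 * ∏ φ, yPart z φ :=
            le_mul_of_one_le_left hN.le (one_le_pow₀ h1)
        _ = ∏ φ : K →+* ℝ, φ (q.2 : K) ^ 2 * yPart z φ := by
            rw [sq_abs, ← Finset.prod_pow, ← Finset.prod_mul_distrib]
        _ ≤ _ := Finset.prod_le_prod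
            (fun φ _ => mul_nonneg (sq_nonneg _) (yPart_pos z φ).le)
            fun φ _ => sq_mul_im_le_pointForm _ _ _
    have hC := D.C_pos
    have hΔ := cuspDist_nonneg z p.1 p.2
    have h3 : √(∏ φ, yPart z φ) ≤ D.C * cuspDist z p.1 p.2 :=
      Real.sqrt_le_iff.2 ⟨by positivity, h2⟩
    have hs := Real.sqrt_pos.2 hN
    have hss := Real.mul_self_sqrt hN.le
    change cuspDist z 1 0 ≤ _
    rw [cuspDist_infty, Real.rpow_neg hN.le, ← Real.sqrt_eq_rpow, inv_le_iff_one_le_mul₀ hs]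
    by_contra hlt
    push Not at hlt
    nlinarith

end TotallyReal

end ReductionData

end Field

end

/-! ### Density and normalizing matrices -/

section

open Prog

section Field

variable {K : Type*} [Field K] [NumberField K]

theorem toK_apply (A : SL(2, 𝓞 K)) (i k : Fin 2) : toK A i k = (A i k : K) := rfl

theorem toK_mul (A B : SL(2, 𝓞 K)) : toK (A * B) = toK A * toK B := map_mul _ A B

theorem toK_inv (A : SL(2, 𝓞 K)) : toK A⁻¹ = (toK A)⁻¹ := map_inv _ A

theorem toK_injective : Function.Injective (toK (K := K)) := by
  intro A B h
  ext i k
  have := congrArg (fun M : SL(2, K) => M i k) h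
  exact this

theorem exists_toK_eq {M : SL(2, K)}
    (h : ∀ i k, M i k ∈ (1 : FractionalIdeal (𝓞 K)⁰ K)) : ∃ A : SL(2, 𝓞 K), toK A = M := by
  choose e he using fun i k => (FractionalIdeal.mem_one_iff _).1 (h i k)
  have hdet : (Matrix.of e).det = 1 := by
    have h1 : (Matrix.of e).map (algebraMap (𝓞 K) K) = (M : Matrix (Fin 2) (Fin 2) K) := by
      ext i k; exact he i k
    have h2 := RingHom.map_det (algebraMap (𝓞 K) K) (Matrix.of e)
    rw [RingHom.mapMatrix_apply, h1, M.det_coe] at h2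
    exact FaithfulSMul.algebraMap_injective (𝓞 K) K (by rw [h2, map_one])
  refine ⟨⟨Matrix.of e, hdet⟩, ?_⟩
  ext i k
  exact he i k

/-- The action of an upper triangular matrix. -/
theorem xPart_act_upper {M : SL(2, K)} {e : K} (h0 : M 0 0 = e) (h1 : M 1 0 = 0) (z : HK K)
    (φ : K →+* ℝ) : xPart (act M z) φ = φ e ^ 2 * xPart z φ + φ (e * M 0 1) := by
  have hdet := M.det_coe
  rw [Matrix.det_fin_two, h0, h1, mul_zero, sub_zero] at hdet
  have he : φ e * φ (M 1 1) = 1 := by rw [← map_mul, hdet, map_one]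
  have he0 : φ e ≠ 0 := left_ne_zero_of_mul_eq_one he
  have h11 : φ (M 1 1) = (φ e)⁻¹ := eq_inv_of_mul_eq_one_right he
  have : ((Matrix.SpecialLinearGroup.map φ M • z φ : ℍ) : ℂ) =
      ((φ e ^ 2 : ℝ) : ℂ) * z φ + ((φ e * φ (M 0 1) : ℝ) : ℂ) := by
    rw [coe_sl_smul]
    simp [h0, h1, h11]
    ring
  have h2 := congrArg Complex.re this
  rw [Complex.add_re, Complex.re_ofReal_mul, Complex.ofReal_re] at h2
  rw [map_mul]
  exact h2

theorem yPart_act_upper {M : SL(2, K)} {e : K} (h0 : M 0 0 = e) (h1 : M 1 0 = 0) (z : HK K) :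
    yPart (act M z) = fun φ => φ e ^ 2 * yPart z φ := by
  ext φ
  have hdet := M.det_coe
  rw [Matrix.det_fin_two, h0, h1, mul_zero, sub_zero] at hdet
  have he : φ e * φ (M 1 1) = 1 := by rw [← map_mul, hdet, map_one]
  have h11 : φ (M 1 1) = (φ e)⁻¹ := eq_inv_of_mul_eq_one_right he
  have : (Matrix.SpecialLinearGroup.map φ M • z φ : ℍ).im = φ e ^ 2 * (z φ).im := by
    rw [im_sl_smul]
    simp [h1, h11]
    field_simp
  exact this

/-! ### Points without equidistant cusps -/

/-- Two quadratic polynomials in `u` that agree at three points have the same coefficients. The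
three coefficient identities combine to `a b (r s' - r' s)² = 0`. -/
theorem proportional_of_vanishing {a b r s r' s' x y t : ℝ} (ht : t ≠ 0) (ha : 0 < a) (hb : 0 < b)
    (h : ∀ u ∈ ({0, t, -t} : Set ℝ), a * ((-s * (u + x) + r) ^ 2 + s ^ 2 * y ^ 2) =
      b * ((-s' * (u + x) + r') ^ 2 + s' ^ 2 * y ^ 2)) : r * s' = r' * s := by
  have h0 := h 0 (by simp)
  have h1 := h t (by simp)
  have h2 := h (-t) (by simp)
  have e1 : a * s ^ 2 = b * s' ^ 2 := by
    have : t ^ 2 * (a * s ^ 2) = t ^ 2 * (b * s' ^ 2) := by linear_combination (h1 + h2) / 2 - h0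
    exact mul_left_cancel₀ (pow_ne_zero 2 ht) this
  have e2 : a * s * (r - s * x) = b * s' * (r' - s' * x) := by
    have : t * (a * s * (r - s * x)) = t * (b * s' * (r' - s' * x)) := by
      linear_combination (h2 - h1) / 4
    exact mul_left_cancel₀ ht this
  have e3 : a * (r - s * x) ^ 2 = b * (r' - s' * x) ^ 2 := by
    linear_combination h0 - y ^ 2 * e1
  have e4 : (a * b) * (r * s' - r' * s) ^ 2 = 0 := by
    linear_combination -(a * (r - s * x) ^ 2) * e1 +
      2 * (a * s * (r - s * x)) * e2 - (a * s ^ 2) * e3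
  have := (mul_eq_zero.1 e4).resolve_left (mul_pos ha hb).ne'
  exact sub_eq_zero.1 (pow_eq_zero_iff two_ne_zero |>.1 this)

theorem continuous_vadd_upperHalfPlane (w : ℍ) : Continuous fun t : ℝ => t +ᵥ w := by
  rw [UpperHalfPlane.isEmbedding_coe.continuous_iff]
  simp only [Function.comp_def, UpperHalfPlane.coe_vadd]
  fun_prop

theorem continuous_cuspDist (ρ σ : 𝓞 K) : Continuous fun z : HK K => cuspDist z ρ σ := by
  have hx : ∀ φ : K →+* ℝ, Continuous fun z : HK K => (z φ).re := fun φ =>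
    UpperHalfPlane.continuous_re.comp (continuous_apply φ)
  have hy : ∀ φ : K →+* ℝ, Continuous fun z : HK K => (z φ).im := fun φ =>
    UpperHalfPlane.continuous_im.comp (continuous_apply φ)
  simp only [cuspDist_eq, pointForm]
  refine continuous_const.mul (Real.continuous_sqrt.comp (continuous_finsetProd _ fun φ _ => ?_))
  exact (((continuous_const.mul (hx φ)).add continuous_const).pow 2 |>.mul
    ((hy φ).inv₀ fun z => (z φ).im_pos.ne')).add (continuous_const.mul (hy φ))

section TotallyReal

variable [IsTotallyReal K]

/-- Suppose the distances agree on a nonempty open set, and move a single coordinate horizontally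
inside it. Both squared distances are then positive constants times a quadratic polynomial in the
shift, so the cusps agree under one embedding and hence in `K`. -/
theorem dense_cuspDist_ne {p q : 𝓞 K × 𝓞 K} (hp : p ≠ 0) (hq : q ≠ 0) (h : ¬ SameCusp p q) :
    Dense {z : HK K | cuspDist z p.1 p.2 ≠ cuspDist z q.1 q.2} := by
  classical
  have hne : Nonempty (K →+* ℝ) := by
    rw [← Fintype.card_pos_iff, card_embeddings]; exact finrank_pos
  obtain ⟨φ₀⟩ := hne
  rw [dense_iff_inter_open]
  rintro O hO ⟨u, hu⟩
  by_contra hempty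
  have hall : ∀ z ∈ O, cuspDist z p.1 p.2 = cuspDist z q.1 q.2 := by
    intro z hz
    by_contra hz2
    exact hempty ⟨z, hz, hz2⟩
  let f : ℝ → HK K := fun t => Function.update u φ₀ (t +ᵥ u φ₀)
  have hf : Continuous f := continuous_const.update φ₀ (continuous_vadd_upperHalfPlane _)
  have hmem : f ⁻¹' O ∈ nhds (0 : ℝ) := by
    refine (hO.preimage hf).mem_nhds ?_
    simpa [f] using hu
  obtain ⟨t₀, ht₀, hball⟩ := Metric.mem_nhds_iff.1 hmem
  have key : ∀ p : 𝓞 K × 𝓞 K, p ≠ 0 → ∃ c : ℝ, 0 < c ∧ ∀ t, cuspDist (f t) p.1 p.2 ^ 2 =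
      c * pointForm (t +ᵥ u φ₀) (φ₀ (p.1 : K)) (φ₀ (p.2 : K)) := by
    intro p hp
    have hN : (0 : ℝ) < Ideal.absNorm (Ideal.span {p.1, p.2}) := by
      exact_mod_cast absNorm_span_pos hp
    have hR : 0 < ∏ φ ∈ Finset.univ.erase φ₀, pointForm (u φ) (φ (p.1 : K)) (φ (p.2 : K)) :=
      Finset.prod_pos fun φ _ => pointForm_pos _ (ne_zero_embedding hp φ)
    refine ⟨((Ideal.absNorm (Ideal.span {p.1, p.2}) : ℝ)⁻¹) ^ 2 *
      ∏ φ ∈ Finset.univ.erase φ₀, pointForm (u φ) (φ (p.1 : K)) (φ (p.2 : K)), by positivity,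
      fun t => ?_⟩
    rw [cuspDist_eq, mul_pow, Real.sq_sqrt (Finset.prod_nonneg fun φ _ => pointForm_nonneg _ _ _),
      ← Finset.mul_prod_erase _ _ (Finset.mem_univ φ₀)]
    have : ∏ φ ∈ Finset.univ.erase φ₀, pointForm (f t φ) (φ (p.1 : K)) (φ (p.2 : K)) =
        ∏ φ ∈ Finset.univ.erase φ₀, pointForm (u φ) (φ (p.1 : K)) (φ (p.2 : K)) :=
      Finset.prod_congr rfl fun φ hφ => by
        simp only [f, Function.update_of_ne (Finset.mem_erase.1 hφ).1]
    rw [this]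
    simp only [f, Function.update_self]
    ring
  obtain ⟨a, ha, hA⟩ := key p hp
  obtain ⟨b, hb, hB⟩ := key q hq
  apply h
  have hrs : φ₀ (p.1 : K) * φ₀ (q.2 : K) = φ₀ (q.1 : K) * φ₀ (p.2 : K) := by
    refine proportional_of_vanishing (x := (u φ₀).re) (y := (u φ₀).im) (t := t₀ / 2)
      (by positivity) ha hb fun t ht => ?_
    have htO : f t ∈ O := by
      apply hball
      rw [Metric.mem_ball, dist_zero_right, Real.norm_eq_abs, abs_lt]
      rcases ht with rfl | rfl | rfl <;> constructor <;> linarith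
    have h1 := hall _ htO
    have h2 := hA t
    rw [h1, hB t] at h2
    have hy := (u φ₀).im_pos.ne'
    simp only [pointForm, UpperHalfPlane.vadd_re, UpperHalfPlane.vadd_im] at h2
    field_simp at h2
    linear_combination -h2
  have : φ₀ ((p.1 * q.2 : 𝓞 K) : K) = φ₀ ((q.1 * p.2 : 𝓞 K) : K) := by
    simpa only [map_mul] using hrs
  exact FaithfulSMul.algebraMap_injective (𝓞 K) K (φ₀.injective this)

theorem isOpen_cuspDist_ne (p q : 𝓞 K × 𝓞 K) :
    IsOpen {z : HK K | cuspDist z p.1 p.2 ≠ cuspDist z q.1 q.2} :=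
  isOpen_ne_fun (continuous_cuspDist _ _) (continuous_cuspDist _ _)

theorem dense_forall_cuspDist_ne (S : Finset ((𝓞 K × 𝓞 K) × (𝓞 K × 𝓞 K)))
    (hS : ∀ s ∈ S, s.1 ≠ 0 ∧ s.2 ≠ 0) :
    Dense {z : HK K | ∀ s ∈ S, cuspDist z s.1.1 s.1.2 = cuspDist z s.2.1 s.2.2 →
      SameCusp s.1 s.2} := by
  classical
  induction S using Finset.induction_on with
  | empty => simp
  | insert a S ha ih =>
    have ih := ih fun s hs => hS s (by simp [hs])
    by_cases h : SameCusp a.1 a.2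
    · refine ih.mono fun z hz s hs => ?_
      rcases Finset.mem_insert.1 hs with rfl | hs
      · exact fun _ => h
      · exact hz s hs
    · have h1 := (hS a (by simp))
      refine (Dense.inter_of_isOpen_left (dense_cuspDist_ne h1.1 h1.2 h) ih
        (isOpen_cuspDist_ne _ _)).mono ?_
      rintro z ⟨hz1, hz2⟩ s hs
      rcases Finset.mem_insert.1 hs with rfl | hs
      · exact fun h' => absurd h' hz1
      · exact hz2 s hs

end TotallyReal

/-! ### Matrices carrying infinity to a cusp, and integrality of conjugates -/

namespace ReductionData

variable (D : ReductionData K)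

/-- The matrices whose columns lie in `𝔞 j` and in its inverse. -/
def IsNormalizing (j : Fin (classNumber K)) (B : SL(2, K)) : Prop :=
  ∀ i, B i 0 ∈ (D.𝔞 j : FractionalIdeal (𝓞 K)⁰ K) ∧
    B i 1 ∈ ((D.𝔞 j : FractionalIdeal (𝓞 K)⁰ K))⁻¹

theorem 𝔞_ne_zero (j : Fin (classNumber K)) : (D.𝔞 j : FractionalIdeal (𝓞 K)⁰ K) ≠ 0 :=
  FractionalIdeal.coeIdeal_ne_zero.2 (nonZeroDivisors.ne_zero (D.𝔞_mem j))

theorem isNormalizing_A (j : Fin (classNumber K)) : D.IsNormalizing j (D.A j) := by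
  have h1 : D.ρ j ∈ D.𝔞 j := by rw [← D.span_cusp]; exact Ideal.subset_span (by simp)
  have h2 : D.σ j ∈ D.𝔞 j := by rw [← D.span_cusp]; exact Ideal.subset_span (by simp)
  intro i
  fin_cases i
  · exact ⟨FractionalIdeal.mem_coeIdeal_of_mem _ h1, D.ξ_mem j⟩
  · exact ⟨FractionalIdeal.mem_coeIdeal_of_mem _ h2, D.η_mem j⟩

theorem mul_mem_one_of_mem {j : Fin (classNumber K)} {x y : K}
    (hx : x ∈ (D.𝔞 j : FractionalIdeal (𝓞 K)⁰ K))
    (hy : y ∈ ((D.𝔞 j : FractionalIdeal (𝓞 K)⁰ K))⁻¹) :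
    x * y ∈ (1 : FractionalIdeal (𝓞 K)⁰ K) := by
  rw [← mul_inv_cancel₀ (D.𝔞_ne_zero j)]
  exact FractionalIdeal.mul_mem_mul hx hy

theorem mul_mul_mem_one_of_mem {j : Fin (classNumber K)} {x y w : K}
    (hx : x ∈ (D.𝔞 j : FractionalIdeal (𝓞 K)⁰ K)) (hy : y ∈ (D.𝔞 j : FractionalIdeal (𝓞 K)⁰ K))
    (hw : w ∈ ((D.𝔞 j : FractionalIdeal (𝓞 K)⁰ K))⁻¹ ^ 2) :
    x * y * w ∈ (1 : FractionalIdeal (𝓞 K)⁰ K) := by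
  have h : (D.𝔞 j : FractionalIdeal (𝓞 K)⁰ K) * D.𝔞 j *
      ((D.𝔞 j : FractionalIdeal (𝓞 K)⁰ K))⁻¹ ^ 2 = 1 := by
    rw [← sq, ← mul_pow, mul_inv_cancel₀ (D.𝔞_ne_zero j), one_pow]
  rw [← h]
  exact FractionalIdeal.mul_mem_mul (FractionalIdeal.mul_mem_mul hx hy) hw

theorem one_mul_mem_one {x y : K} (hx : x ∈ (1 : FractionalIdeal (𝓞 K)⁰ K))
    (hy : y ∈ (1 : FractionalIdeal (𝓞 K)⁰ K)) : x * y ∈ (1 : FractionalIdeal (𝓞 K)⁰ K) := by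
  have := FractionalIdeal.mul_mem_mul hx hy
  rwa [one_mul] at this

theorem one_mul_mem {I : FractionalIdeal (𝓞 K)⁰ K} {x y : K}
    (hx : x ∈ (1 : FractionalIdeal (𝓞 K)⁰ K)) (hy : y ∈ I) : x * y ∈ I := by
  have := FractionalIdeal.mul_mem_mul hx hy
  rwa [one_mul] at this

theorem coe_mem_one (x : 𝓞 K) : (x : K) ∈ (1 : FractionalIdeal (𝓞 K)⁰ K) :=
  FractionalIdeal.coe_mem_one _ x

theorem fractionalIdeal_sub_mem {I : FractionalIdeal (𝓞 K)⁰ K} {x y : K} (hx : x ∈ I)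
    (hy : y ∈ I) : x - y ∈ I :=
  Submodule.sub_mem (I : Submodule (𝓞 K) K) hx hy

theorem fractionalIdeal_add_mem {I : FractionalIdeal (𝓞 K)⁰ K} {x y : K} (hx : x ∈ I)
    (hy : y ∈ I) : x + y ∈ I :=
  Submodule.add_mem (I : Submodule (𝓞 K) K) hx hy

/-- The entries are sums of products from `𝔞 𝔞⁻¹` and `𝔞² 𝔞⁻²` with integral factors. For `M = 1`
this gives equivalences between cusps, and for `B = B'` elements of the stabilizer of a cusp. -/
theorem exists_toK_eq_conj {j : Fin (classNumber K)} {B B' M : SL(2, K)} (hB : D.IsNormalizing j B)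
    (hB' : D.IsNormalizing j B') (h0 : M 0 0 ∈ (1 : FractionalIdeal (𝓞 K)⁰ K))
    (h1 : M 1 1 ∈ (1 : FractionalIdeal (𝓞 K)⁰ K)) (h2 : M 1 0 = 0)
    (h3 : M 0 1 ∈ ((D.𝔞 j : FractionalIdeal (𝓞 K)⁰ K))⁻¹ ^ 2) :
    ∃ A : SL(2, 𝓞 K), toK A = B * M * B'⁻¹ := by
  refine exists_toK_eq fun i k => ?_
  have e : ∀ i, (B * M * B'⁻¹) i 0 = M 0 0 * (B i 0 * B' 1 1) -
      (B i 0 * B' 1 0 * M 0 1 + M 1 1 * (B' 1 0 * B i 1)) ∧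
      (B * M * B'⁻¹) i 1 = (B i 0 * B' 0 0 * M 0 1 + M 1 1 * (B' 0 0 * B i 1)) -
      M 0 0 * (B i 0 * B' 0 1) := by
    intro i
    simp only [Matrix.SpecialLinearGroup.coe_mul, Matrix.mul_apply, Fin.sum_univ_two,
      Matrix.SpecialLinearGroup.coe_inv, Matrix.adjugate_fin_two, Matrix.of_apply,
      Matrix.cons_val', Matrix.cons_val_zero, Matrix.cons_val_one, h2]
    constructor <;> simp <;> ring
  have m1 : ∀ i l, B i 0 * B' l 1 ∈ (1 : FractionalIdeal (𝓞 K)⁰ K) := fun i l =>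
    D.mul_mem_one_of_mem (hB i).1 (hB' l).2
  have m2 : ∀ i l, B' l 0 * B i 1 ∈ (1 : FractionalIdeal (𝓞 K)⁰ K) := fun i l =>
    D.mul_mem_one_of_mem (hB' l).1 (hB i).2
  have m3 : ∀ i l, B i 0 * B' l 0 * M 0 1 ∈ (1 : FractionalIdeal (𝓞 K)⁰ K) := fun i l =>
    D.mul_mul_mem_one_of_mem (hB i).1 (hB' l).1 h3
  fin_cases k
  · change (B * M * B'⁻¹) i 0 ∈ _
    rw [(e i).1]
    exact fractionalIdeal_sub_mem (one_mul_mem_one h0 (m1 i 1))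
      (fractionalIdeal_add_mem (m3 i 1) (one_mul_mem_one h1 (m2 i 1)))
  · change (B * M * B'⁻¹) i 1 ∈ _
    rw [(e i).2]
    exact fractionalIdeal_sub_mem
      (fractionalIdeal_add_mem (m3 i 0) (one_mul_mem_one h1 (m2 i 0)))
      (one_mul_mem_one h0 (m1 i 0))

/-- The upper right entry of a conjugate by a normalizing matrix. -/
theorem conj_mem_inv_sq {j : Fin (classNumber K)} {B : SL(2, K)} (hB : D.IsNormalizing j B)
    (A : SL(2, 𝓞 K)) :
    (B⁻¹ * toK A * B) 0 1 ∈ ((D.𝔞 j : FractionalIdeal (𝓞 K)⁰ K))⁻¹ ^ 2 := by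
  have e : (B⁻¹ * toK A * B) 0 1 =
      (((A 0 0 : 𝓞 K) : K) * (B 1 1 * B 0 1) + ((A 0 1 : 𝓞 K) : K) * (B 1 1 * B 1 1)) -
      (((A 1 0 : 𝓞 K) : K) * (B 0 1 * B 0 1) + ((A 1 1 : 𝓞 K) : K) * (B 0 1 * B 1 1)) := by
    simp only [Matrix.SpecialLinearGroup.coe_mul, Matrix.mul_apply, Fin.sum_univ_two,
      Matrix.SpecialLinearGroup.coe_inv, Matrix.adjugate_fin_two, Matrix.of_apply,
      Matrix.cons_val', Matrix.cons_val_zero, Matrix.cons_val_one, toK_apply]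
    simp
    ring
  have m : ∀ i l, B i 1 * B l 1 ∈ ((D.𝔞 j : FractionalIdeal (𝓞 K)⁰ K))⁻¹ ^ 2 := fun i l => by
    rw [sq]; exact FractionalIdeal.mul_mem_mul (hB i).2 (hB l).2
  rw [e]
  exact fractionalIdeal_sub_mem
    (fractionalIdeal_add_mem (one_mul_mem (coe_mem_one _) (m _ _))
      (one_mul_mem (coe_mem_one _) (m _ _)))
    (fractionalIdeal_add_mem (one_mul_mem (coe_mem_one _) (m _ _))
      (one_mul_mem (coe_mem_one _) (m _ _)))

/-! ### Uniqueness of reduced points with respect to one cusp -/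

section TotallyReal

variable [IsTotallyReal K]

/-- The coordinates of the two vectors differ by the even integers `2 b_k`, while both lie in `[-1,
1)`. So `b = 0` and only the sign of the unit remains. -/
theorem eq_one_or_neg_one_of_unitReduced {y : (K →+* ℝ) → ℝ} (hy : ∀ φ, 0 < y φ) {u : (𝓞 K)ˣ}
    (h : D.UnitReduced y) (h' : D.UnitReduced fun φ => φ ((u : 𝓞 K) : K) ^ 2 * y φ) :
    u = 1 ∨ u = -1 := by
  obtain ⟨Y, hY, e⟩ := h
  obtain ⟨Y', hY', e'⟩ := h'
  obtain ⟨b, hb, -⟩ := D.ε_spec u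
  have hlog : ∀ φ : K →+* ℝ, Real.log |φ ((u : 𝓞 K) : K)| =
      D.BΛ.mulVec (fun k => (b k : ℝ)) φ := fun φ => by
    rw [BΛ_mulVec_int]
    rcases hb with hb | hb
    · rw [← hb]
    · rw [hb]; simp
  have h1 : Y' = (2 : ℝ) • (fun k => (b k : ℝ)) + Y := by
    apply D.BΛ_injective
    ext φ
    rw [e', logNormalized_unit_sq_mul hy, Matrix.mulVec_add, Matrix.mulVec_smul, e, hlog]
    simp
  have hb0 : ∀ k, b k = 0 := by
    intro k
    have h2 := congrFun h1 k
    simp only [Pi.add_apply, Pi.smul_apply, smul_eq_mul] at h2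
    have h3 := hY k
    have h4 := hY' k
    rw [h2] at h4
    have h5 : (b k : ℝ) < 1 := by linarith [h3.1, h4.2]
    have h6 : (-1 : ℝ) < b k := by linarith [h3.2, h4.1]
    have h7 : b k < 1 := by exact_mod_cast h5
    have h8 : -1 < b k := by exact_mod_cast h6
    omega
  simpa [hb0] using hb

/-- Two points of a half-open interval of length `1` that differ by an integer are equal. -/
theorem eq_zero_of_translationReduced {j : Fin (classNumber K)} {x x' : (K →+* ℝ) → ℝ} {α : K}
    (hα : α ∈ ((D.𝔞 j : FractionalIdeal (𝓞 K)⁰ K))⁻¹ ^ 2) (hx : D.TranslationReduced j x)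
    (hx' : D.TranslationReduced j x') (h : ∀ φ, x' φ = x φ + φ α) : α = 0 := by
  obtain ⟨X, hX, rfl⟩ := hx
  obtain ⟨X', hX', rfl⟩ := hx'
  obtain ⟨a, rfl⟩ := D.exists_coords_of_mem j hα
  have h1 : X' = X + fun k => (a k : ℝ) := by
    have h2 : (D.Bβ j).mulVec X' = (D.Bβ j).mulVec (X + fun k => (a k : ℝ)) := by
      ext φ
      rw [h, embedding_sum_β, Matrix.mulVec_add, Pi.add_apply]
    rw [← leftInv_mulVec (D.isUnit_Bβ j) X', h2, leftInv_mulVec (D.isUnit_Bβ j)]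
  have ha : ∀ k, a k = 0 := by
    intro k
    have h2 := congrFun h1 k
    simp only [Pi.add_apply] at h2
    have h3 := hX k
    have h4 := hX' k
    rw [h2] at h4
    have h5 : (a k : ℝ) < 1 := by linarith [h3.1, h4.2]
    have h6 : (-1 : ℝ) < a k := by linarith [h3.2, h4.1]
    have h7 : a k < 1 := by exact_mod_cast h5
    have h8 : -1 < a k := by exact_mod_cast h6
    omega
  simp [ha]

/-- Matrices in `SL₂(𝒪_K)` that identify cusp representatives. -/
theorem exists_unit_mulPair {j k : Fin (classNumber K)} {A : SL(2, 𝓞 K)}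
    (h : SameCusp (D.ρ k, D.σ k) (mulPair A (D.ρ j, D.σ j))) :
    k = j ∧ ∃ u : (𝓞 K)ˣ, mulPair A (D.ρ j, D.σ j) = (u * D.ρ j, u * D.σ j) := by
  have hpj := D.cusp_ne_zero j
  have hspan := span_mulPair A (D.ρ j, D.σ j)
  obtain ⟨a, b, ha, hb, h1, h2⟩ := h.exists_mul_eq (D.cusp_ne_zero k) (mulPair_ne_zero A hpj)
  -- Proportional pairs generate ideals of the same class, so `k = j`. Then `(a) = (b)`, and the
  -- factor of proportionality is a unit.
  have h3 : Ideal.span {a} * D.𝔞 k = Ideal.span {b} * D.𝔞 j := by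
    rw [← D.span_cusp k, ← D.span_cusp j, ← hspan, ← span_mul_pair, ← span_mul_pair]
    exact congrArg₂ (fun x y => Ideal.span {x, y}) h1 h2
  have hkj : k = j := by
    apply D.𝔞_bij.1
    exact ClassGroup.mk0_eq_mk0_iff.2 ⟨a, b, ha, hb, h3⟩
  subst hkj
  refine ⟨rfl, ?_⟩
  have h4 : Ideal.span {a} = Ideal.span {b} :=
    mul_right_cancel₀ (nonZeroDivisors.ne_zero (D.𝔞_mem k)) h3
  obtain ⟨u, hu⟩ := Ideal.span_singleton_eq_span_singleton.1 h4.symm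
  refine ⟨u, Prod.ext ?_ ?_⟩
  · exact mul_left_cancel₀ hb (by rw [← h1, ← hu]; ring)
  · exact mul_left_cancel₀ hb (by rw [← h2, ← hu]; ring)

end TotallyReal

end ReductionData

end Field

end

/-! ### Disjointness of the translates -/

section

open Prog

section Field

variable {K : Type*} [Field K] [NumberField K]

namespace ReductionData

variable (D : ReductionData K)

section TotallyReal

variable [IsTotallyReal K]

theorem conj_apply_zero (B C : SL(2, K)) :
    (B⁻¹ * C * B) 0 0 = B 1 1 * (C 0 0 * B 0 0 + C 0 1 * B 1 0) -
      B 0 1 * (C 1 0 * B 0 0 + C 1 1 * B 1 0) ∧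
    (B⁻¹ * C * B) 1 0 = B 0 0 * (C 1 0 * B 0 0 + C 1 1 * B 1 0) -
      B 1 0 * (C 0 0 * B 0 0 + C 0 1 * B 1 0) := by
  simp only [Matrix.SpecialLinearGroup.coe_mul, Matrix.mul_apply, Fin.sum_univ_two,
    Matrix.SpecialLinearGroup.coe_inv, Matrix.adjugate_fin_two, Matrix.of_apply,
    Matrix.cons_val', Matrix.cons_val_zero, Matrix.cons_val_one]
  constructor <;> simp <;> ring

theorem _root_.HilbertReduction.IsClosest.sameCusp_of_forall {u : HK K} {p q : 𝓞 K × 𝓞 K}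
    (hp : IsClosest u p) (hq : IsClosest u q) {S : Finset ((𝓞 K × 𝓞 K) × (𝓞 K × 𝓞 K))}
    (hS : ∀ s ∈ S, cuspDist u s.1.1 s.1.2 = cuspDist u s.2.1 s.2.2 → SameCusp s.1 s.2)
    (h : (p, q) ∈ S) : SameCusp p q :=
  hS (p, q) h (le_antisymm (hp.2 q hq.1) (hq.2 p hp.1))

/-- Two closest cusps of `u` are `λ_j` and `A⁻¹ λ_k`; the hypothesis `hcusp` says that they
coincide, and it is the only genericity needed. Then `A` fixes `λ_j`, its conjugate `M` by `A_j`
acts by a unit square and a translation, and reducedness on both sides leaves `±1`. -/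
theorem eq_one_or_neg_one_of_mem_domainPart {j k : Fin (classNumber K)} {A : SL(2, 𝓞 K)}
    {u : HK K} (hu : u ∈ D.domainPart j) (hAu : act (toK A) u ∈ D.domainPart k)
    (hcusp : IsClosest u (D.ρ j, D.σ j) → IsClosest u (mulPair A⁻¹ (D.ρ k, D.σ k)) →
      SameCusp (D.ρ j, D.σ j) (mulPair A⁻¹ (D.ρ k, D.σ k))) : A = 1 ∨ A = -1 := by
  have h1 : IsClosest u (D.ρ j, D.σ j) := (isClosest_iff (D.cusp_ne_zero j)).2 hu.2
  have h2 : IsClosest (act (toK A) u) (D.ρ k, D.σ k) :=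
    (isClosest_iff (D.cusp_ne_zero k)).2 hAu.2
  have h3 := h2.mulPair A⁻¹
  rw [toK_inv, ← act_mul, inv_mul_cancel, act_one] at h3
  have h4 := hcusp h1 h3
  have h5 := (sameCusp_mulPair A h4).symm
  rw [mulPair_mulPair_inv] at h5
  obtain ⟨rfl, e, he⟩ := D.exists_unit_mulPair h5
  set M := (D.A k)⁻¹ * toK A * D.A k with hM
  have hdet := D.det_cusp k
  have he1 : ((A 0 0 : 𝓞 K) : K) * D.ρ k + ((A 0 1 : 𝓞 K) : K) * D.σ k = ((e : 𝓞 K) : K) * D.ρ k := by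
    have := congrArg (fun p : 𝓞 K × 𝓞 K => (p.1 : K)) he
    simpa [mulPair] using this
  have he2 : ((A 1 0 : 𝓞 K) : K) * D.ρ k + ((A 1 1 : 𝓞 K) : K) * D.σ k = ((e : 𝓞 K) : K) * D.σ k := by
    have := congrArg (fun p : 𝓞 K × 𝓞 K => (p.2 : K)) he
    simpa [mulPair] using this
  have hconj := conj_apply_zero (D.A k) (toK A)
  have hM0 : M 0 0 = ((e : 𝓞 K) : K) := by
    refine hconj.1.trans ?_
    change D.η k * (((A 0 0 : 𝓞 K) : K) * D.ρ k + ((A 0 1 : 𝓞 K) : K) * D.σ k) -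
      D.ξ k * (((A 1 0 : 𝓞 K) : K) * D.ρ k + ((A 1 1 : 𝓞 K) : K) * D.σ k) = _
    linear_combination D.η k * he1 - D.ξ k * he2 + ((e : 𝓞 K) : K) * hdet
  have hM1 : M 1 0 = 0 := by
    refine hconj.2.trans ?_
    change (D.ρ k : K) * (((A 1 0 : 𝓞 K) : K) * D.ρ k + ((A 1 1 : 𝓞 K) : K) * D.σ k) -
      (D.σ k : K) * (((A 0 0 : 𝓞 K) : K) * D.ρ k + ((A 0 1 : 𝓞 K) : K) * D.σ k) = _
    linear_combination (D.ρ k : K) * he2 - (D.σ k : K) * he1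
  have hM2 : M 0 1 ∈ ((D.𝔞 k : FractionalIdeal (𝓞 K)⁰ K))⁻¹ ^ 2 :=
    D.conj_mem_inv_sq (D.isNormalizing_A k) A
  have hact : act (D.A k)⁻¹ (act (toK A) u) = act M (act (D.A k)⁻¹ u) := by
    rw [← act_mul, ← act_mul, hM]
    congr 1
    group
  obtain ⟨⟨hx, hy⟩, -⟩ := hu
  obtain ⟨⟨hx', hy'⟩, -⟩ := hAu
  rw [hact] at hx' hy'
  rw [yPart_act_upper hM0 hM1] at hy'
  have heu := D.eq_one_or_neg_one_of_unitReduced (yPart_pos _) hy hy'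
  have hesq : ((e : 𝓞 K) : K) ^ 2 = 1 := by
    rcases heu with rfl | rfl <;> simp
  -- Once `e² = 1`, the matrix `M` acts on real parts as the translation by `e * M 0 1`, which lies
  -- in `𝔞_k ^ (-2)`.
  have hz : ((e : 𝓞 K) : K) * M 0 1 = 0 := by
    refine D.eq_zero_of_translationReduced (one_mul_mem (coe_mem_one _) hM2) hx hx' fun φ => ?_
    rw [xPart_act_upper hM0 hM1, ← map_pow, hesq, map_one, one_mul]
  have hM3 : M 0 1 = 0 := (mul_eq_zero.1 hz).resolve_left (by simp)
  have hA : toK A = D.A k * M * (D.A k)⁻¹ := by rw [hM]; group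
  have hM4 : M 1 1 * ((e : 𝓞 K) : K) = 1 := by
    have := M.det_coe
    rw [Matrix.det_fin_two, hM0, hM1] at this
    linear_combination this
  rcases heu with rfl | rfl
  · left
    have : M = 1 := by
      ext i l
      fin_cases i <;> fin_cases l
      · simpa using hM0
      · simpa using hM3
      · simpa using hM1
      · simpa using hM4
    apply toK_injective
    rw [hA, this, mul_one, mul_inv_cancel]
    exact (map_one (Matrix.SpecialLinearGroup.map (algebraMap (𝓞 K) K))).symm
  · right
    have : M = -1 := by
      ext i l
      fin_cases i <;> fin_cases l
      · simpa using hM0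
      · simpa using hM3
      · simpa using hM1
      · simp at hM4 ⊢
        linear_combination -hM4
    apply toK_injective
    rw [hA, this, mul_neg, mul_one, neg_mul, mul_inv_cancel]
    ext i l
    fin_cases i <;> fin_cases l <;> simp [toK]

theorem disjoint_translates {V W : SL(2, 𝓞 K)}
    (h : (QuotientGroup.mk V : Matrix.ProjectiveSpecialLinearGroup (Fin 2) (𝓞 K)) ≠
      QuotientGroup.mk W) :
    Disjoint (act (toK V) '' interior D.fundamentalDomain)
      (act (toK W) '' interior D.fundamentalDomain) := by
  classical
  rw [Set.disjoint_left]
  rintro _ ⟨u, hu, rfl⟩ ⟨u', hu', huu'⟩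
  set A := W⁻¹ * V with hA
  have hAu : act (toK A) u = u' := by
    rw [hA, toK_mul, act_mul, ← huu', ← act_mul, toK_inv, inv_mul_cancel, act_one]
  let O := interior D.fundamentalDomain ∩ act (toK A) ⁻¹' interior D.fundamentalDomain
  have hO : IsOpen O := isOpen_interior.inter (isOpen_interior.preimage (continuous_act _))
  -- Only the cusps `λ_j` and `A⁻¹ λ_k` can be compared, so finitely many pairs suffice and local
  -- finiteness of the closest cusps is not needed.
  let S : Finset ((𝓞 K × 𝓞 K) × (𝓞 K × 𝓞 K)) := Finset.univ.image
    fun q : Fin (classNumber K) × Fin (classNumber K) =>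
      ((D.ρ q.1, D.σ q.1), mulPair A⁻¹ (D.ρ q.2, D.σ q.2))
  have hS : ∀ s ∈ S, s.1 ≠ 0 ∧ s.2 ≠ 0 := by
    intro s hs
    obtain ⟨q, -, rfl⟩ := Finset.mem_image.1 hs
    exact ⟨D.cusp_ne_zero _, mulPair_ne_zero _ (D.cusp_ne_zero _)⟩
  obtain ⟨v, hvO, hv⟩ := (dense_forall_cuspDist_ne S hS).inter_open_nonempty O hO
    ⟨u, hu, by rw [Set.mem_preimage, hAu]; exact hu'⟩
  obtain ⟨j, hj⟩ := Set.mem_iUnion.1 (interior_subset hvO.1)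
  obtain ⟨k, hk⟩ := Set.mem_iUnion.1 (interior_subset hvO.2)
  have hA1 := D.eq_one_or_neg_one_of_mem_domainPart hj hk
    fun h1 h2 => h1.sameCusp_of_forall h2 hv (Finset.mem_image_of_mem _ (Finset.mem_univ (j, k)))
  apply h
  symm
  rw [QuotientGroup.eq, ← hA, Matrix.SpecialLinearGroup.mem_center_iff]
  rcases hA1 with h1 | h1
  · exact ⟨1, by simp, by rw [h1]; simp⟩
  · exact ⟨-1, by simp, by rw [h1]; ext i l; fin_cases i <;> fin_cases l <;> simp⟩

end TotallyReal

end ReductionData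

end Field

end

section

open Prog InnerProductSpace

/-! ### Gram-Schmidt vectors and swaps -/

section GramSchmidt

variable {E : Type*} [NormedAddCommGroup E] [InnerProductSpace ℝ E] {m : ℕ}

/-- The span of the vectors before the `j`-th one. -/
def prevSpan (f : Fin m → E) (j : Fin m) : Submodule ℝ E := Submodule.span ℝ (f '' Set.Iio j)

theorem mem_prevSpan (f : Fin m → E) {i j : Fin m} (h : i < j) : f i ∈ prevSpan f j :=
  Submodule.subset_span ⟨i, h, rfl⟩

theorem prevSpan_mono (f : Fin m → E) {i j : Fin m} (h : i ≤ j) : prevSpan f i ≤ prevSpan f j :=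
  Submodule.span_mono (Set.image_mono (Set.Iio_subset_Iio h))

theorem inner_gramSchmidt_of_mem {f : Fin m → E} {j : Fin m} {x : E} (hx : x ∈ prevSpan f j) :
    inner ℝ x (gramSchmidt ℝ f j) = 0 := by
  rw [prevSpan, ← span_gramSchmidt_Iio] at hx
  induction hx using Submodule.span_induction with
  | mem x hx =>
    obtain ⟨i, hi, rfl⟩ := hx
    exact gramSchmidt_orthogonal ℝ f (ne_of_lt hi)
  | zero => exact inner_zero_left _
  | add x y _ _ hx hy => rw [inner_add_left, hx, hy, add_zero]
  | smul c x _ hx => rw [inner_smul_left, hx, mul_zero]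

theorem gramSchmidt_mem_prevSpan (f : Fin m → E) {i j : Fin m} (h : i < j) :
    gramSchmidt ℝ f i ∈ prevSpan f j := by
  rw [prevSpan, ← span_gramSchmidt_Iio ℝ]
  exact Submodule.subset_span ⟨i, h, rfl⟩

theorem gramSchmidt_sub_mem (f : Fin m → E) (j : Fin m) :
    gramSchmidt ℝ f j - f j ∈ prevSpan f j := by
  have h := gramSchmidt_def'' ℝ f j
  have h2 : gramSchmidt ℝ f j - f j = -∑ i ∈ Finset.Iio j,
      (inner ℝ (gramSchmidt ℝ f i) (f j) / (‖gramSchmidt ℝ f i‖ : ℝ) ^ 2) •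
        gramSchmidt ℝ f i := by
    rw [sub_eq_iff_eq_add, eq_neg_add_iff_add_eq, add_comm]
    exact h.symm
  rw [h2]
  refine Submodule.neg_mem _ (Submodule.sum_mem _ fun i hi => Submodule.smul_mem _ _ ?_)
  exact gramSchmidt_mem_prevSpan f (Finset.mem_Iio.1 hi)

/-- The Gram-Schmidt vectors are characterized by the spans of the preceding vectors. -/
theorem gramSchmidt_eq_of {f : Fin m → E} {j : Fin m} {v : E} (h1 : v - f j ∈ prevSpan f j)
    (h2 : ∀ x ∈ prevSpan f j, inner ℝ x v = 0) : gramSchmidt ℝ f j = v := by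
  have h3 : gramSchmidt ℝ f j - v ∈ prevSpan f j := by
    have := Submodule.sub_mem _ (gramSchmidt_sub_mem f j) h1
    rwa [sub_sub_sub_cancel_right] at this
  have h4 : inner ℝ (gramSchmidt ℝ f j - v) (gramSchmidt ℝ f j - v) = 0 := by
    rw [inner_sub_right, inner_gramSchmidt_of_mem h3, h2 _ h3, sub_zero]
  exact sub_eq_zero.1 (inner_self_eq_zero.1 h4)

theorem norm_gramSchmidt_le (f : Fin m → E) (j : Fin m) : ‖gramSchmidt ℝ f j‖ ≤ ‖f j‖ := by
  have h1 := inner_gramSchmidt_of_mem (gramSchmidt_sub_mem f j)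
  rw [inner_sub_left, sub_eq_zero, real_inner_self_eq_norm_sq] at h1
  have h2 := real_inner_le_norm (f j) (gramSchmidt ℝ f j)
  rw [← h1, sq] at h2
  by_contra h
  push Not at h
  have := norm_nonneg (f j)
  nlinarith

theorem prevSpan_le_of {f f' : Fin m → E} (h : ∀ j, f' j - f j ∈ prevSpan f j) (j : Fin m) :
    prevSpan f' j ≤ prevSpan f j := by
  refine Submodule.span_le.2 ?_
  rintro _ ⟨i, hi, rfl⟩
  have h1 := Submodule.add_mem _ (prevSpan_mono f (le_of_lt hi) (h i)) (mem_prevSpan f hi)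
  rwa [sub_add_cancel] at h1

/-- Subtracting a multiple of an earlier vector keeps the flag of spans and the class of each vector
modulo the preceding span. These determine the Gram-Schmidt vectors. -/
theorem gramSchmidt_update (f : Fin m → E) {i j : Fin m} (hij : j < i) (c : ℝ) :
    gramSchmidt ℝ (Function.update f i (f i - c • f j)) = gramSchmidt ℝ f := by
  set f' := Function.update f i (f i - c • f j) with hf'
  have hi : f' i = f i - c • f j := by simp [hf']
  have hne : ∀ l, l ≠ i → f' l = f l := fun l hl => by simp [hf', hl]
  have h1 : ∀ l, f' l - f l ∈ prevSpan f l := by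
    intro l
    by_cases hl : l = i
    · subst hl
      rw [hi, sub_sub_cancel_left]
      exact Submodule.neg_mem _ (Submodule.smul_mem _ _ (mem_prevSpan f hij))
    · rw [hne l hl, sub_self]; exact Submodule.zero_mem _
  have h2 : ∀ l, f l - f' l ∈ prevSpan f' l := by
    intro l
    by_cases hl : l = i
    · subst hl
      rw [hi, sub_sub_cancel, ← hne j hij.ne]
      exact Submodule.smul_mem _ _ (mem_prevSpan f' hij)
    · rw [hne l hl, sub_self]; exact Submodule.zero_mem _
  have h3 : ∀ l, prevSpan f' l = prevSpan f l := fun l =>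
    le_antisymm (prevSpan_le_of h1 l) (prevSpan_le_of h2 l)
  ext l
  refine gramSchmidt_eq_of ?_ fun x hx => inner_gramSchmidt_of_mem (by rwa [← h3 l])
  rw [h3 l]
  have := Submodule.sub_mem _ (gramSchmidt_sub_mem f l) (h1 l)
  rwa [sub_sub_sub_cancel_right] at this

/-! ### Exchange of two neighbouring vectors -/

variable {f : Fin m → E} {i k : Fin m}

/-- Of the initial segments of indices only the one that ends between `i` and `k` is not preserved
by the exchange. -/
theorem prevSpan_swap (hik : (k : ℕ) = i + 1) {l : Fin m} (hl : l ≠ k) :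
    prevSpan (f ∘ Equiv.swap i k) l = prevSpan f l := by
  rw [prevSpan, prevSpan, Set.image_comp]
  congr 2
  have hi : ∀ x : Fin m, x < l → Equiv.swap i k x < l := by
    intro x hx
    have hl' : (l : ℕ) ≠ k := fun h => hl (Fin.ext h)
    by_cases h1 : x = i
    · subst h1; rw [Equiv.swap_apply_left]; rw [Fin.lt_def] at hx ⊢; omega
    · by_cases h2 : x = k
      · subst h2; rw [Equiv.swap_apply_right]; rw [Fin.lt_def] at hx ⊢; omega
      · rwa [Equiv.swap_apply_of_ne_of_ne h1 h2]
  ext x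
  constructor
  · rintro ⟨y, hy, rfl⟩; exact hi y hy
  · intro hx
    exact ⟨Equiv.swap i k x, hi x hx, Equiv.swap_apply_self i k x⟩

theorem gramSchmidt_swap_of_ne (hik : (k : ℕ) = i + 1) {l : Fin m} (hli : l ≠ i) (hlk : l ≠ k) :
    gramSchmidt ℝ (f ∘ Equiv.swap i k) l = gramSchmidt ℝ f l := by
  have h := prevSpan_swap (f := f) hik hlk
  refine gramSchmidt_eq_of ?_ fun x hx => inner_gramSchmidt_of_mem (by rwa [← h])
  rw [h, Function.comp_apply, Equiv.swap_apply_of_ne_of_ne hli hlk]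
  exact gramSchmidt_sub_mem f l

/-- The vector that replaces the `i`-th Gram-Schmidt vector after a swap. -/
def swapVec (f : Fin m → E) (i k : Fin m) : E :=
  (inner ℝ (gramSchmidt ℝ f i) (f k) / ‖gramSchmidt ℝ f i‖ ^ 2) • gramSchmidt ℝ f i +
    gramSchmidt ℝ f k

/-- The vector `f k` now has to be made orthogonal only to the vectors before `i`, so its component
along the old `i`-th Gram-Schmidt vector survives. -/
theorem gramSchmidt_swap_left (hik : (k : ℕ) = i + 1) :
    gramSchmidt ℝ (f ∘ Equiv.swap i k) i = swapVec f i k := by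
  have hlt : i < k := by rw [Fin.lt_def]; omega
  have h := prevSpan_swap (f := f) hik hlt.ne
  refine gramSchmidt_eq_of ?_ fun x hx => ?_
  · rw [h, Function.comp_apply, Equiv.swap_apply_left]
    have h1 := gramSchmidt_def'' ℝ f k
    have hsplit : Finset.Iio k = insert i (Finset.Iio i) := by
      ext x
      simp only [Finset.mem_Iio, Finset.mem_insert, Fin.lt_def, Fin.ext_iff]
      omega
    rw [hsplit, Finset.sum_insert (by simp)] at h1
    have h2 : swapVec f i k - f k = -∑ l ∈ Finset.Iio i,
        (inner ℝ (gramSchmidt ℝ f l) (f k) / (‖gramSchmidt ℝ f l‖ : ℝ) ^ 2) •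
          gramSchmidt ℝ f l := by
      conv_lhs => rw [h1]
      rw [swapVec]
      simp only [RCLike.ofReal_real_eq_id, id]
      abel
    rw [h2]
    refine Submodule.neg_mem _ (Submodule.sum_mem _ fun l hl => Submodule.smul_mem _ _ ?_)
    exact gramSchmidt_mem_prevSpan f (Finset.mem_Iio.1 hl)
  · rw [h] at hx
    rw [swapVec, inner_add_right, inner_smul_right, inner_gramSchmidt_of_mem hx,
      inner_gramSchmidt_of_mem (prevSpan_mono f hlt.le hx), mul_zero, add_zero]

theorem gramSchmidt_swap_right (hik : (k : ℕ) = i + 1) :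
    gramSchmidt ℝ (f ∘ Equiv.swap i k) k = gramSchmidt ℝ f i -
      (inner ℝ (swapVec f i k) (gramSchmidt ℝ f i) / ‖swapVec f i k‖ ^ 2) • swapVec f i k := by
  have hlt : i < k := by rw [Fin.lt_def]; omega
  have h := prevSpan_swap (f := f) hik hlt.ne
  have hv := gramSchmidt_swap_left (f := f) hik
  set f' := f ∘ Equiv.swap i k with hf'
  set v := swapVec f i k with hv'
  have hvorth : ∀ x ∈ prevSpan f i, inner ℝ x v = 0 := fun x hx => by
    rw [← hv]; exact inner_gramSchmidt_of_mem (by rwa [h])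
  have horth : inner ℝ v (gramSchmidt ℝ f i - (inner ℝ v (gramSchmidt ℝ f i) / ‖v‖ ^ 2) • v) = 0 := by
    rw [inner_sub_right, inner_smul_right, real_inner_self_eq_norm_sq]
    by_cases h0 : ‖v‖ ^ 2 = 0
    · have : v = 0 := by simpa using h0
      simp [this]
    · rw [div_mul_cancel₀ _ h0, sub_self]
  refine gramSchmidt_eq_of ?_ fun x hx => ?_
  · have e : f' k = f i := by simp [hf']
    rw [e, sub_sub, add_comm, ← sub_sub]
    refine Submodule.sub_mem _ ?_ (Submodule.smul_mem _ _ ?_)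
    · refine prevSpan_mono f' hlt.le ?_
      rw [h]; exact gramSchmidt_sub_mem f i
    · rw [← hv]; exact gramSchmidt_mem_prevSpan f' hlt
  · rw [prevSpan, ← span_gramSchmidt_Iio] at hx
    induction hx using Submodule.span_induction with
    | mem x hx =>
      obtain ⟨l, hl, rfl⟩ := hx
      rw [Set.mem_Iio, Fin.lt_def] at hl
      by_cases hli : l = i
      · rw [hli, hv]; exact horth
      · have hlt2 : l < i := by
          have : (l : ℕ) ≠ i := fun h => hli (Fin.ext h)
          rw [Fin.lt_def]; omega
        have hlk : l ≠ k := (hlt2.trans hlt).ne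
        have hm : gramSchmidt ℝ f l ∈ prevSpan f i := gramSchmidt_mem_prevSpan f hlt2
        rw [gramSchmidt_swap_of_ne hik hli hlk, inner_sub_right, inner_smul_right,
          inner_gramSchmidt_of_mem hm, hvorth _ hm, mul_zero, sub_zero]
    | zero => exact inner_zero_left _
    | add x y _ _ hx hy => rw [inner_add_left, hx, hy, add_zero]
    | smul c x _ hx => rw [inner_smul_left, hx, mul_zero]

theorem norm_sq_swapVec (hik : (k : ℕ) = i + 1) :
    ‖swapVec f i k‖ ^ 2 = (inner ℝ (gramSchmidt ℝ f i) (f k) / ‖gramSchmidt ℝ f i‖ ^ 2) ^ 2 *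
      ‖gramSchmidt ℝ f i‖ ^ 2 + ‖gramSchmidt ℝ f k‖ ^ 2 := by
  have hne : i ≠ k := by rw [Ne, Fin.ext_iff]; omega
  rw [swapVec, norm_add_sq_real, inner_smul_left, gramSchmidt_orthogonal ℝ f hne, norm_smul,
    mul_pow, Real.norm_eq_abs, sq_abs]
  simp

/-- A swap keeps the product of the squared lengths of the two Gram-Schmidt vectors. -/
theorem norm_sq_mul_norm_sq_swap (hik : (k : ℕ) = i + 1) (hk : gramSchmidt ℝ f k ≠ 0) :
    ‖gramSchmidt ℝ (f ∘ Equiv.swap i k) i‖ ^ 2 * ‖gramSchmidt ℝ (f ∘ Equiv.swap i k) k‖ ^ 2 =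
      ‖gramSchmidt ℝ f i‖ ^ 2 * ‖gramSchmidt ℝ f k‖ ^ 2 := by
  have hne : i ≠ k := by rw [Ne, Fin.ext_iff]; omega
  rw [gramSchmidt_swap_left hik, gramSchmidt_swap_right hik]
  have h1 := norm_sq_swapVec (f := f) hik
  have h2 : inner ℝ (swapVec f i k) (gramSchmidt ℝ f i) =
      (inner ℝ (gramSchmidt ℝ f i) (f k) / ‖gramSchmidt ℝ f i‖ ^ 2) *
        ‖gramSchmidt ℝ f i‖ ^ 2 := by
    rw [swapVec, inner_add_left, inner_smul_left, gramSchmidt_orthogonal ℝ f hne.symm,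
      real_inner_self_eq_norm_sq]
    simp
  set v := swapVec f i k
  set g := gramSchmidt ℝ f i
  set μ := inner ℝ g (f k) / ‖g‖ ^ 2
  have hkpos : 0 < ‖gramSchmidt ℝ f k‖ ^ 2 := by positivity
  have hvpos : 0 < ‖v‖ ^ 2 := by
    rw [h1]; positivity
  rw [norm_sub_sq_real, inner_smul_right, norm_smul, mul_pow, Real.norm_eq_abs, sq_abs,
    real_inner_comm v g, h2]
  generalize ‖v‖ ^ 2 = V at *
  generalize ‖g‖ ^ 2 = G at *
  have hV := hvpos.ne'
  have e : V * (G - 2 * (μ * G / V * (μ * G)) + (μ * G / V) ^ 2 * V) = G * (V - μ ^ 2 * G) := by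
    field_simp
    ring
  rw [e, h1]
  ring

/-- The new vector is an orthogonal projection of the old `i`-th Gram-Schmidt vector. This keeps a
common upper bound for all lengths. -/
theorem norm_sq_swap_right_le (hik : (k : ℕ) = i + 1) :
    ‖gramSchmidt ℝ (f ∘ Equiv.swap i k) k‖ ^ 2 ≤ ‖gramSchmidt ℝ f i‖ ^ 2 := by
  rw [gramSchmidt_swap_right hik, norm_sub_sq_real, inner_smul_right, norm_smul, mul_pow,
    Real.norm_eq_abs, sq_abs, real_inner_comm (swapVec f i k)]
  set v := swapVec f i k
  set g := gramSchmidt ℝ f i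
  by_cases h0 : ‖v‖ ^ 2 = 0
  · simp [h0]
  · have hvpos : 0 < ‖v‖ ^ 2 := lt_of_le_of_ne (sq_nonneg _) (Ne.symm h0)
    have : 2 * (inner ℝ v g / ‖v‖ ^ 2 * inner ℝ v g) =
        2 * ((inner ℝ v g / ‖v‖ ^ 2) ^ 2 * ‖v‖ ^ 2) := by
      field_simp
    rw [this]
    nlinarith [mul_nonneg (sq_nonneg (inner ℝ v g / ‖v‖ ^ 2)) hvpos.le]

/-- The potential of a basis, which decreases with each swap of the LLL algorithm. -/
def potential (f : Fin m → E) : ℝ := ∏ j, (‖gramSchmidt ℝ f j‖ ^ 2) ^ (m - (j : ℕ))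

theorem prod_split {i k : Fin m} (hne : i ≠ k) (F : Fin m → ℝ) :
    ∏ j, F j = F i * F k * ∏ j ∈ (Finset.univ.erase i).erase k, F j := by
  rw [mul_assoc, Finset.mul_prod_erase _ _ (by simp [hne.symm]),
    Finset.mul_prod_erase _ _ (Finset.mem_univ i)]

theorem prod_norm_sq_swap (hik : (k : ℕ) = i + 1) (hk : gramSchmidt ℝ f k ≠ 0) :
    ∏ j, ‖gramSchmidt ℝ (f ∘ Equiv.swap i k) j‖ ^ 2 = ∏ j, ‖gramSchmidt ℝ f j‖ ^ 2 := by
  have hne : i ≠ k := by rw [Ne, Fin.ext_iff]; omega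
  rw [prod_split hne, prod_split hne fun j => ‖gramSchmidt ℝ f j‖ ^ 2,
    norm_sq_mul_norm_sq_swap hik hk]
  congr 1
  refine Finset.prod_congr rfl fun l hl => ?_
  simp only [Finset.mem_erase, Finset.mem_univ, and_true] at hl
  rw [gramSchmidt_swap_of_ne hik hl.2 hl.1]

/-- The exponent at `i` exceeds the one at `k` by one, and the product of the two squared lengths is
preserved. So the potential changes exactly by the ratio of the squared lengths at `i`, which is
below `3/4`. -/
theorem potential_swap_le (hik : (k : ℕ) = i + 1) (hi : gramSchmidt ℝ f i ≠ 0)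
    (hk : gramSchmidt ℝ f k ≠ 0) (h : ‖swapVec f i k‖ ^ 2 < 3 / 4 * ‖gramSchmidt ℝ f i‖ ^ 2) :
    potential (f ∘ Equiv.swap i k) ≤ 3 / 4 * potential f := by
  have hne : i ≠ k := by rw [Ne, Fin.ext_iff]; omega
  have hprod := norm_sq_mul_norm_sq_swap hik hk
  rw [potential, potential, prod_split hne,
    prod_split hne fun j => (‖gramSchmidt ℝ f j‖ ^ 2) ^ (m - (j : ℕ))]
  have hrest : ∏ l ∈ (Finset.univ.erase i).erase k,
      (‖gramSchmidt ℝ (f ∘ Equiv.swap i k) l‖ ^ 2) ^ (m - (l : ℕ)) =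
      ∏ l ∈ (Finset.univ.erase i).erase k, (‖gramSchmidt ℝ f l‖ ^ 2) ^ (m - (l : ℕ)) := by
    refine Finset.prod_congr rfl fun l hl => ?_
    simp only [Finset.mem_erase, Finset.mem_univ, and_true] at hl
    rw [gramSchmidt_swap_of_ne hik hl.2 hl.1]
  rw [hrest, ← mul_assoc]
  refine mul_le_mul_of_nonneg_right ?_ (Finset.prod_nonneg fun l _ => by positivity)
  have hmi : m - (i : ℕ) = (m - (k : ℕ)) + 1 := by have := k.2; omega
  rw [hmi, pow_succ _ (m - (k : ℕ)), pow_succ _ (m - (k : ℕ))]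
  rw [gramSchmidt_swap_left hik] at hprod ⊢
  set a' := ‖swapVec f i k‖ ^ 2
  set b' := ‖gramSchmidt ℝ (f ∘ Equiv.swap i k) k‖ ^ 2
  set a := ‖gramSchmidt ℝ f i‖ ^ 2
  set b := ‖gramSchmidt ℝ f k‖ ^ 2
  have e1 : a' ^ (m - (k : ℕ)) * a' * b' ^ (m - (k : ℕ)) = (a * b) ^ (m - (k : ℕ)) * a' := by
    rw [← hprod, mul_pow]; ring
  have e2 : 3 / 4 * (a ^ (m - (k : ℕ)) * a * b ^ (m - (k : ℕ))) =
      (a * b) ^ (m - (k : ℕ)) * (3 / 4 * a) := by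
    rw [mul_pow]; ring
  rw [e1, e2]
  exact mul_le_mul_of_nonneg_left h.le (by positivity)

end GramSchmidt

end

/-! ### The LLL algorithm -/

section

open Prog InnerProductSpace

theorem mem_zip_finRange_tail {m : ℕ} {q : Fin m × Fin m}
    (h : q ∈ (List.finRange m).zip (List.finRange m).tail) : (q.2 : ℕ) = q.1 + 1 := by
  obtain ⟨i, hi, rfl⟩ := List.mem_iff_getElem.1 h
  simp

/-- The lower bound for the Gram-Schmidt vectors in terms of their product. -/
theorem le_of_prod_eq {m : ℕ} {F : Fin m → ℝ} {P M : ℝ} (h0 : ∀ j, 0 ≤ F j) (hM : ∀ j, F j ≤ M)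
    (hM1 : 1 ≤ M) (hP : ∏ j, F j = P) (j : Fin m) : P / M ^ m ≤ F j := by
  have hpos : 0 < M ^ m := by positivity
  rw [div_le_iff₀ hpos, ← hP, ← Finset.mul_prod_erase _ _ (Finset.mem_univ j)]
  refine mul_le_mul_of_nonneg_left ?_ (h0 j)
  calc ∏ l ∈ Finset.univ.erase j, F l ≤ ∏ l ∈ Finset.univ.erase j, M :=
        Finset.prod_le_prod (fun l _ => h0 l) fun l _ => hM l
    _ = M ^ (Finset.univ.erase j).card := by simp
    _ ≤ M ^ m := pow_le_pow_right₀ hM1 (by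
        refine (Finset.card_le_univ _).trans ?_
        simp)

/-- A number of swaps that suffices for the LLL algorithm. -/
theorem exists_swap_bound {Φ₀ δ : ℝ} (hδ : 0 < δ) : ∃ k : ℕ,
    Φ₀ ≤ (4 / 3 : ℝ) ^ k * δ ∧ (k : ℝ) ≤ 3 * |Φ₀ / δ| + 1 := by
  -- Bernoulli's inequality `(1 + 1/3)^k ≥ 1 + k/3` gives a linear number of swaps. A logarithmic
  -- bound is not needed for a polynomial running time.
  refine ⟨⌈3 * |Φ₀ / δ|⌉₊, ?_, ?_⟩
  · have h1 := Nat.le_ceil (3 * |Φ₀ / δ|)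
    have h2 := one_add_mul_le_pow (a := (1 / 3 : ℝ)) (by norm_num) ⌈3 * |Φ₀ / δ|⌉₊
    have h3 : Φ₀ / δ ≤ (1 + 1 / 3 : ℝ) ^ ⌈3 * |Φ₀ / δ|⌉₊ := by
      have := le_abs_self (Φ₀ / δ)
      linarith
    rw [div_le_iff₀ hδ] at h3
    have e : (4 / 3 : ℝ) = 1 + 1 / 3 := by norm_num
    rw [e]
    exact h3
  · exact (Nat.ceil_lt_add_one (by positivity)).le

section Field

variable {K : Type*} [Field K] [NumberField K]

namespace ReductionData

variable (D : ReductionData K)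

theorem gramCoeff_eq (g v : EuclideanSpace ℂ (K →+* ℝ)) :
    gramCoeff g v = inner ℝ g v / ‖g‖ ^ 2 := by
  rw [gramCoeff, PiLp.inner_apply]
  congr 1
  refine Finset.sum_congr rfl fun φ _ => ?_
  rw [Complex.inner, Complex.mul_re, Complex.conj_re, Complex.conj_im]
  ring

theorem latticeVec_apply (z : HK K) (p : 𝓞 K × 𝓞 K) (φ : K →+* ℝ) :
    latticeVec z p φ = (φ (p.1 : K) : ℂ) - (φ (p.2 : K) : ℂ) * (z φ : ℂ) := rfl

theorem latticeVec_sub_smul (z : HK K) (p q : 𝓞 K × 𝓞 K) (n : ℤ) :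
    latticeVec z (p - n • q) = latticeVec z p - (n : ℝ) • latticeVec z q := by
  ext φ
  simp only [latticeVec_apply, PiLp.sub_apply, PiLp.smul_apply, Prod.fst_sub, Prod.snd_sub,
    map_sub, zsmul_eq_mul, Complex.ofReal_sub]
  simp
  ring

theorem latticeVec_update (z : HK K) {m : ℕ} (b : Fin m → 𝓞 K × 𝓞 K) (i j : Fin m) (n : ℤ) :
    (fun l => latticeVec z (Function.update b i (b i - n • b j) l)) =
      Function.update (fun l => latticeVec z (b l)) i
        (latticeVec z (b i) - (n : ℝ) • latticeVec z (b j)) := by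
  funext l
  by_cases hl : l = i
  · subst hl
    rw [Function.update_self, Function.update_self, latticeVec_sub_smul]
  · rw [Function.update_of_ne hl, Function.update_of_ne hl]

theorem gramVecs_update (z : HK K) (b : Fin (deg K + deg K) → 𝓞 K × 𝓞 K)
    {i j : Fin (deg K + deg K)} (hij : j < i) (n : ℤ) :
    gramVecs z (Function.update b i (b i - n • b j)) = gramVecs z b := by
  unfold gramVecs
  rw [latticeVec_update]
  exact gramSchmidt_update (fun l => latticeVec z (b l)) hij (n : ℝ)

/-- Size reduction does not change the Gram-Schmidt vectors. -/
theorem spec_sizeReduce (z : HK K) (b : Fin (deg K + deg K) → 𝓞 K × 𝓞 K) :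
    Spec (sizeReduce z (gramVecs z b) b)
      (((List.finRange (deg K + deg K)).flatMap fun i =>
        (((List.finRange (deg K + deg K)).filter fun j => j < i).reverse).map
          fun j => (i, j)).length * (20 * deg K + 10 : ℕ))
      fun b' => gramVecs z b' = gramVecs z b := by
  refine (Spec.forEach (Inv := fun b' => gramVecs z b' = gramVecs z b) (P := fun _ _ => True)
    ?_ rfl).mono le_rfl fun _ h => h.1
  rintro b' hb' ⟨i, j⟩ hij
  have hlt : j < i := by
    simp only [List.mem_flatMap, List.mem_map, List.mem_reverse, List.mem_filter,
      Prod.mk.injEq, decide_eq_true_eq] at hij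
    obtain ⟨_, -, _, ⟨-, h⟩, rfl, rfl⟩ := hij
    exact h
  refine Spec.charge (Spec.ret (by simp) ⟨?_, trivial, fun _ h => h⟩)
  exact (gramVecs_update z b' hlt _).trans hb'

theorem swapVec_eq (z : HK K) (b : Fin (deg K + deg K) → 𝓞 K × 𝓞 K)
    (i k : Fin (deg K + deg K)) :
    gramCoeff (gramVecs z b i) (latticeVec z (b k)) • gramVecs z b i + gramVecs z b k =
      swapVec (fun l => latticeVec z (b l)) i k := by
  rw [gramCoeff_eq]; rfl

/-- The invariant of the LLL algorithm. -/
def LLLInv (z : HK K) (M P : ℝ) (b : Fin (deg K + deg K) → 𝓞 K × 𝓞 K) : Prop :=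
  (∏ j, ‖gramVecs z b j‖ ^ 2 = P) ∧ ∀ j, ‖gramVecs z b j‖ ^ 2 ≤ M

theorem LLLInv.ne_zero {z : HK K} {M P : ℝ} {b : Fin (deg K + deg K) → 𝓞 K × 𝓞 K}
    (h : LLLInv z M P b) (hP : 0 < P) (j) : gramVecs z b j ≠ 0 := by
  intro h0
  rw [← h.1, Finset.prod_eq_zero (Finset.mem_univ j) (by simp [h0])] at hP
  exact lt_irrefl _ hP

/-- The violated Lovász condition shortens the vector at `i`, the one at `k` becomes a projection of
the old vector at `i`, and the product of all squared lengths is preserved. -/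
theorem LLLInv.swap {z : HK K} {M P : ℝ} {b : Fin (deg K + deg K) → 𝓞 K × 𝓞 K}
    (h : LLLInv z M P b) (hP : 0 < P) {i k : Fin (deg K + deg K)} (hik : (k : ℕ) = i + 1)
    (hlt : ‖swapVec (fun l => latticeVec z (b l)) i k‖ ^ 2 < 3 / 4 * ‖gramVecs z b i‖ ^ 2) :
    LLLInv z M P (b ∘ Equiv.swap i k) := by
  have hk := h.ne_zero hP k
  refine ⟨?_, fun j => ?_⟩
  · rw [← h.1]
    exact prod_norm_sq_swap (f := fun l => latticeVec z (b l)) hik hk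
  · by_cases hji : j = i
    · subst hji
      have e : gramVecs z (b ∘ Equiv.swap j k) j = swapVec (fun l => latticeVec z (b l)) j k :=
        gramSchmidt_swap_left (f := fun l => latticeVec z (b l)) hik
      rw [e]
      have := h.2 j
      nlinarith [sq_nonneg ‖gramVecs z b j‖]
    · by_cases hjk : j = k
      · subst hjk
        exact (norm_sq_swap_right_le (f := fun l => latticeVec z (b l)) hik).trans (h.2 i)
      · have e : gramVecs z (b ∘ Equiv.swap i k) j = gramVecs z b j :=
          gramSchmidt_swap_of_ne (f := fun l => latticeVec z (b l)) hik hji hjk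
        rw [e]; exact h.2 j

/-- The potential of a basis of the lattice `L_z`. -/
def latticePotential (z : HK K) (b : Fin (deg K + deg K) → 𝓞 K × 𝓞 K) : ℝ :=
  potential fun l => latticeVec z (b l)

/-- A fixed product `P` of factors at most `M` bounds every factor from below. This replaces the
usual estimates of the determinants of sublattices. -/
theorem LLLInv.le_latticePotential {z : HK K} {M P : ℝ} {b : Fin (deg K + deg K) → 𝓞 K × 𝓞 K}
    (h : LLLInv z M P b) (hP : 0 < P) (hM : 1 ≤ M) :
    ∏ j : Fin (deg K + deg K), (P / M ^ (deg K + deg K)) ^ (deg K + deg K - (j : ℕ)) ≤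
      latticePotential z b := by
  refine Finset.prod_le_prod (fun j _ => by positivity) fun j _ => ?_
  refine pow_le_pow_left₀ (by positivity) ?_ _
  exact le_of_prod_eq (fun j => sq_nonneg _) h.2 hM h.1 j

theorem LLLInv.latticePotential_le {z : HK K} {M P : ℝ} {b : Fin (deg K + deg K) → 𝓞 K × 𝓞 K}
    (h : LLLInv z M P b) :
    latticePotential z b ≤ ∏ j : Fin (deg K + deg K), M ^ (deg K + deg K - (j : ℕ)) := by
  unfold latticePotential potential
  refine Finset.prod_le_prod (fun j _ => by positivity) fun j _ => ?_
  exact pow_le_pow_left₀ (sq_nonneg _) (h.2 j) _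

theorem latticePotential_eq_of_gramVecs_eq {z : HK K} {b b' : Fin (deg K + deg K) → 𝓞 K × 𝓞 K}
    (h : gramVecs z b' = gramVecs z b) : latticePotential z b' = latticePotential z b := by
  change ∏ j, (‖gramVecs z b' j‖ ^ 2) ^ (deg K + deg K - (j : ℕ)) =
    ∏ j, (‖gramVecs z b j‖ ^ 2) ^ (deg K + deg K - (j : ℕ))
  rw [h]

/-- The LLL algorithm returns a vector of bounded length. -/
theorem exists_lll_cost : ∃ c : ℝ, 0 ≤ c ∧ ∀ (z : HK K) (M P : ℝ), 1 ≤ M → 0 < P →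
    LLLInv z M P (Fin.append (fun i => (D.α i, 0)) (fun i => (0, D.α i))) →
    Spec (D.lll z) (c * (3 * |(∏ j : Fin (deg K + deg K), M ^ (deg K + deg K - (j : ℕ))) /
        ∏ j : Fin (deg K + deg K),
          (P / M ^ (deg K + deg K)) ^ (deg K + deg K - (j : ℕ))| + 2))
      fun l => l ≠ 0 ∧ ‖latticeVec z l‖ ^ 2 ≤ M := by
  set L := ((List.finRange (deg K + deg K)).flatMap fun i =>
        (((List.finRange (deg K + deg K)).filter fun j => j < i).reverse).map
          fun j => (i, j)).length with hL
  set c : ℝ := (100 * deg K ^ 3 : ℕ) + L * (20 * deg K + 10 : ℕ) + (100 * deg K ^ 2 : ℕ) with hc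
  refine ⟨c, by positivity, fun z M P hM hP h0 => ?_⟩
  set δ := ∏ j : Fin (deg K + deg K), (P / M ^ (deg K + deg K)) ^ (deg K + deg K - (j : ℕ))
  set Φ := ∏ j : Fin (deg K + deg K), M ^ (deg K + deg K - (j : ℕ))
  have hδ : 0 < δ := Finset.prod_pos fun j _ => by positivity
  obtain ⟨k, hk1, hk2⟩ := exists_swap_bound (Φ₀ := Φ) hδ
  -- The remaining number of swaps is measured by the potential relative to its lower bound `δ`: at
  -- most `k` swaps remain if it is at most `(4/3)^k δ`.
  refine (Spec.loop (T := c)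
    (fun k b => LLLInv z M P b ∧ latticePotential z b ≤ (4 / 3 : ℝ) ^ k * δ) ?_ k _
    ⟨h0, h0.latticePotential_le.trans hk1⟩).mono ?_ fun _ h => h
  · rintro k b ⟨hb, hpot⟩
    refine Spec.charge ((spec_sizeReduce z b).bind fun b' hb' => Spec.charge ?_)
    have hinv' : LLLInv z M P b' := by rw [LLLInv, hb']; exact hb
    have hT : (0 : ℝ) ≤ c - (100 * deg K ^ 3 : ℕ) - (L * (20 * deg K + 10 : ℕ)) -
        (100 * deg K ^ 2 : ℕ) := by
      rw [hc]; linarith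
    split
    · refine Spec.ret hT ?_
      have hidx : ∀ j : Fin (deg K + deg K), (j : ℕ) = 0 → gramVecs z b' j = latticeVec z (b' j) := by
        intro j hj
        have he : Finset.Iio j = ∅ := by
          ext x; simp [Fin.lt_def, hj]
        rw [gramVecs, gramSchmidt_def, he, Finset.sum_empty, sub_zero]
      have h1 := hidx ⟨0, Nat.add_pos_left finrank_pos _⟩ rfl
      refine ⟨fun h => hinv'.ne_zero hP ⟨0, Nat.add_pos_left finrank_pos _⟩ ?_, ?_⟩
      · rw [h1, h]
        ext φ; simp [latticeVec_apply]
      · rw [← h1]; exact hinv'.2 _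
    · rename_i q hq
      refine Spec.ret hT ?_
      have hmem := mem_zip_finRange_tail (List.mem_of_find?_eq_some hq)
      have hlt : ‖gramCoeff (gramVecs z b q.1) (latticeVec z (b' q.2)) • gramVecs z b q.1 +
          gramVecs z b q.2‖ ^ 2 < 3 / 4 * ‖gramVecs z b q.1‖ ^ 2 := by
        simpa using List.find?_some hq
      -- The condition was tested with the Gram-Schmidt vectors of `b`, which are also those of the
      -- size-reduced basis `b'`.
      rw [← hb', swapVec_eq] at hlt
      have hnew := hinv'.swap hP hmem hlt
      have hpot' : latticePotential z (b' ∘ Equiv.swap q.1 q.2) ≤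
          3 / 4 * latticePotential z b' :=
        potential_swap_le (f := fun l => latticeVec z (b' l)) hmem (hinv'.ne_zero hP _)
          (hinv'.ne_zero hP _) hlt
      rw [latticePotential_eq_of_gramVecs_eq hb'] at hpot'
      have hlow := hnew.le_latticePotential hP hM
      cases k with
      | zero =>
        -- One more swap would push the potential below `δ`.
        rw [pow_zero, one_mul] at hpot
        change δ ≤ _ at hlow
        linarith
      | succ k =>
        refine ⟨k, rfl, hnew, ?_⟩
        rw [pow_succ] at hpot
        linarith
  · rw [mul_comm]
    refine mul_le_mul_of_nonneg_left ?_ (by positivity)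
    push_cast
    linarith

/-! ### The initial basis -/

/-- The vector `ρ` of a combination `ρ - σ z`. -/
def coordA (z : HK K) : EuclideanSpace ℂ (K →+* ℝ) →ₗ[ℝ] ((K →+* ℝ) → ℝ) where
  toFun v := fun φ => (v φ).re - (v φ).im * (xPart z φ / yPart z φ)
  map_add' v w := by ext φ; simp; ring
  map_smul' c v := by ext φ; simp; ring

/-- The vector `σ` of a combination `ρ - σ z`. -/
def coordB (z : HK K) : EuclideanSpace ℂ (K →+* ℝ) →ₗ[ℝ] ((K →+* ℝ) → ℝ) where
  toFun v := fun φ => -(v φ).im / yPart z φ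
  map_add' v w := by ext φ; simp; ring
  map_smul' c v := by ext φ; simp; ring

theorem coordA_latticeVec (z : HK K) (p : 𝓞 K × 𝓞 K) :
    coordA z (latticeVec z p) = fun φ => φ (p.1 : K) := by
  ext φ
  have hy := (yPart_pos z φ).ne'
  simp only [coordA, LinearMap.coe_mk, AddHom.coe_mk, latticeVec_apply]
  simp only [xPart, yPart] at hy ⊢
  simp
  field_simp
  ring

theorem coordB_latticeVec (z : HK K) (p : 𝓞 K × 𝓞 K) :
    coordB z (latticeVec z p) = fun φ => φ (p.2 : K) := by
  ext φ
  have hy := (yPart_pos z φ).ne'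
  simp only [coordB, LinearMap.coe_mk, AddHom.coe_mk, latticeVec_apply]
  simp only [yPart] at hy ⊢
  simp
  field_simp

theorem abs_coordB_le (z : HK K) (v : EuclideanSpace ℂ (K →+* ℝ)) (φ : K →+* ℝ) :
    |coordB z v φ| ≤ size z * ‖v‖ := by
  have hy := yPart_pos z φ
  have h1 : |(v φ).im| ≤ ‖v‖ := (Complex.abs_im_le_norm _).trans (PiLp.norm_apply_le v φ)
  change |-(v φ).im / yPart z φ| ≤ _
  rw [abs_div, abs_neg, abs_of_pos hy, div_eq_mul_inv, mul_comm]
  exact mul_le_mul (inv_yPart_le z φ) h1 (abs_nonneg _) (zero_le_one.trans (one_le_size z))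

theorem abs_coordA_le (z : HK K) (v : EuclideanSpace ℂ (K →+* ℝ)) (φ : K →+* ℝ) :
    |coordA z v φ| ≤ (1 + size z ^ 2) * ‖v‖ := by
  have h1 : |(v φ).re| ≤ ‖v‖ := (Complex.abs_re_le_norm _).trans (PiLp.norm_apply_le v φ)
  have h2 : coordA z v φ = (v φ).re + coordB z v φ * xPart z φ := by
    change (v φ).re - (v φ).im * (xPart z φ / yPart z φ) =
      (v φ).re + -(v φ).im / yPart z φ * xPart z φ
    ring
  rw [h2]
  refine (abs_add_le _ _).trans ?_
  rw [abs_mul]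
  have h3 := mul_le_mul (abs_coordB_le z v φ) (abs_xPart_le z φ) (abs_nonneg _)
    (mul_nonneg (zero_le_one.trans (one_le_size z)) (norm_nonneg _))
  calc _ ≤ ‖v‖ + size z * ‖v‖ * size z := add_le_add h1 h3
    _ = _ := by ring

section TotallyReal

variable [IsTotallyReal K]

/-- The dual coordinate functional `ℓ` of the `j`-th vector vanishes on the earlier ones. So it
takes the value `1` on the `j`-th Gram-Schmidt vector, which cannot be short since `ℓ` has
polynomially bounded norm. -/
theorem one_le_norm_gramVecs (z : HK K) (j : Fin (deg K + deg K)) :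
    1 ≤ entrySum (leftInv D.BO) * ((1 + size z ^ 2) *
      ‖gramVecs z (Fin.append (fun i => (D.α i, 0)) (fun i => (0, D.α i))) j‖) := by
  set b : Fin (deg K + deg K) → 𝓞 K × 𝓞 K :=
    Fin.append (fun i => (D.α i, 0)) (fun i => (0, D.α i)) with hb
  have hs := one_le_size z
  have key : ∃ ℓ : EuclideanSpace ℂ (K →+* ℝ) →ₗ[ℝ] ℝ,
      (∀ l, ℓ (latticeVec z (b l)) = if l = j then 1 else 0) ∧
      ∀ v, |ℓ v| ≤ entrySum (leftInv D.BO) * ((1 + size z ^ 2) * ‖v‖) := by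
    have hrepr : ∀ x : 𝓞 K, (leftInv D.BO).mulVec (fun φ => φ (x : K)) =
        fun k => (D.α.repr x k : ℝ) := fun x => (D.repr_eq_leftInv x).symm
    refine Fin.addCases (fun i => ?_) (fun i => ?_) j
    · refine ⟨(LinearMap.proj i ∘ₗ (leftInv D.BO).mulVecLin) ∘ₗ coordA z, fun l => ?_, fun v => ?_⟩
      · simp only [LinearMap.comp_apply, LinearMap.proj_apply, Matrix.mulVecLin_apply,
          coordA_latticeVec, hrepr]
        refine Fin.addCases (fun l => ?_) (fun l => ?_) l
        · simp [hb, Fin.append_left, Finsupp.single_apply]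
        · rw [if_neg fun h => absurd (congrArg Fin.val h) (by simp; have := i.2; omega)]
          simp only [hb, Fin.append_right, map_zero, Finsupp.zero_apply, Int.cast_zero]
      · simp only [LinearMap.comp_apply, LinearMap.proj_apply, Matrix.mulVecLin_apply]
        exact abs_mulVec_le _ (abs_coordA_le z v) (by positivity) i
    · refine ⟨(LinearMap.proj i ∘ₗ (leftInv D.BO).mulVecLin) ∘ₗ coordB z, fun l => ?_, fun v => ?_⟩
      · simp only [LinearMap.comp_apply, LinearMap.proj_apply, Matrix.mulVecLin_apply,
          coordB_latticeVec, hrepr]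
        refine Fin.addCases (fun l => ?_) (fun l => ?_) l
        · rw [if_neg fun h => absurd (congrArg Fin.val h) (by simp; have := l.2; omega)]
          simp only [hb, Fin.append_left, map_zero, Finsupp.zero_apply, Int.cast_zero]
        · simp only [hb, Fin.append_right, Basis.repr_self, Finsupp.single_apply,
            (Fin.natAdd_injective _ _).eq_iff]
          split_ifs <;> simp
      · simp only [LinearMap.comp_apply, LinearMap.proj_apply, Matrix.mulVecLin_apply]
        refine abs_mulVec_le _ (fun φ => (abs_coordB_le z v φ).trans ?_) (by positivity) i
        refine mul_le_mul_of_nonneg_right ?_ (norm_nonneg _)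
        nlinarith
  obtain ⟨ℓ, hℓ1, hℓ2⟩ := key
  have hker : prevSpan (fun l => latticeVec z (b l)) j ≤ LinearMap.ker ℓ := by
    refine Submodule.span_le.2 ?_
    rintro _ ⟨l, hl, rfl⟩
    rw [SetLike.mem_coe, LinearMap.mem_ker, hℓ1, if_neg (ne_of_lt hl)]
  have h1 := hker (gramSchmidt_sub_mem (fun l => latticeVec z (b l)) j)
  rw [LinearMap.mem_ker, map_sub, hℓ1, if_pos rfl, sub_eq_zero] at h1
  have h2 := hℓ2 (gramVecs z b j)
  rwa [gramVecs, h1, abs_one] at h2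

theorem exists_norm_latticeVec_le : ∃ c : ℝ, 1 ≤ c ∧ ∀ (z : HK K) (j : Fin (deg K + deg K)),
    ‖latticeVec z ((Fin.append (fun i => (D.α i, 0)) (fun i => (0, D.α i)) :
      Fin (deg K + deg K) → 𝓞 K × 𝓞 K) j)‖ ^ 2 ≤ c * size z ^ 2 := by
  set E := entrySum D.BO
  have hE : 0 ≤ E := entrySum_nonneg _
  have hα : ∀ i, ∀ φ : K →+* ℝ, |φ (D.α i : K)| ≤ E := fun i φ =>
    (Finset.single_le_sum (f := fun i => |D.BO φ i|) (fun _ _ => abs_nonneg _)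
      (Finset.mem_univ i)).trans (sum_abs_row_le D.BO φ)
  refine ⟨1 + deg K * (2 * E) ^ 2, ?_, fun z j => ?_⟩
  · have : (0 : ℝ) ≤ deg K * (2 * E) ^ 2 := by positivity
    linarith
  have hs := one_le_size z
  have hbound : ∀ φ, ‖latticeVec z ((Fin.append (fun i => (D.α i, 0)) (fun i => (0, D.α i)) :
      Fin (deg K + deg K) → 𝓞 K × 𝓞 K) j) φ‖ ≤ 2 * E * size z := by
    intro φ
    rw [latticeVec_apply]
    refine Fin.addCases (fun i => ?_) (fun i => ?_) j
    · rw [Fin.append_left]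
      have := hα i φ
      simp
      nlinarith
    · rw [Fin.append_right]
      simp only [map_zero, Complex.ofReal_zero, zero_sub, norm_neg, norm_mul, Complex.norm_real,
        Real.norm_eq_abs]
      have hz : ‖(z φ : ℂ)‖ ≤ 2 * size z := by
        refine (Complex.norm_le_abs_re_add_abs_im _).trans ?_
        have h1 := abs_xPart_le z φ
        have h2 := yPart_le z φ
        have h3 := abs_of_pos (yPart_pos z φ)
        simp only [xPart, yPart] at h1 h2 h3
        rw [UpperHalfPlane.coe_re, UpperHalfPlane.coe_im, h3]
        linarith
      calc _ ≤ E * (2 * size z) := mul_le_mul (hα i φ) hz (norm_nonneg _) hE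
        _ = _ := by ring
  rw [EuclideanSpace.norm_sq_eq]
  calc _ ≤ ∑ φ : K →+* ℝ, (2 * E * size z) ^ 2 :=
        Finset.sum_le_sum fun φ _ => pow_le_pow_left₀ (norm_nonneg _) (hbound φ) 2
    _ = deg K * (2 * E) ^ 2 * size z ^ 2 := by
        rw [Finset.sum_const, Finset.card_univ, card_embeddings, nsmul_eq_mul]; ring
    _ ≤ _ := by
        refine mul_le_mul_of_nonneg_right ?_ (sq_nonneg _)
        linarith

/-- The initial vectors are polynomially bounded, and so is the inverse of the product `P` of the
squared Gram-Schmidt lengths; this controls the number of swaps. How well the output approximates a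
shortest vector plays no role. -/
theorem exists_spec_lll : ∃ T B : HK K → ℝ, PolyBdd T ∧ PolyBdd B ∧ (∀ z, 0 ≤ B z) ∧
    ∀ z, Spec (D.lll z) (T z) fun l => l ≠ 0 ∧
      (∀ φ : K →+* ℝ, |φ (l.1 : K)| ≤ B z) ∧ ∀ φ : K →+* ℝ, |φ (l.2 : K)| ≤ B z := by
  obtain ⟨c₁, hc₁, hlll⟩ := D.exists_lll_cost
  obtain ⟨c₂, hc₂, hnorm⟩ := D.exists_norm_latticeVec_le
  set b : Fin (deg K + deg K) → 𝓞 K × 𝓞 K :=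
    Fin.append (fun i => (D.α i, 0)) (fun i => (0, D.α i)) with hb
  set E := entrySum (leftInv D.BO)
  have hE : 0 ≤ E := entrySum_nonneg _
  let M : HK K → ℝ := fun z => c₂ * size z ^ 2
  let P : HK K → ℝ := fun z => ∏ j, ‖gramVecs z b j‖ ^ 2
  have hM : PolyBdd M := (PolyBdd.const c₂).mul (PolyBdd.size.pow 2)
  have hM1 : ∀ z, 1 ≤ M z := fun z => by
    have := one_le_pow₀ (one_le_size z) (n := 2)
    simp only [M]; nlinarith
  let Q : HK K → ℝ := fun z => (E * (1 + size z ^ 2)) ^ 2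
  have hQ : PolyBdd Q := ((PolyBdd.const E).mul ((PolyBdd.const 1).add (PolyBdd.size.pow 2))).pow 2
  have hg : ∀ z j, 1 ≤ Q z * ‖gramVecs z b j‖ ^ 2 := fun z j => by
    have := one_le_pow₀ (D.one_le_norm_gramVecs z j) (n := 2)
    rw [← mul_assoc, mul_pow] at this
    exact this
  have hP : ∀ z, 0 < P z := fun z => Finset.prod_pos fun j _ => by
    have h1 := hg z j
    by_contra h
    have h2 : ‖gramVecs z b j‖ ^ 2 = 0 := le_antisymm (not_lt.1 h) (sq_nonneg _)
    rw [h2, mul_zero] at h1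
    linarith
  -- The lower bound for each of the `2n` Gram-Schmidt vectors gives `1 ≤ Q^(2n) P`.
  have hPinv : PolyBdd fun z => (P z)⁻¹ := by
    refine (hQ.pow (deg K + deg K)).mono' (fun z => (inv_pos.2 (hP z)).le) fun z => ?_
    rw [inv_le_iff_one_le_mul₀ (hP z)]
    have : Q z ^ (deg K + deg K) * P z = ∏ j : Fin (deg K + deg K), (Q z * ‖gramVecs z b j‖ ^ 2) := by
      rw [Finset.prod_mul_distrib]; simp [P]
    rw [this]
    exact (Finset.prod_le_prod (fun _ _ => zero_le_one) fun j _ => hg z j).trans' (by simp)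
  refine ⟨fun z => c₁ * (3 * |(∏ j : Fin (deg K + deg K), M z ^ (deg K + deg K - (j : ℕ))) *
      ∏ j : Fin (deg K + deg K), ((P z)⁻¹ * M z ^ (deg K + deg K)) ^ (deg K + deg K - (j : ℕ))| + 2),
    fun z => (1 + size z ^ 2) * (1 + M z), ?_, ?_, fun z => ?_, fun z => ?_⟩
  · refine (PolyBdd.const c₁).mul (((PolyBdd.const 3).mul (PolyBdd.abs ?_)).add (PolyBdd.const 2))
    exact (PolyBdd.prod _ fun j _ => hM.pow _).mul
      (PolyBdd.prod _ fun j _ => (hPinv.mul (hM.pow (deg K + deg K))).pow _)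
  · exact ((PolyBdd.const 1).add (PolyBdd.size.pow 2)).mul ((PolyBdd.const 1).add hM)
  · have := hM1 z
    positivity
  · have hinv : LLLInv z (M z) (P z) b := ⟨rfl, fun j => by
      refine (pow_le_pow_left₀ (norm_nonneg _) (norm_gramSchmidt_le _ j) 2).trans (hnorm z j)⟩
    refine (hlll z (M z) (P z) (hM1 z) (hP z) hinv).mono (le_of_eq ?_) ?_
    · rw [div_eq_mul_inv, ← Finset.prod_inv_distrib]
      congr 4
      congr 1
      refine Finset.prod_congr rfl fun j _ => ?_
      rw [← inv_pow, inv_div, div_eq_mul_inv, mul_comm]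
    · rintro l ⟨hl0, hl⟩
      have hlM : ‖latticeVec z l‖ ≤ 1 + M z := by nlinarith [norm_nonneg (latticeVec z l)]
      have hs := one_le_size z
      have h1 : (1 + size z ^ 2) * ‖latticeVec z l‖ ≤ (1 + size z ^ 2) * (1 + M z) :=
        mul_le_mul_of_nonneg_left hlM (by positivity)
      refine ⟨hl0, fun φ => ?_, fun φ => ?_⟩
      · have := abs_coordA_le z (latticeVec z l) φ
        rw [coordA_latticeVec] at this
        exact this.trans h1
      · have := abs_coordB_le z (latticeVec z l) φ
        rw [coordB_latticeVec] at this
        refine this.trans (le_trans ?_ h1)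
        refine mul_le_mul_of_nonneg_right ?_ (norm_nonneg _)
        nlinarith

end TotallyReal

end ReductionData

end Field

end

/-! ### The search for the closest cusp -/

section

open Prog

section Field

variable {K : Type*} [Field K] [NumberField K]

/-- The embeddings of both entries of a pair are at most `B` in absolute value. -/
def BoundedPair (B : ℝ) (p : 𝓞 K × 𝓞 K) : Prop :=
  (∀ φ : K →+* ℝ, |φ (p.1 : K)| ≤ B) ∧ ∀ φ : K →+* ℝ, |φ (p.2 : K)| ≤ B

namespace ReductionData

variable (D : ReductionData K)

theorem length_boxPoints_le {c r : (K →+* ℝ) → ℝ} {R : ℝ} (hr0 : ∀ φ, 0 ≤ r φ)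
    (hr : ∀ φ, r φ ≤ R) (hR : 0 ≤ R) : ((D.boxPoints c r).length : ℝ) ≤
      (2 * (entrySum (leftInv D.BO) * R) + 1) ^ deg K := by
  have hE := entrySum_nonneg (leftInv D.BO)
  simp only [boxPoints, length_choices, length_intRange, Nat.cast_prod]
  refine (Finset.prod_le_prod (fun _ _ => by positivity) fun k _ => ?_).trans_eq
    (by rw [Finset.prod_const, Finset.card_univ, Fintype.card_fin])
  set S := ∑ φ, |leftInv D.BO k φ| * r φ
  set x := ∑ φ, leftInv D.BO k φ * c φ
  have hS0 : 0 ≤ S := Finset.sum_nonneg fun φ _ => mul_nonneg (abs_nonneg _) (hr0 φ)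
  have hS : S ≤ entrySum (leftInv D.BO) * R := by
    refine (Finset.sum_le_sum fun φ _ => mul_le_mul_of_nonneg_left (hr φ) (abs_nonneg _)).trans ?_
    rw [← Finset.sum_mul]
    exact mul_le_mul_of_nonneg_right (sum_abs_row_le _ k) hR
  have h1 := Int.floor_le (x + S)
  have h2 := Int.le_ceil (x - S)
  have h3 : (((⌊x + S⌋ + 1 - ⌈x - S⌉).toNat : ℤ) : ℝ) ≤ 2 * S + 1 := by
    rw [Int.toNat_eq_max]
    push_cast
    exact max_le (by linarith) (by linarith)
  have h4 : (((⌊x + S⌋ + 1 - ⌈x - S⌉).toNat : ℝ)) =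
    (((⌊x + S⌋ + 1 - ⌈x - S⌉).toNat : ℤ) : ℝ) := by push_cast; rfl
  rw [h4]
  linarith

section TotallyReal

variable [IsTotallyReal K]

theorem repr_mem_boxPoints {c r : (K →+* ℝ) → ℝ} {x : 𝓞 K}
    (h : ∀ φ : K →+* ℝ, |φ (x : K) - c φ| ≤ r φ) : ⇑(D.α.repr x) ∈ D.boxPoints c r := by
  simp only [boxPoints, mem_choices, mem_intRange]
  intro k
  have h1 : (D.α.repr x k : ℝ) = ∑ φ, leftInv D.BO k φ * φ (x : K) :=
    congrFun (D.repr_eq_leftInv x) k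
  have h2 : |(D.α.repr x k : ℝ) - ∑ φ, leftInv D.BO k φ * c φ| ≤
      ∑ φ, |leftInv D.BO k φ| * r φ := by
    rw [h1, ← Finset.sum_sub_distrib]
    refine (Finset.abs_sum_le_sum_abs _ _).trans (Finset.sum_le_sum fun φ _ => ?_)
    rw [← mul_sub, abs_mul]
    exact mul_le_mul_of_nonneg_left (h φ) (abs_nonneg _)
  rw [abs_le] at h2
  exact ⟨Int.ceil_le.2 (by linarith), Int.le_floor.2 (by linarith)⟩

/-- The invariant of the search for the closest cusp. -/
def SearchInv (z : HK K) (B : ℝ) (s : (𝓞 K × 𝓞 K) × ℝ) : Prop :=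
  s.1 ≠ 0 ∧ BoundedPair B s.1 ∧ s.2 = cuspDist z s.1.1 s.1.2

open scoped Classical in
-- This is the inner loop, for a fixed `σ`. The stored distance never increases, so an inequality
-- established by one candidate survives the later rounds.
theorem spec_search_fst {z : HK K} {σ : 𝓞 K} {a : (K →+* ℝ) → ℝ} {R B τ : ℝ} (hR : 0 ≤ R)
    (hτ : 0 ≤ τ) (ha0 : ∀ φ, 0 ≤ yPart z φ * a φ) (ha : ∀ φ, yPart z φ * a φ ≤ R)
    (hσ : ∀ φ : K →+* ℝ, |φ (σ : K)| ≤ B)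
    (hB : ∀ φ : K →+* ℝ, |φ (σ : K) * xPart z φ| + yPart z φ * a φ ≤ B)
    (hcomp : ∀ p, BoundedPair B p →
      Spec (D.computeDist z p) τ fun δ => δ = cuspDist z p.1 p.2)
    {s : (𝓞 K × 𝓞 K) × ℝ} (hs : SearchInv z B s) :
    Spec (forEach (fun (best : (𝓞 K × 𝓞 K) × ℝ) Y =>
            let ρ := D.ofCoords Y
            charge (10 * deg K + 10) <|
            if (∀ φ, |φ (ρ : K) - φ (σ : K) * xPart z φ| ≤ yPart z φ * a φ) ∧ (ρ, σ) ≠ 0 then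
              (D.computeDist z (ρ, σ)).bind fun δ =>
                charge 1 <| if δ < best.2 then ret ((ρ, σ), δ) else ret best
            else ret best)
          s (D.boxPoints (fun φ => φ (σ : K) * xPart z φ) fun φ => yPart z φ * a φ))
      ((2 * (entrySum (leftInv D.BO) * R) + 1) ^ deg K * ((10 * deg K + 10 : ℕ) + τ + 1))
      fun s' => SearchInv z B s' ∧ s'.2 ≤ s.2 ∧ ∀ ρ : 𝓞 K,
        (∀ φ : K →+* ℝ, |φ (ρ : K) - φ (σ : K) * xPart z φ| ≤ yPart z φ * a φ) →
        (ρ, σ) ≠ 0 → s'.2 ≤ cuspDist z ρ σ := by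
  refine (Spec.forEach (T := (10 * deg K + 10 : ℕ) + τ + 1)
    (Inv := fun s' => SearchInv z B s' ∧ s'.2 ≤ s.2)
    (P := fun Y s' =>
      (∀ φ : K →+* ℝ, |φ (D.ofCoords Y : K) - φ (σ : K) * xPart z φ| ≤ yPart z φ * a φ) →
        (D.ofCoords Y, σ) ≠ 0 → s'.2 ≤ cuspDist z (D.ofCoords Y) σ) ?_ ⟨hs, le_rfl⟩).mono ?_ ?_
  · rintro best ⟨hbest, hle⟩ Y -
    refine Spec.charge ?_
    split_ifs with h
    · have hbd : BoundedPair B (D.ofCoords Y, σ) := by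
        refine ⟨fun φ => le_trans ?_ (hB φ), hσ⟩
        have h1 := h.1 φ
        have h2 := abs_add_le (φ (σ : K) * xPart z φ)
          (φ (D.ofCoords Y : K) - φ (σ : K) * xPart z φ)
        rw [add_sub_cancel] at h2
        linarith
      refine (hcomp _ hbd).bind fun δ hδ => Spec.charge ?_
      dsimp only at hδ
      have hT : (0 : ℝ) ≤ (10 * deg K + 10 : ℕ) + τ + 1 - (10 * deg K + 10 : ℕ) - τ - (1 : ℕ) := by
        push_cast; linarith
      split_ifs with hlt
      · refine Spec.ret hT ⟨⟨⟨h.2, hbd, hδ⟩, hlt.le.trans hle⟩, fun _ _ => hδ.le, ?_⟩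
        exact fun Y' h' h1 h2 => hlt.le.trans (h' h1 h2)
      · exact Spec.ret hT ⟨⟨hbest, hle⟩, fun _ _ => (not_lt.1 hlt).trans_eq hδ, fun _ h => h⟩
    · refine Spec.ret (by linarith) ⟨⟨hbest, hle⟩, fun h1 h2 => absurd ⟨h1, h2⟩ h, fun _ h => h⟩
  · exact mul_le_mul_of_nonneg_right (D.length_boxPoints_le ha0 ha hR) (by positivity)
  · rintro s' ⟨⟨h1, h2⟩, h3, -⟩
    refine ⟨h1, h2, fun ρ hρ h0 => ?_⟩
    have := h3 _ (D.repr_mem_boxPoints hρ)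
    rw [D.ofCoords_repr] at this
    exact this hρ h0

/-- The search for a closest cusp, for a point at which the bounds for the box are at most `R`. -/
theorem spec_closestCusp {z : HK K} {T R B τ : ℝ} (hT : 0 ≤ T) (hR : 0 ≤ R) (hτ : 0 ≤ τ)
    (hlll : Spec (D.lll z) T fun l => l ≠ 0 ∧ BoundedPair B l)
    (hcomp : ∀ p, BoundedPair B p →
      Spec (D.computeDist z p) τ fun δ => δ = cuspDist z p.1 p.2)
    (hB1 : 1 ≤ B)
    (hR1 : ∀ d : ℝ, 0 ≤ d → d ≤ cuspDist z 1 0 → ∀ φ,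
      D.boundConst φ * d ^ (1 / (deg K : ℝ)) * yPart z φ ^ (-(1 / 2) : ℝ) ≤ R)
    (hRB : R * size z + size z * R ≤ B) (hRB' : R ≤ B) :
    Spec (D.closestCusp z) ((deg K + 1 : ℕ) + T + τ + τ + τ +
        (4 * deg K ^ 2 + 10 * deg K + 10 : ℕ) +
        (2 * (entrySum (leftInv D.BO) * R) + 1) ^ deg K * ((10 * deg K + 10 : ℕ) +
          (4 * deg K ^ 2 + 10 * deg K : ℕ) +
          (2 * (entrySum (leftInv D.BO) * (size z * R)) + 1) ^ deg K *
            ((10 * deg K + 10 : ℕ) + τ + 1)))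
      fun p => IsClosest z p ∧ BoundedPair B p := by
  have hE := entrySum_nonneg (leftInv D.BO)
  have hs := one_le_size z
  have hb10 : BoundedPair B ((1, 0) : 𝓞 K × 𝓞 K) :=
    ⟨fun φ => by simpa using hB1, fun φ => by simpa using zero_le_one.trans hB1⟩
  have hb01 : BoundedPair B ((0, 1) : 𝓞 K × 𝓞 K) :=
    ⟨fun φ => by simpa using zero_le_one.trans hB1, fun φ => by simpa using hB1⟩
  unfold closestCusp
  refine Spec.charge ?_
  split_ifs with hC
  · refine Spec.ret ?_ ⟨D.isClosest_infty hC, hb10⟩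
    rw [add_assoc, add_assoc, add_assoc, add_assoc, add_assoc, add_sub_cancel_left]
    positivity
  refine hlll.bind fun l hl => (hcomp l hl.2).bind fun d₁ hd₁ => (hcomp _ hb10).bind fun d₂ hd₂ =>
    (hcomp _ hb01).bind fun d₃ hd₃ => Spec.charge ?_
  dsimp only at hd₁ hd₂ hd₃
  set d := min d₁ (min d₂ d₃) with hd
  have hd0 : 0 ≤ d := by
    rw [hd, hd₁, hd₂, hd₃]
    exact le_min (cuspDist_nonneg _ _ _) (le_min (cuspDist_nonneg _ _ _) (cuspDist_nonneg _ _ _))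
  have hdle : d ≤ cuspDist z 1 0 := by
    rw [← hd₂]; exact (min_le_right _ _).trans (min_le_left _ _)
  -- Since `d` is attained, the search yields a value at most `d`, and cusps farther away than `d`
  -- can be ignored.
  obtain ⟨p, hp0, hpd⟩ : ∃ p : 𝓞 K × 𝓞 K, p ≠ 0 ∧ cuspDist z p.1 p.2 = d := by
    rcases min_choice d₁ (min d₂ d₃) with h | h
    · exact ⟨l, hl.1, by rw [← hd₁, hd, h]⟩
    · rcases min_choice d₂ d₃ with h' | h'
      · exact ⟨(1, 0), by simp, by rw [← hd₂, hd, h, h']⟩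
      · exact ⟨(0, 1), by simp, by rw [← hd₃, hd, h, h']⟩
  set a : (K →+* ℝ) → ℝ := fun φ =>
    D.boundConst φ * d ^ (1 / (deg K : ℝ)) * yPart z φ ^ (-(1 / 2) : ℝ) with ha
  have ha0 : ∀ φ, 0 ≤ a φ := fun φ =>
    mul_nonneg (mul_nonneg (D.boundConst_pos φ).le (Real.rpow_nonneg hd0 _))
      (Real.rpow_nonneg (yPart_pos z φ).le _)
  have haR : ∀ φ, a φ ≤ R := hR1 d hd0 hdle
  have hya0 : ∀ φ, 0 ≤ yPart z φ * a φ := fun φ => mul_nonneg (yPart_pos z φ).le (ha0 φ)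
  have hyaR : ∀ φ, yPart z φ * a φ ≤ size z * R := fun φ =>
    mul_le_mul (yPart_le z φ) (haR φ) (ha0 φ) (by linarith)
  refine Spec.bindRet ((Spec.forEach (T := (10 * deg K + 10 : ℕ) +
          (4 * deg K ^ 2 + 10 * deg K : ℕ) +
          (2 * (entrySum (leftInv D.BO) * (size z * R)) + 1) ^ deg K *
            ((10 * deg K + 10 : ℕ) + τ + 1))
    (Inv := SearchInv z B)
    (P := fun X s => |∏ φ : K →+* ℝ, φ (D.ofCoords X : K)| ≤
        d * D.C * (∏ φ, yPart z φ) ^ (-(1 / 2) : ℝ) → (∀ φ : K →+* ℝ, |φ (D.ofCoords X : K)| ≤ a φ) →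
      ∀ ρ : 𝓞 K, (∀ φ : K →+* ℝ,
        |φ (ρ : K) - φ (D.ofCoords X : K) * xPart z φ| ≤ yPart z φ * a φ) →
        (ρ, D.ofCoords X) ≠ 0 → s.2 ≤ cuspDist z ρ (D.ofCoords X)) ?_ ?_).mono ?_ ?_)
  · intro best hbest X _
    refine Spec.charge ?_
    split_ifs with h
    · have hσ : ∀ φ : K →+* ℝ, |φ (D.ofCoords X : K)| ≤ R := fun φ => (h.2 φ).trans (haR φ)
      refine Spec.charge ((D.spec_search_fst (a := a) (R := size z * R) (by positivity) hτ hya0 hyaR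
        (fun φ => (hσ φ).trans hRB') (fun φ => le_trans ?_ hRB) hcomp hbest).mono ?_ ?_)
      · rw [abs_mul]
        exact add_le_add (mul_le_mul (hσ φ) (abs_xPart_le z φ) (abs_nonneg _) hR) (hyaR φ)
      · linarith
      · rintro s ⟨h1, h2, h3⟩
        exact ⟨h1, fun _ _ => h3, fun Y hY h4 h5 ρ h6 h7 => h2.trans (hY h4 h5 ρ h6 h7)⟩
    · refine Spec.ret ?_ ⟨hbest, fun h1 h2 => absurd ⟨h1, h2⟩ h, fun _ h => h⟩
      rw [add_assoc, add_sub_cancel_left]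
      positivity
  · exact ⟨by simp, hb10, hd₂⟩
  · have h1 := D.length_boxPoints_le (c := 0) ha0 haR hR
    refine (mul_le_mul_of_nonneg_right h1 (by positivity)).trans (le_of_eq ?_)
    ring
  · rintro s ⟨⟨h1, h2, h3⟩, h4, -⟩
    -- The pair `q` itself may lie outside the boxes. It is replaced by the bounded representative
    -- `q'` of the same cusp, which passes all tests of the search.
    have key : ∀ q : 𝓞 K × 𝓞 K, q ≠ 0 → cuspDist z q.1 q.2 ≤ d → s.2 ≤ cuspDist z q.1 q.2 := by
      intro q hq hqd
      obtain ⟨q', hq', hqq, hprod, hbd, -⟩ := D.exists_bounded_representative hq hqd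
      rw [hqq.cuspDist_eq hq hq' z]
      -- So `a_φ² y_φ = (D_φ d^(1/n))²`. The two summands of the local form then give `|σ_φ| ≤ a_φ`
      -- and `|ρ_φ - σ_φ x_φ| ≤ y_φ a_φ`.
      have hy : ∀ φ, (yPart z φ ^ (-(1 / 2) : ℝ)) ^ 2 * yPart z φ = 1 := fun φ => by
        rw [← Real.rpow_natCast, ← Real.rpow_mul (yPart_pos z φ).le]
        norm_num
        rw [Real.rpow_neg_one, inv_mul_cancel₀ (yPart_pos z φ).ne']
      have hσ : ∀ φ : K →+* ℝ, |φ (q'.2 : K)| ≤ a φ := fun φ => by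
        refine abs_le_of_sq_le_sq ?_ (ha0 φ)
        have h5 := (sq_mul_im_le_pointForm (z φ) (φ (q'.1 : K)) (φ (q'.2 : K))).trans (hbd φ)
        refine le_of_mul_le_mul_right ?_ (yPart_pos z φ)
        rw [ha]
        dsimp only
        rw [mul_pow, mul_assoc, hy, mul_one]
        exact h5
      have hρ : ∀ φ : K →+* ℝ, |φ (q'.1 : K) - φ (q'.2 : K) * xPart z φ| ≤ yPart z φ * a φ := by
        intro φ
        refine abs_le_of_sq_le_sq ?_ (hya0 φ)
        have h5 := (sq_le_im_mul_pointForm (z φ) (φ (q'.1 : K)) (φ (q'.2 : K))).trans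
          (mul_le_mul_of_nonneg_left (hbd φ) (yPart_pos z φ).le)
        refine h5.trans_eq ?_
        rw [ha]
        dsimp only
        rw [mul_pow (yPart z φ), mul_pow _ (yPart z φ ^ (-(1 / 2) : ℝ))]
        have := hy φ
        change yPart z φ * _ = _
        linear_combination (-(yPart z φ) * (D.boundConst φ * d ^ (1 / (deg K : ℝ))) ^ 2) * this
      have hN : |∏ φ : K →+* ℝ, φ (q'.2 : K)| ≤
          d * D.C * (∏ φ, yPart z φ) ^ (-(1 / 2) : ℝ) := by
        have hNy : 0 < ∏ φ, yPart z φ := Finset.prod_pos fun φ _ => yPart_pos z φ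
        have hNy2 : ((∏ φ, yPart z φ) ^ (-(1 / 2) : ℝ)) ^ 2 * ∏ φ, yPart z φ = 1 := by
          rw [← Real.rpow_natCast, ← Real.rpow_mul hNy.le]
          norm_num
          rw [Real.rpow_neg_one, inv_mul_cancel₀ hNy.ne']
        refine abs_le_of_sq_le_sq ?_ (by positivity)
        refine le_of_mul_le_mul_right ?_ hNy
        rw [mul_pow, mul_assoc, hNy2, mul_one, mul_comm d, ← Finset.prod_pow,
          ← Finset.prod_mul_distrib]
        refine le_trans (Finset.prod_le_prod (fun φ _ => ?_) fun φ _ => ?_) hprod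
        · exact mul_nonneg (sq_nonneg _) (yPart_pos z φ).le
        · exact sq_mul_im_le_pointForm _ _ _
      have h5 := h4 _ (D.repr_mem_boxPoints (c := 0) (r := a) (x := q'.2) (by simpa using hσ))
      rw [D.ofCoords_repr] at h5
      exact h5 hN hσ q'.1 hρ hq'
    refine ⟨⟨h1, fun q hq => ?_⟩, h2⟩
    rw [← h3]
    by_cases hqd : cuspDist z q.1 q.2 ≤ d
    · exact key q hq hqd
    · exact (key p hp0 hpd.le).trans (hpd.le.trans (not_le.1 hqd).le)

/-! ### Polynomial bounds for the search -/

theorem rpow_le_one_add {t s : ℝ} (ht : 0 ≤ t) (hs : 0 ≤ s) (hs1 : s ≤ 1) : t ^ s ≤ 1 + t := by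
  rcases le_total t 1 with h | h
  · exact (Real.rpow_le_one ht h hs).trans (by linarith)
  · exact (Real.rpow_le_rpow_of_exponent_le h hs1).trans (by rw [Real.rpow_one]; linarith)

theorem rpow_neg_half_le {t : ℝ} (ht : 0 < t) : t ^ (-(1 / 2) : ℝ) ≤ 1 + t⁻¹ := by
  rw [Real.rpow_neg ht.le, ← Real.inv_rpow ht.le]
  exact rpow_le_one_add (inv_nonneg.2 ht.le) (by norm_num) (by norm_num)

theorem cuspDist_infty_le (z : HK K) : cuspDist z 1 0 ≤ 1 + size z ^ deg K := by
  rw [cuspDist_infty]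
  refine (rpow_neg_half_le (Finset.prod_pos fun φ _ => yPart_pos z φ)).trans ?_
  rw [← Finset.prod_inv_distrib]
  have := prod_le_pow_deg (f := fun φ => (yPart z φ)⁻¹)
    (fun φ => (inv_pos.2 (yPart_pos z φ)).le) (inv_yPart_le z)
  linarith

theorem exists_spec_closestCusp : ∃ T B : HK K → ℝ, PolyBdd T ∧ PolyBdd B ∧ (∀ z, 1 ≤ B z) ∧
    ∀ z, Spec (D.closestCusp z) (T z) fun p => IsClosest z p ∧ BoundedPair (B z) p := by
  obtain ⟨T, B, hT, hB, hB0, hlll⟩ := D.exists_spec_lll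
  obtain ⟨c, hc, hcomp⟩ := D.exists_computeDist_cost
  set s := size (K := K)
  have hs : PolyBdd s := PolyBdd.size
  have hE := entrySum_nonneg (leftInv D.BO)
  set E := entrySum (leftInv D.BO)
  set b := ∑ φ, D.boundConst φ
  have hb : ∀ φ, D.boundConst φ ≤ b := fun φ =>
    Finset.single_le_sum (fun φ _ => (D.boundConst_pos φ).le) (Finset.mem_univ φ)
  have hb0 : 0 ≤ b := Finset.sum_nonneg fun φ _ => (D.boundConst_pos φ).le
  -- The three factors bound `D_φ`, `d^(1/n)` by way of `d ≤ Δ(z, ∞)`, and `y_φ^(-1/2)`.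
  let R : HK K → ℝ := fun z => b * (1 + (1 + s z ^ deg K)) * (1 + s z)
  have hR : PolyBdd R := ((PolyBdd.const b).mul ((PolyBdd.const 1).add
    ((PolyBdd.const 1).add (hs.pow _)))).mul ((PolyBdd.const 1).add hs)
  -- One bound for all pairs whose distance is computed: the output of LLL, the cusps `∞` and `0`,
  -- and the candidates in the boxes.
  let B' : HK K → ℝ := fun z => B z + 1 + (R z * s z + s z * R z)
  have hB' : PolyBdd B' := (hB.add (PolyBdd.const 1)).add ((hR.mul hs).add (hs.mul hR))
  let τ : HK K → ℝ := fun z => c * (1 + B' z) ^ deg K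
  have hτ : PolyBdd τ := (PolyBdd.const c).mul (((PolyBdd.const 1).add hB').pow _)
  have hR0 : ∀ z, 0 ≤ R z := fun z => by
    have := one_le_size z
    positivity
  have hRs : ∀ z, 0 ≤ R z * s z := fun z => mul_nonneg (hR0 z) (by linarith [one_le_size z])
  have hB'0 : ∀ z, 1 ≤ B' z := fun z => by
    have h1 := hRs z
    have h2 := hB0 z
    have h3 := mul_comm (R z) (s z)
    simp only [B']; linarith
  refine ⟨_, B', ?_, hB', hB'0, fun z => D.spec_closestCusp (T := |T z|) (R := R z) (τ := τ z)
    (abs_nonneg _) (hR0 z) ?_ ?_ (fun p hp => ?_) (hB'0 z) (fun d hd0 hd φ => ?_) ?_ ?_⟩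
  · have hbox : ∀ f : HK K → ℝ, PolyBdd f → PolyBdd fun z => (2 * (E * f z) + 1) ^ deg K :=
      fun f hf => (((PolyBdd.const 2).mul ((PolyBdd.const E).mul hf)).add (PolyBdd.const 1)).pow _
    refine PolyBdd.add (PolyBdd.add (PolyBdd.add (PolyBdd.add (PolyBdd.add (PolyBdd.add
      (PolyBdd.const _) hT.abs) hτ) hτ) hτ) (PolyBdd.const _)) ?_
    refine (hbox R hR).mul ((PolyBdd.const _).add ?_)
    exact (hbox _ (hs.mul hR)).mul (((PolyBdd.const _).add hτ).add (PolyBdd.const 1))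
  · have := hB'0 z
    positivity
  · refine (hlll z).mono (le_abs_self _) fun l hl => ⟨hl.1, fun φ => (hl.2.1 φ).trans ?_,
      fun φ => (hl.2.2 φ).trans ?_⟩
    all_goals
      have h1 := hRs z
      have h3 := mul_comm (R z) (s z)
      simp only [B']; linarith
  · exact hcomp z p (B' z) (by linarith [hB'0 z]) hp.1 hp.2
  · have h1 := rpow_le_one_add (s := 1 / (deg K : ℝ)) hd0 (by positivity) (by
      rw [div_le_one deg_pos]
      exact_mod_cast (finrank_pos : 0 < finrank ℚ K))
    have h2 := rpow_neg_half_le (yPart_pos z φ)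
    have h3 := inv_yPart_le z φ
    have h4 := cuspDist_infty_le z
    have h5 := one_le_size z
    refine mul_le_mul (mul_le_mul (hb φ) ?_ (Real.rpow_nonneg hd0 _) hb0) ?_
      (Real.rpow_nonneg (yPart_pos z φ).le _) (by positivity)
    · linarith
    · linarith
  · have h2 := hB0 z
    simp only [B']
    linarith
  · have h1 := hRs z
    have h2 := hB0 z
    have h3 : R z ≤ R z * s z := le_mul_of_one_le_right (hR0 z) (one_le_size z)
    have h4 := mul_comm (R z) (s z)
    simp only [B']; linarith

end TotallyReal

end ReductionData

end Field

end

/-! ### Bounded matrices between equivalent cusps -/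

section

open Prog

section Field

variable {K : Type*} [Field K] [NumberField K]

/-- This unfolds `1 ∈ I I⁻¹ = ρ I⁻¹ + σ I⁻¹`. -/
theorem exists_det_eq_one {I : Ideal (𝓞 K)} (hI : I ≠ ⊥) {ρ σ : 𝓞 K}
    (h : Ideal.span {ρ, σ} = I) :
    ∃ ξ η : K, ξ ∈ ((I : FractionalIdeal (𝓞 K)⁰ K))⁻¹ ∧ η ∈ ((I : FractionalIdeal (𝓞 K)⁰ K))⁻¹ ∧
      (ρ : K) * η - ξ * (σ : K) = 1 := by
  have h1 : (1 : K) ∈ (I : FractionalIdeal (𝓞 K)⁰ K) * (I : FractionalIdeal (𝓞 K)⁰ K)⁻¹ := by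
    rw [mul_inv_cancel₀ (FractionalIdeal.coeIdeal_ne_zero.2 hI)]
    exact FractionalIdeal.one_mem_one _
  have h2 : (I : FractionalIdeal (𝓞 K)⁰ K) = FractionalIdeal.spanSingleton (𝓞 K)⁰ (ρ : K) +
      FractionalIdeal.spanSingleton (𝓞 K)⁰ (σ : K) := by
    rw [← h, Ideal.span_insert, FractionalIdeal.coeIdeal_sup,
      FractionalIdeal.coeIdeal_span_singleton, FractionalIdeal.coeIdeal_span_singleton]
  nth_rw 1 [h2] at h1
  rw [add_mul, FractionalIdeal.mem_add] at h1
  obtain ⟨x, hx, y, hy, hxy⟩ := h1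
  obtain ⟨η, hη, rfl⟩ := FractionalIdeal.mem_singleton_mul.1 hx
  obtain ⟨ξ, hξ, rfl⟩ := FractionalIdeal.mem_singleton_mul.1 hy
  refine ⟨-ξ, η, ?_, hη, by linear_combination hxy⟩
  exact Submodule.neg_mem _ hξ

namespace ReductionData

variable (D : ReductionData K)

section TotallyReal

variable [IsTotallyReal K]

/-- Rounding the coordinates in the basis `β j` leaves a remainder with bounded coordinates. -/
theorem exists_add_mem_inv_sq_le (j : Fin (classNumber K)) (x : K) :
    ∃ t ∈ ((D.𝔞 j : FractionalIdeal (𝓞 K)⁰ K))⁻¹ ^ 2,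
      ∀ φ : K →+* ℝ, |φ (x + t)| ≤ entrySum (D.Bβ j) := by
  set X := (leftInv (D.Bβ j)).mulVec fun φ => φ x with hX
  refine ⟨∑ k, (-nearest (X k)) • (D.β j k : K), D.sum_mem_inv_sq j _, fun φ => ?_⟩
  have h1 : φ x = (D.Bβ j).mulVec X φ := by
    rw [hX, mulVec_leftInv (D.isUnit_Bβ j)]
  rw [map_add, D.embedding_sum_β, h1, ← Pi.add_apply, ← Matrix.mulVec_add]
  refine (abs_mulVec_le _ (B := 1) (fun k => ?_) zero_le_one φ).trans_eq (mul_one _)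
  have h2 := nearest_le (X k)
  have h3 := lt_nearest (X k)
  rw [Pi.add_apply, abs_le]
  push_cast
  constructor <;> linarith

/-- The norm has absolute value at least `1` and the other conjugates are at most `B`, so no
conjugate can be too small. -/
theorem inv_embedding_le {x : 𝓞 K} (hx : x ≠ 0) {B : ℝ} (hB : 1 ≤ B)
    (h : ∀ φ : K →+* ℝ, |φ (x : K)| ≤ B) (φ : K →+* ℝ) : |φ (x : K)|⁻¹ ≤ B ^ deg K := by
  classical
  have hx0 : φ (x : K) ≠ 0 := by simpa using hx
  have h1 := one_le_abs_prod hx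
  rw [Finset.abs_prod, ← Finset.mul_prod_erase _ _ (Finset.mem_univ φ)] at h1
  rw [inv_le_iff_one_le_mul₀' (abs_pos.2 hx0)]
  refine h1.trans (mul_le_mul_of_nonneg_left ?_ (abs_nonneg _))
  calc ∏ ψ ∈ Finset.univ.erase φ, |ψ (x : K)| ≤ ∏ ψ ∈ Finset.univ.erase φ, B :=
        Finset.prod_le_prod (fun _ _ => abs_nonneg _) fun ψ _ => h ψ
    _ = B ^ (Finset.univ.erase φ).card := by simp
    _ ≤ B ^ deg K := pow_le_pow_right₀ hB (by
        rw [← card_embeddings K]; exact Finset.card_le_univ _)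

/-- The second column of a normalizing matrix can be chosen with bounded entries. -/
theorem exists_bounded_column {j : Fin (classNumber K)} {ρ σ : 𝓞 K}
    (h : Ideal.span {ρ, σ} = D.𝔞 j) {B : ℝ} (hB : 1 ≤ B) (hb : BoundedPair B (ρ, σ)) :
    ∃ ξ η : K, ξ ∈ ((D.𝔞 j : FractionalIdeal (𝓞 K)⁰ K))⁻¹ ∧
      η ∈ ((D.𝔞 j : FractionalIdeal (𝓞 K)⁰ K))⁻¹ ∧ (ρ : K) * η - ξ * (σ : K) = 1 ∧
      ∀ φ : K →+* ℝ, |φ ξ| ≤ (1 + entrySum (D.Bβ j) * B ^ 2) * B ^ deg K ∧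
        |φ η| ≤ (1 + entrySum (D.Bβ j) * B ^ 2) * B ^ deg K := by
  have hI : D.𝔞 j ≠ ⊥ := nonZeroDivisors.ne_zero (D.𝔞_mem j)
  obtain ⟨ξ, η, hξ, hη, hdet⟩ := exists_det_eq_one hI h
  set E := entrySum (D.Bβ j)
  have hE : 0 ≤ E := entrySum_nonneg _
  have hBn : 1 ≤ B ^ deg K := one_le_pow₀ hB
  -- Adding `t (ρ, σ)` with `t` in `𝔞_j ^ (-2)` to the second column `(ξ, η)` keeps it in `𝔞_j⁻¹`
  -- and keeps the determinant.
  have hshift : ∀ t ∈ ((D.𝔞 j : FractionalIdeal (𝓞 K)⁰ K))⁻¹ ^ 2, ∀ x ∈ D.𝔞 j,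
      t * (x : K) ∈ ((D.𝔞 j : FractionalIdeal (𝓞 K)⁰ K))⁻¹ := fun t ht x hx => by
    have h1 := FractionalIdeal.mul_mem_mul ht
      (FractionalIdeal.mem_coeIdeal_of_mem (𝓞 K)⁰ (P := K) hx)
    rwa [sq, mul_assoc, inv_mul_cancel₀ (D.𝔞_ne_zero j), mul_one] at h1
  have hρm : ρ ∈ D.𝔞 j := h ▸ Ideal.subset_span (by simp)
  have hσm : σ ∈ D.𝔞 j := h ▸ Ideal.subset_span (by simp)
  -- Common to the cases `ρ = 0` and `ρ ≠ 0`: with `x` a nonzero entry of the first column, `u` is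
  -- bounded through `u / x`, and `v` through the determinant equation divided by `x`.
  have hfst : ∀ {x y : 𝓞 K} {u v : K}, x ≠ 0 → (∀ φ : K →+* ℝ, |φ (x : K)| ≤ B) →
      (∀ φ : K →+* ℝ, |φ (y : K)| ≤ B) → (∀ φ : K →+* ℝ, |φ (u / (x : K))| ≤ E) →
      (∀ φ : K →+* ℝ, |φ ((x : K) * v)| ≤ 1 + |φ (u * (y : K))|) → ∀ φ : K →+* ℝ,
        |φ u| ≤ (1 + E * B ^ 2) * B ^ deg K ∧ |φ v| ≤ (1 + E * B ^ 2) * B ^ deg K := by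
    intro x y u v hx0 hx hy hu hv φ
    have hφx : φ (x : K) ≠ 0 := by simpa using hx0
    have h1 : |φ u| ≤ E * B := by
      have := hu φ
      rw [map_div₀, abs_div, div_le_iff₀ (abs_pos.2 hφx)] at this
      exact this.trans (mul_le_mul_of_nonneg_left (hx φ) hE)
    have hEB : E * B ≤ E * B ^ 2 := mul_le_mul_of_nonneg_left (by nlinarith) hE
    have hpos : 0 ≤ 1 + E * B ^ 2 := by positivity
    refine ⟨?_, ?_⟩
    · nlinarith
    · have h2 := hv φ
      rw [map_mul, map_mul, abs_mul, abs_mul] at h2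
      have h3 : |φ u| * |φ (y : K)| ≤ E * B * B :=
        mul_le_mul h1 (hy φ) (abs_nonneg _) (by positivity)
      have h4 : |φ (x : K)| * |φ v| ≤ 1 + E * B ^ 2 := by nlinarith
      have h5 := inv_embedding_le hx0 hB hx φ
      calc |φ v| = |φ (x : K)| * |φ v| * |φ (x : K)|⁻¹ := by
            field_simp
        _ ≤ _ := mul_le_mul h4 h5 (by positivity) hpos
  by_cases hρ : ρ = 0
  · have hσ : σ ≠ 0 := by
      rintro rfl
      rw [hρ] at hdet
      simp at hdet
    have hσK : (σ : K) ≠ 0 := by simpa using hσ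
    obtain ⟨t, ht, hbd⟩ := D.exists_add_mem_inv_sq_le j (η / (σ : K))
    have e : (η + t * σ) / (σ : K) = η / σ + t := by field_simp
    have key := hfst (x := σ) (y := ρ) (u := η + t * σ) (v := ξ + t * ρ) hσ hb.2 hb.1
      (fun φ => by rw [e]; exact hbd φ) (fun φ => by
        have e2 : (σ : K) * (ξ + t * ρ) = -1 + (η + t * σ) * (ρ : K) := by
          linear_combination -hdet
        rw [e2, map_add, map_neg, map_one]
        exact (abs_add_le _ _).trans (by simp))
    exact ⟨ξ + t * ρ, η + t * σ, fractionalIdeal_add_mem hξ (hshift t ht _ hρm),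
      fractionalIdeal_add_mem hη (hshift t ht _ hσm), by linear_combination hdet,
      fun φ => (key φ).symm⟩
  · have hρK : (ρ : K) ≠ 0 := by simpa using hρ
    obtain ⟨t, ht, hbd⟩ := D.exists_add_mem_inv_sq_le j (ξ / (ρ : K))
    have e : (ξ + t * ρ) / (ρ : K) = ξ / ρ + t := by field_simp
    have key := hfst (x := ρ) (y := σ) (u := ξ + t * ρ) (v := η + t * σ) hρ hb.1 hb.2
      (fun φ => by rw [e]; exact hbd φ) (fun φ => by
        have e2 : (ρ : K) * (η + t * σ) = 1 + (ξ + t * ρ) * (σ : K) := by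
          linear_combination hdet
        rw [e2, map_add, map_one]
        exact (abs_add_le _ _).trans (by simp))
    exact ⟨ξ + t * ρ, η + t * σ, fractionalIdeal_add_mem hξ (hshift t ht _ hρm),
      fractionalIdeal_add_mem hη (hshift t ht _ hσm), by linear_combination hdet, key⟩

/-- The sum of the absolute values of the embeddings of the entries of the matrices `A_j`. -/
def matrixSum : ℝ := ∑ j, ∑ i, ∑ k, ∑ φ : K →+* ℝ, |φ (D.A j i k)|

theorem abs_A_le (j : Fin (classNumber K)) (i k : Fin 2) (φ : K →+* ℝ) :
    |φ (D.A j i k)| ≤ D.matrixSum := by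
  unfold matrixSum
  refine le_trans ?_ (Finset.single_le_sum
    (f := fun j => ∑ i, ∑ k, ∑ φ : K →+* ℝ, |φ (D.A j i k)|) (fun _ _ => by positivity)
    (Finset.mem_univ j))
  refine le_trans ?_ (Finset.single_le_sum
    (f := fun i => ∑ k, ∑ φ : K →+* ℝ, |φ (D.A j i k)|) (fun _ _ => by positivity)
    (Finset.mem_univ i))
  refine le_trans ?_ (Finset.single_le_sum
    (f := fun k => ∑ φ : K →+* ℝ, |φ (D.A j i k)|) (fun _ _ => by positivity)
    (Finset.mem_univ k))
  exact Finset.single_le_sum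
    (f := fun φ : K →+* ℝ => |φ (D.A j i k)|) (fun _ _ => abs_nonneg _) (Finset.mem_univ φ)

theorem mul_inv_entries (M N : SL(2, K)) :
    (M * N⁻¹) 0 0 = M 0 0 * N 1 1 - M 0 1 * N 1 0 ∧
    (M * N⁻¹) 0 1 = M 0 1 * N 0 0 - M 0 0 * N 0 1 ∧
    (M * N⁻¹) 1 0 = M 1 0 * N 1 1 - M 1 1 * N 1 0 ∧
    (M * N⁻¹) 1 1 = M 1 1 * N 0 0 - M 1 0 * N 0 1 := by
  simp only [Matrix.SpecialLinearGroup.coe_mul, Matrix.mul_apply, Fin.sum_univ_two,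
    Matrix.SpecialLinearGroup.coe_inv, Matrix.adjugate_fin_two, Matrix.of_apply,
    Matrix.cons_val', Matrix.cons_val_zero, Matrix.cons_val_one]
  simp
  refine ⟨?_, ?_, ?_, ?_⟩ <;> ring

/-- Take `U = A_j N⁻¹`, where `N` has first column `q` and a bounded second column. It maps the
first column of `N` to that of `A_j`, and it is integral because both matrices are normalizing for
`𝔞_j`. -/
theorem exists_bounded_conj {j : Fin (classNumber K)} {q : 𝓞 K × 𝓞 K}
    (h : Ideal.span {q.1, q.2} = D.𝔞 j) {B : ℝ} (hB : 1 ≤ B) (hb : BoundedPair B q) :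
    ∃ U : SL(2, 𝓞 K), mulPair U q = (D.ρ j, D.σ j) ∧ ∀ i k, ∀ φ : K →+* ℝ,
      |φ (U i k : K)| ≤ 2 * D.matrixSum * ((1 + entrySum (D.Bβ j) * B ^ 2) * B ^ deg K + B) := by
  obtain ⟨ξ, η, hξ, hη, hdet, hbd⟩ := D.exists_bounded_column h hB hb
  set B' := (1 + entrySum (D.Bβ j) * B ^ 2) * B ^ deg K + B
  have hE := entrySum_nonneg (D.Bβ j)
  have hB'0 : 0 ≤ (1 + entrySum (D.Bβ j) * B ^ 2) * B ^ deg K := by positivity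
  let N : SL(2, K) := ⟨!![(q.1 : K), ξ; (q.2 : K), η], by
    rw [Matrix.det_fin_two_of]; exact hdet⟩
  have hN : D.IsNormalizing j N := by
    intro i
    fin_cases i
    · exact ⟨FractionalIdeal.mem_coeIdeal_of_mem _ (h ▸ Ideal.subset_span (by simp)), hξ⟩
    · exact ⟨FractionalIdeal.mem_coeIdeal_of_mem _ (h ▸ Ideal.subset_span (by simp)), hη⟩
  obtain ⟨U, hU⟩ := D.exists_toK_eq_conj (M := 1) (D.isNormalizing_A j) hN
    (FractionalIdeal.one_mem_one _) (FractionalIdeal.one_mem_one _) rfl (Submodule.zero_mem _)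
  rw [mul_one] at hU
  obtain ⟨e00, e01, e10, e11⟩ := mul_inv_entries (D.A j) N
  rw [← hU, toK_apply] at e00 e01 e10 e11
  have n00 : N 0 0 = (q.1 : K) := rfl
  have n01 : N 0 1 = ξ := rfl
  have n10 : N 1 0 = (q.2 : K) := rfl
  have n11 : N 1 1 = η := rfl
  have a00 : D.A j 0 0 = (D.ρ j : K) := rfl
  have a10 : D.A j 1 0 = (D.σ j : K) := rfl
  rw [n11, n10] at e00 e10
  rw [n00, n01] at e01 e11
  refine ⟨U, ?_, ?_⟩
  · refine Prod.ext ?_ ?_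
    · apply RingOfIntegers.coe_injective
      have e : ((U 0 0 * q.1 + U 0 1 * q.2 : 𝓞 K) : K) = (D.ρ j : K) := by
        push_cast
        linear_combination (q.1 : K) * e00 + (q.2 : K) * e01 + a00 + D.A j 0 0 * hdet
      exact e
    · apply RingOfIntegers.coe_injective
      have e : ((U 1 0 * q.1 + U 1 1 * q.2 : 𝓞 K) : K) = (D.σ j : K) := by
        push_cast
        linear_combination (q.1 : K) * e10 + (q.2 : K) * e11 + a10 + D.A j 1 0 * hdet
      exact e
  · have hS : 0 ≤ D.matrixSum := (abs_nonneg _).trans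
      (D.abs_A_le j 0 0 (Classical.choice (by
        rw [← Fintype.card_pos_iff, card_embeddings]; exact finrank_pos)))
    have key : ∀ (φ : K →+* ℝ) (a b x y : K), |φ a| ≤ D.matrixSum → |φ b| ≤ D.matrixSum →
        |φ x| ≤ B' → |φ y| ≤ B' → |φ (a * x - b * y)| ≤ 2 * D.matrixSum * B' := by
      intro φ a b x y ha hb hx hy
      rw [map_sub, map_mul, map_mul]
      refine (abs_sub _ _).trans ?_
      rw [abs_mul, abs_mul]
      have h1 := mul_le_mul ha hx (abs_nonneg _) hS
      have h2 := mul_le_mul hb hy (abs_nonneg _) hS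
      linarith
    have b1 : ∀ φ : K →+* ℝ, |φ (q.1 : K)| ≤ B' := fun φ => (hb.1 φ).trans (by simp only [B']; linarith)
    have b2 : ∀ φ : K →+* ℝ, |φ (q.2 : K)| ≤ B' := fun φ => (hb.2 φ).trans (by simp only [B']; linarith)
    have b3 : ∀ φ : K →+* ℝ, |φ ξ| ≤ B' := fun φ => (hbd φ).1.trans (by simp only [B']; linarith)
    have b4 : ∀ φ : K →+* ℝ, |φ η| ≤ B' := fun φ => (hbd φ).2.trans (by simp only [B']; linarith)
    have hA := D.abs_A_le j
    intro i k φ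
    fin_cases i <;> fin_cases k
    · change |φ (U 0 0 : K)| ≤ _
      rw [e00]; exact key φ _ _ _ _ (hA 0 0 φ) (hA 0 1 φ) (b4 φ) (b2 φ)
    · change |φ (U 0 1 : K)| ≤ _
      rw [e01]; exact key φ _ _ _ _ (hA 0 1 φ) (hA 0 0 φ) (b1 φ) (b3 φ)
    · change |φ (U 1 0 : K)| ≤ _
      rw [e10]; exact key φ _ _ _ _ (hA 1 0 φ) (hA 1 1 φ) (b4 φ) (b2 φ)
    · change |φ (U 1 1 : K)| ≤ _
      rw [e11]; exact key φ _ _ _ _ (hA 1 1 φ) (hA 1 0 φ) (b1 φ) (b3 φ)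

/-- Every cusp has a representative that generates one of the ideals `𝔞 j` and whose embeddings are
bounded in terms of those of the cusp. -/
theorem exists_balanced_representative {p : 𝓞 K × 𝓞 K} (hp : p ≠ 0) {B : ℝ} (hB : 1 ≤ B)
    (hb : BoundedPair B p) : ∃ (j : Fin (classNumber K)) (q : 𝓞 K × 𝓞 K), SameCusp p q ∧
      Ideal.span {q.1, q.2} = D.𝔞 j ∧
      BoundedPair ((∑ φ, D.boundConst φ) * (1 + (2 * B ^ 2) ^ deg K)) q := by
  -- At the point with all coordinates `i` the local form is `r² + s²`, so bounds for the forms are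
  -- bounds for the conjugates.
  let i : HK K := fun _ => UpperHalfPlane.I
  have hform : ∀ r s : ℝ, pointForm UpperHalfPlane.I r s = r ^ 2 + s ^ 2 := fun r s => by
    simp [pointForm]
  obtain ⟨q, -, hpq, -, hq, j, hj⟩ := D.exists_bounded_representative (z := i) hp le_rfl
  refine ⟨j, q, hpq, hj, ?_⟩
  set d := cuspDist i p.1 p.2 with hd
  have hd0 : 0 ≤ d := cuspDist_nonneg _ _ _
  have hd1 : d ≤ (2 * B ^ 2) ^ deg K := by
    rw [hd, cuspDist_eq]
    have h1 : (1 : ℝ) ≤ Ideal.absNorm (Ideal.span {p.1, p.2}) := by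
      exact_mod_cast absNorm_span_pos hp
    have h2 : ∏ φ : K →+* ℝ, pointForm (i φ) (φ (p.1 : K)) (φ (p.2 : K)) ≤
        (2 * B ^ 2) ^ deg K := by
      refine prod_le_pow_deg (fun φ => pointForm_nonneg _ _ _) fun φ => ?_
      rw [hform, ← sq_abs, ← sq_abs (φ (p.2 : K))]
      have h3 := pow_le_pow_left₀ (abs_nonneg _) (hb.1 φ) 2
      have h4 := pow_le_pow_left₀ (abs_nonneg _) (hb.2 φ) 2
      linarith
    have h3 : (1 : ℝ) ≤ (2 * B ^ 2) ^ deg K := one_le_pow₀ (by nlinarith)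
    have h4 : √(∏ φ : K →+* ℝ, pointForm (i φ) (φ (p.1 : K)) (φ (p.2 : K))) ≤
        (2 * B ^ 2) ^ deg K := by
      refine (Real.sqrt_le_sqrt h2).trans ?_
      rw [Real.sqrt_le_left (by linarith)]
      nlinarith
    exact (mul_le_of_le_one_left (Real.sqrt_nonneg _) (inv_le_one_of_one_le₀ h1)).trans h4
  have hd2 : d ^ (1 / (deg K : ℝ)) ≤ 1 + (2 * B ^ 2) ^ deg K :=
    (rpow_le_one_add hd0 (by positivity) (by
      rw [div_le_one deg_pos]
      exact_mod_cast (finrank_pos : 0 < finrank ℚ K))).trans (by linarith)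
  have key : ∀ φ : K →+* ℝ, (φ (q.1 : K)) ^ 2 + (φ (q.2 : K)) ^ 2 ≤
      ((∑ φ, D.boundConst φ) * (1 + (2 * B ^ 2) ^ deg K)) ^ 2 := by
    intro φ
    have h1 := hq φ
    rw [hform] at h1
    refine h1.trans (pow_le_pow_left₀ ?_ ?_ 2)
    · exact mul_nonneg (D.boundConst_pos φ).le (Real.rpow_nonneg hd0 _)
    · refine mul_le_mul ?_ hd2 (Real.rpow_nonneg hd0 _)
        (Finset.sum_nonneg fun φ _ => (D.boundConst_pos φ).le)
      exact Finset.single_le_sum (fun φ _ => (D.boundConst_pos φ).le) (Finset.mem_univ φ)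
  have h0 : 0 ≤ (∑ φ, D.boundConst φ) * (1 + (2 * B ^ 2) ^ deg K) :=
    mul_nonneg (Finset.sum_nonneg fun φ _ => (D.boundConst_pos φ).le) (by positivity)
  exact ⟨fun φ => abs_le_of_sq_le_sq (by nlinarith [key φ, sq_nonneg (φ (q.2 : K))]) h0,
    fun φ => abs_le_of_sq_le_sq (by nlinarith [key φ, sq_nonneg (φ (q.1 : K))]) h0⟩

end TotallyReal

end ReductionData

end Field

end

/-! ### The search for a cusp representative -/

section

open Prog

section Field

variable {K : Type*} [Field K] [NumberField K]

namespace ReductionData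

variable (D : ReductionData K)

theorem testCusp_ne_none {p : 𝓞 K × 𝓞 K} {e : Fin 4 → 𝓞 K} {j : Fin (classNumber K)}
    (h : e 0 * e 3 - e 1 * e 2 = 1)
    (h' : (e 0 * p.1 + e 1 * p.2) * D.σ j = (e 2 * p.1 + e 3 * p.2) * D.ρ j) :
    D.testCusp p e j ≠ none := by
  unfold testCusp
  rw [dif_pos ⟨h, h'⟩]
  exact Option.some_ne_none _

theorem testCusp_eq_some {p : 𝓞 K × 𝓞 K} {e : Fin 4 → 𝓞 K} {j : Fin (classNumber K)}
    {r : Fin (classNumber K) × SL(2, 𝓞 K)} (h : D.testCusp p e j = some r) :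
    SameCusp (mulPair r.2 p) (D.ρ r.1, D.σ r.1) ∧ ∀ i k, ∃ l, r.2 i k = e l := by
  unfold testCusp at h
  split_ifs at h with h1
  rw [Option.some.injEq] at h
  subst h
  refine ⟨?_, fun i k => ?_⟩
  · change (e 0 * p.1 + e 1 * p.2) * D.σ j = D.ρ j * (e 2 * p.1 + e 3 * p.2)
    rw [h1.2, mul_comm]
  · fin_cases i <;> fin_cases k
    · exact ⟨0, rfl⟩
    · exact ⟨1, rfl⟩
    · exact ⟨2, rfl⟩
    · exact ⟨3, rfl⟩

/-- The search for a matrix that maps a cusp to one of the representatives. -/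
theorem spec_findRep {p : 𝓞 K × 𝓞 K} {j : Fin (classNumber K)} {U : SL(2, 𝓞 K)}
    (hU : SameCusp (mulPair U p) (D.ρ j, D.σ j)) {R : ℕ}
    (hR : ∀ i k l, |D.α.repr (U i k) l| ≤ (R : ℤ)) :
    Spec (D.findRep p) ((R + 1 : ℕ) * (1 + 3 * deg K * (2 * R + 1) ^ deg K +
        ((2 * R + 1) ^ deg K) ^ 4 * classNumber K * 20))
      fun r => SameCusp (mulPair r.2 p) (D.ρ r.1, D.σ r.1) ∧
        ∀ i k, ∀ φ : K →+* ℝ, |φ (r.2 i k : K)| ≤ entrySum D.BO * R := by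
  let Q : Fin (classNumber K) × SL(2, 𝓞 K) → Prop := fun r =>
    SameCusp (mulPair r.2 p) (D.ρ r.1, D.σ r.1) ∧
      ∀ i k, ∀ φ : K →+* ℝ, |φ (r.2 i k : K)| ≤ entrySum D.BO * R
  -- The measure is the distance of the current radius `R'` to the radius `R` at which the known
  -- matrix `U` appears.
  refine Spec.loop (Q := Q) (fun k R' => R' + k = R) ?_ R 0 (zero_add R)
  intro k R' hR'
  set E := (choices (deg K) fun _ => intRange (-(R' : ℤ)) (R' : ℤ)).map D.ofCoords with hE
  have hlen : E.length = (2 * R' + 1) ^ deg K := by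
    have h1 : (((R' : ℤ) + 1 - -(R' : ℤ)).toNat) = 2 * R' + 1 := by omega
    rw [hE, List.length_map, length_choices]
    simp only [length_intRange, h1, Finset.prod_const, Finset.card_univ, Fintype.card_fin]
  have hlenR : (E.length : ℝ) ≤ (2 * R + 1) ^ deg K := by
    rw [hlen]
    push_cast
    refine pow_le_pow_left₀ (by positivity) ?_ _
    have : (R' : ℝ) ≤ R := by exact_mod_cast (by omega : R' ≤ R)
    linarith
  have hEbd : ∀ x ∈ E, ∀ φ : K →+* ℝ, |φ (x : K)| ≤ entrySum D.BO * R := by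
    intro x hx φ
    obtain ⟨X, hX, rfl⟩ := List.mem_map.1 hx
    refine D.abs_embedding_ofCoords_le (fun l => ?_) (Nat.cast_nonneg R) φ
    have h1 := mem_intRange.1 (mem_choices.1 hX l)
    have h2 : |X l| ≤ (R : ℤ) := by
      rw [abs_le]; omega
    exact_mod_cast h2
  refine Spec.charge ?_
  refine (Spec.forEach (T := ((20 : ℕ) : ℝ)) (Inv := fun found => ∀ r, found = some r → Q r)
    (P := fun q found => D.testCusp p q.1 q.2 ≠ none → found ≠ none) ?_ ?_).bind ?_
  · intro found hfound q hq
    refine Spec.charge ?_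
    rw [sub_self]
    cases found with
    | some r => exact Spec.ret le_rfl ⟨hfound, fun _ => Option.some_ne_none r, fun _ h => h⟩
    | none =>
      refine Spec.ret le_rfl ⟨fun r hr => ?_, fun h => h, fun b hb hb' => absurd rfl (hb hb')⟩
      obtain ⟨h1, h2⟩ := D.testCusp_eq_some hr
      refine ⟨h1, fun i k φ => ?_⟩
      obtain ⟨l, hl⟩ := h2 i k
      rw [hl]
      exact hEbd _ (mem_choices.1 (List.mem_product.1 hq).1 l) φ
  · intro r hr
    exact absurd hr.symm (Option.some_ne_none r)
  · rintro found ⟨hinv, hP, -⟩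
    have hcost : (0 : ℝ) ≤ 1 + 3 * deg K * (2 * R + 1) ^ deg K +
        ((2 * R + 1) ^ deg K) ^ 4 * classNumber K * 20 - (1 + 3 * deg K * E.length : ℕ) -
        (((choices 4 fun _ => E).product (List.finRange (classNumber K))).length : ℝ) *
          (20 : ℕ) := by
      have h1 : ((choices 4 fun _ => E).product (List.finRange (classNumber K))).length =
          E.length ^ 4 * classNumber K := by
        rw [List.product, List.length_flatMap]
        simp [length_choices]
      rw [h1]
      push_cast
      have h2 : (E.length : ℝ) ^ 4 ≤ ((2 * R + 1) ^ deg K) ^ 4 :=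
        pow_le_pow_left₀ (Nat.cast_nonneg _) hlenR 4
      have h3 : (0 : ℝ) ≤ classNumber K := Nat.cast_nonneg _
      have h4 : (0 : ℝ) ≤ 3 * deg K := by positivity
      have h5 := mul_le_mul_of_nonneg_left hlenR h4
      have h6 := mul_le_mul_of_nonneg_right h2 h3
      linarith
    cases found with
    | some r => exact Spec.ret hcost (hinv r rfl)
    | none =>
      refine Spec.ret hcost ?_
      cases k with
      | zero =>
        exfalso
        rw [add_zero] at hR'
        subst hR'
        -- At the radius `R` the entries of `U` are in the list, so the round cannot have failed.
        have hmem : ∀ i k, U i k ∈ E := fun i k => by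
          refine List.mem_map.2 ⟨⇑(D.α.repr (U i k)), mem_choices.2 fun l => ?_, D.ofCoords_repr _⟩
          exact mem_intRange.2 (abs_le.1 (hR i k l))
        have hdet := U.det_coe
        rw [Matrix.det_fin_two] at hdet
        refine hP (![U 0 0, U 0 1, U 1 0, U 1 1], j) ?_ (D.testCusp_ne_none hdet ?_) rfl
        · refine List.mem_product.2 ⟨mem_choices.2 fun l => ?_, List.mem_finRange j⟩
          fin_cases l
          · exact hmem 0 0
          · exact hmem 0 1
          · exact hmem 1 0
          · exact hmem 1 1
        · have := hU
          rw [SameCusp] at this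
          exact this.trans (mul_comm _ _)
      | succ k => exact ⟨k, rfl, by omega⟩

section TotallyReal

variable [IsTotallyReal K]

/-- The given representative of the cusp need not generate any `𝔞_j`. It is exchanged for a balanced
one, `q`, and a bounded `U` with `U q = (ρ_j, σ_j)` then also maps the given cusp to `λ_j`. -/
theorem exists_spec_findRep {B : HK K → ℝ} (hB : PolyBdd B) (hB1 : ∀ z, 1 ≤ B z) :
    ∃ T B' : HK K → ℝ, PolyBdd T ∧ PolyBdd B' ∧ (∀ z, 0 ≤ B' z) ∧
      ∀ z, ∀ p : 𝓞 K × 𝓞 K, p ≠ 0 → BoundedPair (B z) p →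
        Spec (D.findRep p) (T z) fun r => SameCusp (mulPair r.2 p) (D.ρ r.1, D.σ r.1) ∧
          ∀ i k, ∀ φ : K →+* ℝ, |φ (r.2 i k : K)| ≤ B' z := by
  obtain ⟨B₁, hB₁def⟩ : ∃ B₁ : HK K → ℝ, B₁ = fun z =>
    1 + (∑ φ, D.boundConst φ) * (1 + (2 * B z ^ 2) ^ deg K) := ⟨_, rfl⟩
  have hB₁ : PolyBdd B₁ := hB₁def ▸ (PolyBdd.const 1).add ((PolyBdd.const _).mul
    ((PolyBdd.const 1).add (((PolyBdd.const 2).mul (hB.pow 2)).pow _)))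
  set e := ∑ j, entrySum (D.Bβ j) with he
  have hebd : ∀ j, entrySum (D.Bβ j) ≤ e := fun j =>
    Finset.single_le_sum (f := fun j => entrySum (D.Bβ j)) (fun _ _ => entrySum_nonneg _)
      (Finset.mem_univ j)
  have he0 : 0 ≤ e := Finset.sum_nonneg fun _ _ => entrySum_nonneg _
  obtain ⟨B₂, hB₂def⟩ : ∃ B₂ : HK K → ℝ, B₂ = fun z =>
    2 * D.matrixSum * ((1 + e * B₁ z ^ 2) * B₁ z ^ deg K + B₁ z) := ⟨_, rfl⟩
  have hB₂ : PolyBdd B₂ := hB₂def ▸ (PolyBdd.const _).mul ((((PolyBdd.const 1).add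
    ((PolyBdd.const e).mul (hB₁.pow 2))).mul (hB₁.pow _)).add hB₁)
  have hS : 0 ≤ D.matrixSum := by
    unfold matrixSum; positivity
  have hbc : 0 ≤ ∑ φ, D.boundConst φ := Finset.sum_nonneg fun φ _ => (D.boundConst_pos φ).le
  have hB₁1 : ∀ z, 1 ≤ B₁ z := fun z => by
    have : 0 ≤ (∑ φ, D.boundConst φ) * (1 + (2 * B z ^ 2) ^ deg K) :=
      mul_nonneg hbc (by positivity)
    rw [hB₁def]; dsimp only; linarith
  have hB₂0 : ∀ z, 0 ≤ B₂ z := fun z => by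
    have h0 := zero_le_one.trans (hB₁1 z)
    rw [hB₂def]
    exact mul_nonneg (mul_nonneg zero_le_two hS) (add_nonneg (mul_nonneg (add_nonneg zero_le_one
      (mul_nonneg he0 (sq_nonneg _))) (pow_nonneg h0 _)) h0)
  set E := entrySum (leftInv D.BO)
  have hE : 0 ≤ E := entrySum_nonneg _
  have hE' := entrySum_nonneg D.BO
  obtain ⟨R, hRdef⟩ : ∃ R : HK K → ℕ, ∀ z, R z = ⌈E * B₂ z⌉₊ := ⟨_, fun _ => rfl⟩
  have hR : PolyBdd fun z => (R z : ℝ) := by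
    refine (((PolyBdd.const E).mul hB₂).add (PolyBdd.const 1)).mono' (fun z => Nat.cast_nonneg _)
      fun z => by
        rw [hRdef]
        exact (Nat.ceil_lt_add_one (mul_nonneg hE (hB₂0 z))).le
  have hR1 : PolyBdd fun z => (2 * (R z : ℝ) + 1) ^ deg K :=
    (((PolyBdd.const 2).mul hR).add (PolyBdd.const 1)).pow _
  refine ⟨fun z => (R z + 1 : ℕ) * (1 + 3 * deg K * (2 * (R z : ℝ) + 1) ^ deg K +
        ((2 * (R z : ℝ) + 1) ^ deg K) ^ 4 * classNumber K * 20),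
    fun z => entrySum D.BO * R z, ?_, (PolyBdd.const _).mul hR, fun z => mul_nonneg hE' (Nat.cast_nonneg _),
    fun z p hp hbp => ?_⟩
  · push_cast
    exact (hR.add (PolyBdd.const 1)).mul (((PolyBdd.const 1).add ((PolyBdd.const _).mul hR1)).add
      (((hR1.pow 4).mul (PolyBdd.const _)).mul (PolyBdd.const 20)))
  · obtain ⟨j, q, hpq, hspan, hq⟩ := D.exists_balanced_representative hp (hB1 z) hbp
    have hq' : BoundedPair (B₁ z) q :=
      ⟨fun φ => (hq.1 φ).trans (by rw [hB₁def]; dsimp only; linarith),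
        fun φ => (hq.2 φ).trans (by rw [hB₁def]; dsimp only; linarith)⟩
    obtain ⟨U, hUq, hU⟩ := D.exists_bounded_conj hspan (hB₁1 z) hq'
    have hsame : SameCusp (mulPair U p) (D.ρ j, D.σ j) := by
      rw [← hUq]; exact sameCusp_mulPair U hpq
    refine D.spec_findRep hsame fun i k l => ?_
    have hU' : ∀ φ : K →+* ℝ, |φ (U i k : K)| ≤ B₂ z := fun φ => by
      rw [hB₂def]
      refine (hU i k φ).trans (mul_le_mul_of_nonneg_left ?_ (mul_nonneg zero_le_two hS))
      have := hB₁1 z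
      gcongr
      exact hebd j
    have h1 := (D.abs_repr_le hU' (hB₂0 z) l).trans (Nat.le_ceil _)
    rw [← hRdef] at h1
    exact_mod_cast h1

end TotallyReal

end ReductionData

end Field

end

/-! ### The reduction algorithm -/

section

open Prog

theorem abs_log_le {t : ℝ} (ht : 0 < t) : |Real.log t| ≤ t + t⁻¹ := by
  have h1 := Real.log_le_self ht.le
  have h2 := Real.log_le_self (inv_nonneg.2 ht.le)
  rw [Real.log_inv] at h2
  have h3 := inv_pos.2 ht
  exact abs_le.2 ⟨by linarith, by linarith⟩

theorem normSq_mul_add_le {a b G s : ℝ} {w : ℍ} (ha : |a| ≤ G) (hb : |b| ≤ G)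
    (hx : |w.re| ≤ s) (hy : w.im ≤ s) :
    Complex.normSq ((a : ℂ) * w + b) ≤ (G * s + G) ^ 2 + (G * s) ^ 2 := by
  have hG := (abs_nonneg a).trans ha
  have e : Complex.normSq ((a : ℂ) * w + b) = (a * w.re + b) ^ 2 + (a * w.im) ^ 2 := by
    rw [Complex.normSq_apply]
    simp
    ring
  rw [e, ← sq_abs, ← sq_abs (a * w.im), abs_mul a w.im, abs_of_pos w.im_pos]
  refine add_le_add (pow_le_pow_left₀ (abs_nonneg _) ?_ 2) (pow_le_pow_left₀ ?_ ?_ 2)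
  · refine (abs_add_le _ _).trans (add_le_add ?_ hb)
    rw [abs_mul]
    exact mul_le_mul ha hx (abs_nonneg _) hG
  · exact mul_nonneg (abs_nonneg _) w.im_pos.le
  · exact mul_le_mul ha hy w.im_pos.le hG

/-- The first row of `g` bounds the imaginary part of `g • w` from above, the second row bounds its
inverse. -/
theorem abs_log_im_sl_smul_le {g : SL(2, ℝ)} {w : ℍ} {G s : ℝ} (hg : ∀ i k, |g i k| ≤ G)
    (hx : |w.re| ≤ s) (hy : w.im ≤ s) (hy' : w.im⁻¹ ≤ s) :
    |Real.log (g • w).im| ≤ 2 * (((G * s + G) ^ 2 + (G * s) ^ 2) * s) := by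
  have hs : 0 ≤ s := w.im_pos.le.trans hy
  have h1 : (g • w).im ≤ ((G * s + G) ^ 2 + (G * s) ^ 2) * s := by
    refine (im_sl_smul_le g w).trans ?_
    rw [div_eq_mul_inv]
    exact mul_le_mul (normSq_mul_add_le (hg 0 0) (hg 0 1) hx hy) hy'
      (inv_nonneg.2 w.im_pos.le) (by positivity)
  have h2 : (g • w).im⁻¹ ≤ ((G * s + G) ^ 2 + (G * s) ^ 2) * s := by
    rw [im_sl_smul, inv_div, div_eq_mul_inv]
    exact mul_le_mul (normSq_mul_add_le (hg 1 0) (hg 1 1) hx hy) hy'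
      (inv_nonneg.2 w.im_pos.le) (by positivity)
  have := abs_log_le (g • w).im_pos
  linarith

section Field

variable {K : Type*} [Field K] [NumberField K]

theorem inv_mul_entries (M N : SL(2, K)) (k : Fin 2) :
    (M⁻¹ * N) 0 k = M 1 1 * N 0 k - M 0 1 * N 1 k ∧
    (M⁻¹ * N) 1 k = M 0 0 * N 1 k - M 1 0 * N 0 k := by
  simp only [Matrix.SpecialLinearGroup.coe_mul, Matrix.mul_apply, Fin.sum_univ_two,
    Matrix.SpecialLinearGroup.coe_inv, Matrix.adjugate_fin_two, Matrix.of_apply,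
    Matrix.cons_val', Matrix.cons_val_zero, Matrix.cons_val_one]
  simp
  refine ⟨?_, ?_⟩ <;> ring

theorem translation_mul_multiplier (α : K) (ε : (𝓞 K)ˣ) :
    (translation α * multiplier ε) 0 0 = ((ε : 𝓞 K) : K) ∧
    (translation α * multiplier ε) 0 1 = α * ((ε : 𝓞 K) : K)⁻¹ ∧
    (translation α * multiplier ε) 1 0 = 0 ∧
    (translation α * multiplier ε) 1 1 = ((ε : 𝓞 K) : K)⁻¹ := by
  have t00 : translation α 0 0 = 1 := rfl
  have t01 : translation α 0 1 = α := rfl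
  have t10 : translation α 1 0 = 0 := rfl
  have t11 : translation α 1 1 = 1 := rfl
  have m00 : multiplier ε 0 0 = ((ε : 𝓞 K) : K) := rfl
  have m01 : multiplier ε 0 1 = 0 := rfl
  have m10 : multiplier ε 1 0 = 0 := rfl
  have m11 : multiplier ε 1 1 = ((ε : 𝓞 K) : K)⁻¹ := rfl
  simp only [Matrix.SpecialLinearGroup.coe_mul, Matrix.mul_apply, Fin.sum_univ_two, t00, t01, t10,
    t11, m00, m01, m10, m11, one_mul, mul_zero, zero_mul, add_zero, zero_add, and_self]

namespace ReductionData

variable (D : ReductionData K)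

section TotallyReal

variable [IsTotallyReal K]

/-- From `V A_j = A_j M` with `M` upper triangular, `V` multiplies the first column of `A_j` by `ε`
and so fixes the cusp. Integrality uses that `ε⁻¹` is integral as well. -/
theorem exists_stabilizer (j : Fin (classNumber K)) (ε : (𝓞 K)ˣ) {α : K}
    (hα : α ∈ ((D.𝔞 j : FractionalIdeal (𝓞 K)⁰ K))⁻¹ ^ 2) :
    ∃ V : SL(2, 𝓞 K), toK V = D.A j * (translation α * multiplier ε) * (D.A j)⁻¹ ∧
      SameCusp (mulPair V (D.ρ j, D.σ j)) (D.ρ j, D.σ j) := by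
  obtain ⟨h00, h01, h10, h11⟩ := translation_mul_multiplier α ε
  have hinv : ((ε : 𝓞 K) : K)⁻¹ = (((ε⁻¹ : (𝓞 K)ˣ) : 𝓞 K) : K) := by simp
  have hm : ((ε : 𝓞 K) : K)⁻¹ ∈ (1 : FractionalIdeal (𝓞 K)⁰ K) := by
    rw [hinv]; exact coe_mem_one _
  obtain ⟨V, hV⟩ := D.exists_toK_eq_conj (M := translation α * multiplier ε)
    (D.isNormalizing_A j) (D.isNormalizing_A j) (by rw [h00]; exact coe_mem_one _)
    (by rw [h11]; exact hm) h10 (by rw [h01, mul_comm]; exact one_mul_mem hm hα)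
  refine ⟨V, hV, ?_⟩
  have h1 : toK V * D.A j = D.A j * (translation α * multiplier ε) := by
    rw [hV, inv_mul_cancel_right]
  have e : ∀ i, (V i 0 : K) * D.ρ j + (V i 1 : K) * D.σ j = D.A j i 0 * ((ε : 𝓞 K) : K) := by
    intro i
    have h2 := congrArg (fun M : SL(2, K) => M i 0) h1
    simp only [Matrix.SpecialLinearGroup.coe_mul, Matrix.mul_apply, Fin.sum_univ_two] at h2
    simp only [Matrix.SpecialLinearGroup.coe_mul, Matrix.mul_apply, Fin.sum_univ_two] at h00 h10
    rw [h00, h10, mul_zero, add_zero] at h2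
    exact h2
  have e0 := e 0
  have e1 := e 1
  change _ = (D.ρ j : K) * _ at e0
  change _ = (D.σ j : K) * _ at e1
  apply RingOfIntegers.coe_injective
  have : (((V 0 0 * D.ρ j + V 0 1 * D.σ j) * D.σ j : 𝓞 K) : K) =
      ((D.ρ j * (V 1 0 * D.ρ j + V 1 1 * D.σ j) : 𝓞 K) : K) := by
    push_cast
    linear_combination (D.σ j : K) * e0 - (D.ρ j : K) * e1
  exact this

/-- The part of the reduction algorithm after the closest cusp has been mapped to a representative
is correct. -/
theorem exists_act_mem_domainPart {z : HK K} {μ : 𝓞 K × 𝓞 K} (hμ : IsClosest z μ)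
    {j : Fin (classNumber K)} {U : SL(2, 𝓞 K)}
    (hU : SameCusp (mulPair U μ) (D.ρ j, D.σ j)) {w : HK K}
    (hw : w = act ((D.A j)⁻¹ * toK U) z) {ε : (𝓞 K)ˣ} (hε : ε = D.reducingUnit (yPart w))
    {X : Fin (deg K) → ℝ}
    (hX : X = (leftInv (D.Bβ j)).mulVec (xPart (act (multiplier ε) w))) {α : K}
    (hα : α = ∑ k, (-nearest (X k)) • (D.β j k : K)) :
    ∃ A : SL(2, 𝓞 K), toK A = D.A j * translation α * multiplier ε * (D.A j)⁻¹ * toK U ∧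
      act (toK A) z ∈ D.domainPart j := by
  obtain ⟨V, hV, hVc⟩ := D.exists_stabilizer j ε (hα ▸ D.sum_mem_inv_sq j _)
  obtain ⟨h00, h01, h10, h11⟩ := translation_mul_multiplier α ε
  have hε0 : ((ε : 𝓞 K) : K) ≠ 0 := by simp
  have hVU : toK (V * U) = D.A j * translation α * multiplier ε * (D.A j)⁻¹ * toK U := by
    rw [toK_mul, hV]
    simp only [mul_assoc]
  refine ⟨V * U, hVU, ?_⟩
  have hact : act (D.A j)⁻¹ (act (toK (V * U)) z) = act (translation α * multiplier ε) w := by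
    rw [hw, ← act_mul, ← act_mul, hVU]
    congr 1
    group
  have hclosest : IsClosest (act (toK (V * U)) z) (D.ρ j, D.σ j) := by
    rw [toK_mul, act_mul]
    exact (((hμ.mulPair U).sameCusp hU (D.cusp_ne_zero j)).mulPair V).sameCusp hVc
      (D.cusp_ne_zero j)
  refine ⟨⟨?_, ?_⟩, (isClosest_iff (D.cusp_ne_zero j)).1 hclosest⟩
  · rw [hact]
    refine ⟨X + fun k => ((-nearest (X k) : ℤ) : ℝ), fun k => ?_, ?_⟩
    · have h1 := nearest_le (X k)
      have h2 := lt_nearest (X k)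
      rw [Pi.add_apply]
      push_cast
      constructor <;> linarith
    · ext φ
      rw [Matrix.mulVec_add, Pi.add_apply, ← D.embedding_sum_β, ← hα, hX,
        mulVec_leftInv (D.isUnit_Bβ j), xPart_act_upper h00 h10, h01,
        xPart_act_upper (M := multiplier ε) (e := ((ε : 𝓞 K) : K)) rfl rfl]
      -- The upper right entry of the product of translation and multiplier is `α ε⁻¹`, yet the
      -- product translates real parts by `α`.
      have e1 : ((ε : 𝓞 K) : K) * (α * ((ε : 𝓞 K) : K)⁻¹) = α := by field_simp
      have e2 : multiplier ε 0 1 = 0 := rfl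
      rw [e1, e2, mul_zero, map_zero, add_zero]
  · rw [hact, yPart_act_upper h00 h10, hε]
    exact D.unitReduced_reducingUnit (yPart_pos w)

theorem abs_logNormalized_le {y : (K →+* ℝ) → ℝ} (hy : ∀ φ, 0 < y φ) {L : ℝ}
    (hL : ∀ φ, |Real.log (y φ)| ≤ L) (φ : K →+* ℝ) : |logNormalized y φ| ≤ 2 * L := by
  rw [logNormalized_apply hy]
  have hn := deg_pos (K := K)
  have h1 : |∑ ψ, Real.log (y ψ)| ≤ deg K * L := by
    refine (Finset.abs_sum_le_sum_abs _ _).trans ((Finset.sum_le_sum fun ψ _ => hL ψ).trans_eq ?_)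
    rw [Finset.sum_const, Finset.card_univ, card_embeddings, nsmul_eq_mul]
  refine (abs_sub _ _).trans ?_
  rw [abs_mul, abs_of_pos (one_div_pos.2 hn)]
  have h2 : 1 / (deg K : ℝ) * |∑ ψ, Real.log (y ψ)| ≤ L := by
    rw [one_div, inv_mul_le_iff₀ hn]
    exact h1
  linarith [hL φ]

theorem sum_unit_exponents_le {y : (K →+* ℝ) → ℝ} (hy : ∀ φ, 0 < y φ) {L : ℝ} (hL0 : 0 ≤ L)
    (hL : ∀ φ, |Real.log (y φ)| ≤ L) :
    ((∑ k : Fin (Units.rank K), (1 +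
      (-nearest ((leftInv D.BΛ).mulVec (logNormalized y) k / 2)).natAbs) : ℕ) : ℝ) ≤
      Units.rank K * (2 + entrySum (leftInv D.BΛ) * L) := by
  push_cast
  refine (Finset.sum_le_sum (g := fun _ => 2 + entrySum (leftInv D.BΛ) * L)
    fun k _ => ?_).trans_eq ?_
  · set t := (leftInv D.BΛ).mulVec (logNormalized y) k with ht
    have h1 : |t| ≤ entrySum (leftInv D.BΛ) * (2 * L) :=
      abs_mulVec_le _ (abs_logNormalized_le hy hL) (by positivity) k
    have h2 := abs_nearest_le (t / 2)
    rw [abs_div, abs_of_pos (zero_lt_two (α := ℝ))] at h2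
    rw [Int.natAbs_neg, Nat.cast_natAbs, Int.cast_abs]
    linarith
  · rw [Finset.sum_const, Finset.card_univ, Fintype.card_fin, nsmul_eq_mul]

/-- Besides the two searches, the only cost that depends on `z` is that of the unit exponents. These
are linear in the logarithms of `Im w`, where `w` is the image of `z` under a matrix with bounded
conjugates. -/
theorem exists_spec_reduce : ∃ T : HK K → ℝ, PolyBdd T ∧ ∀ z, Spec (D.reduce z) (T z)
    fun M => ∃ A : SL(2, 𝓞 K), toK A = M ∧ act (toK A) z ∈ D.fundamentalDomain := by
  obtain ⟨T₁, B₁, hT₁, hB₁, hB₁1, hclosest⟩ := D.exists_spec_closestCusp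
  obtain ⟨T₂, B₂, hT₂, hB₂, hB₂0, hfind⟩ := D.exists_spec_findRep hB₁ hB₁1
  obtain ⟨G, hG⟩ : ∃ G : HK K → ℝ, G = fun z => 2 * D.matrixSum * B₂ z := ⟨_, rfl⟩
  have hGp : PolyBdd G := hG ▸ (PolyBdd.const _).mul hB₂
  obtain ⟨L, hL⟩ : ∃ L : HK K → ℝ, L = fun z =>
    2 * (((G z * size z + G z) ^ 2 + (G z * size z) ^ 2) * size z) := ⟨_, rfl⟩
  have hs : PolyBdd (size (K := K)) := PolyBdd.size
  have hLp : PolyBdd L := hL ▸ (PolyBdd.const _).mul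
    (((((hGp.mul hs).add hGp).pow 2).add ((hGp.mul hs).pow 2)).mul hs)
  have hL0 : ∀ z, 0 ≤ L z := fun z => by
    rw [hL]
    exact mul_nonneg zero_le_two (mul_nonneg (add_nonneg (sq_nonneg _) (sq_nonneg _))
      (zero_le_one.trans (one_le_size z)))
  refine ⟨fun z => T₁ z + T₂ z + (100 * deg K ^ 2 + 100 : ℕ) +
    Units.rank K * (2 + entrySum (leftInv D.BΛ) * L z) + (100 * deg K ^ 2 + 100 : ℕ), ?_,
    fun z => ?_⟩
  · exact (((hT₁.add hT₂).add (PolyBdd.const _)).add ((PolyBdd.const _).mul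
      ((PolyBdd.const 2).add ((PolyBdd.const _).mul hLp)))).add (PolyBdd.const _)
  · refine (hclosest z).bind fun μ hμ => (hfind z μ hμ.1.1 hμ.2).bind fun q hq => ?_
    obtain ⟨A, hA, hmem⟩ := D.exists_act_mem_domainPart hμ.1 hq.1 rfl rfl rfl rfl
    refine Spec.charge (Spec.charge (Spec.charge (Spec.ret ?_ ⟨A, hA, Set.mem_iUnion.2 ⟨_, hmem⟩⟩)))
    have hlog : ∀ φ, |Real.log (yPart (act ((D.A q.1)⁻¹ * toK q.2) z) φ)| ≤ L z := by
      intro φ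
      rw [hL]
      refine abs_log_im_sl_smul_le (G := G z) (fun i k => ?_) (abs_xPart_le z φ) (yPart_le z φ)
        (inv_yPart_le z φ)
      rw [hG]
      have hS : 0 ≤ D.matrixSum := (abs_nonneg _).trans (D.abs_A_le q.1 0 0 φ)
      have key : ∀ a b x y : K, |φ a| ≤ D.matrixSum → |φ b| ≤ D.matrixSum →
          |φ x| ≤ B₂ z → |φ y| ≤ B₂ z → |φ (a * x - b * y)| ≤ 2 * D.matrixSum * B₂ z := by
        intro a b x y ha hb hx hy
        rw [map_sub, map_mul, map_mul]
        refine (abs_sub _ _).trans ?_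
        rw [abs_mul, abs_mul]
        have h1 := mul_le_mul ha hx (abs_nonneg _) hS
        have h2 := mul_le_mul hb hy (abs_nonneg _) hS
        linarith
      have hA := fun i k => D.abs_A_le q.1 i k φ
      have hq2 := fun i k => hq.2 i k φ
      change |φ (((D.A q.1)⁻¹ * toK q.2) i k)| ≤ _
      obtain ⟨e0, e1⟩ := inv_mul_entries (D.A q.1) (toK q.2) k
      fin_cases i
      · refine (le_of_eq (congrArg (fun x => |φ x|) e0)).trans ?_
        exact key _ _ _ _ (hA 1 1) (hA 0 1) (hq2 0 k) (hq2 1 k)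
      · refine (le_of_eq (congrArg (fun x => |φ x|) e1)).trans ?_
        exact key _ _ _ _ (hA 0 0) (hA 1 0) (hq2 1 k) (hq2 0 k)
    have := D.sum_unit_exponents_le (yPart_pos _) (hL0 z) hlog
    linarith

end TotallyReal

end ReductionData

end Field

end

/-! ### Existence of the reduction data -/

section

open Prog

section Field

variable {K : Type*} [Field K] [NumberField K]

/-- A real embedding maps roots of unity to real numbers of absolute value `1`. -/
theorem eq_one_or_neg_one_of_mem_torsion [IsTotallyReal K] {u : (𝓞 K)ˣ}
    (hu : u ∈ Units.torsion K) : u = 1 ∨ u = -1 := by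
  have hne : Nonempty (K →+* ℝ) := by
    rw [← Fintype.card_pos_iff, card_embeddings]; exact finrank_pos
  obtain ⟨φ⟩ := hne
  obtain ⟨n, hn, h⟩ := isOfFinOrder_iff_pow_eq_one.1 ((CommGroup.mem_torsion _).1 hu)
  have h1 : φ ((u : 𝓞 K) : K) ^ n = 1 := by
    rw [← map_pow, ← map_pow, ← Units.val_pow_eq_pow_val, h]; simp
  have h2 : |φ ((u : 𝓞 K) : K)| = 1 := by
    rw [← pow_eq_one_iff_of_nonneg (abs_nonneg _) hn.ne', ← abs_pow, h1, abs_one]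
  rcases eq_or_eq_neg_of_abs_eq h2 with h3 | h3
  · left
    apply Units.ext
    apply RingOfIntegers.coe_injective
    apply φ.injective
    rw [h3]; simp
  · right
    apply Units.ext
    apply RingOfIntegers.coe_injective
    apply φ.injective
    rw [h3]; simp

theorem existsUnique_fundSystem [IsTotallyReal K] (u : (𝓞 K)ˣ) :
    ∃! b : Fin (Units.rank K) → ℤ,
      u = ∏ k, Units.fundSystem K k ^ b k ∨ u = -∏ k, Units.fundSystem K k ^ b k := by
  obtain ⟨⟨ζ, e⟩, h, huniq⟩ := Units.exist_unique_eq_mul_prod K u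
  have hneg : (-1 : (𝓞 K)ˣ) ∈ Units.torsion K :=
    (CommGroup.mem_torsion _).2 (isOfFinOrder_iff_pow_eq_one.2 ⟨2, two_pos, by simp⟩)
  refine ⟨e, ?_, fun b hb => ?_⟩
  · dsimp only at h ⊢
    rcases eq_one_or_neg_one_of_mem_torsion ζ.2 with h1 | h1
    · left; rw [h, h1, one_mul]
    · right; rw [h, h1, neg_one_mul]
  · rcases hb with hb | hb
    · exact (Prod.ext_iff.1 (huniq (1, b) (by simpa using hb))).2
    · exact (Prod.ext_iff.1 (huniq (⟨-1, hneg⟩, b) (by simpa using hb))).2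

theorem exists_ideal_of_minimal_norm (c : ClassGroup (𝓞 K)) :
    ∃ I : (Ideal (𝓞 K))⁰, ClassGroup.mk0 I = c ∧ ∀ J : (Ideal (𝓞 K))⁰, ClassGroup.mk0 J = c →
      Ideal.absNorm (I : Ideal (𝓞 K)) ≤ Ideal.absNorm (J : Ideal (𝓞 K)) := by
  have hne : {I : (Ideal (𝓞 K))⁰ | ClassGroup.mk0 I = c}.Nonempty := ClassGroup.mk0_surjective c
  have h := Function.argminOn_mem (fun I : (Ideal (𝓞 K))⁰ => Ideal.absNorm (I : Ideal (𝓞 K))) _ hne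
  exact ⟨_, h, fun J hJ => Function.argminOn_le (f := fun I : (Ideal (𝓞 K))⁰ =>
    Ideal.absNorm (I : Ideal (𝓞 K))) (s := {I | ClassGroup.mk0 I = c}) (show J ∈ _ from hJ)⟩

/-- Ideals of a Dedekind domain have two generators. The unit ideal gets the pair `(1, 0)`, that is,
the cusp at infinity. -/
theorem exists_generating_pair {I : Ideal (𝓞 K)} (hI : I ≠ ⊥) :
    ∃ ρ σ : 𝓞 K, Ideal.span {ρ, σ} = I ∧ (I = ⊤ → σ = 0) := by
  by_cases h : I = ⊤
  · exact ⟨1, 0, by rw [h, Ideal.eq_top_iff_one]; exact Ideal.subset_span (by simp), fun _ => rfl⟩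
  · obtain ⟨x, hx, hx0⟩ := Submodule.exists_mem_ne_zero_of_ne_bot hI
    obtain ⟨y, hy⟩ := IsDedekindDomain.exists_eq_span_pair hx hx0
    exact ⟨x, y, hy.symm, fun h' => absurd h' h⟩

theorem nonempty_basis_fractionalIdeal {I : FractionalIdeal (𝓞 K)⁰ K} (hI : I ≠ 0) :
    Nonempty (Basis (Fin (deg K)) ℤ I) := by
  have h := fractionalIdeal_rank K (Units.mk0 I hI)
  rw [RingOfIntegers.rank] at h
  exact ⟨finBasisOfFinrankEq ℤ (I : Submodule (𝓞 K) K) h⟩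

theorem nonempty_reductionData [IsTotallyReal K] : Nonempty (ReductionData K) := by
  let e : Fin (classNumber K) ≃ ClassGroup (𝓞 K) := (Fintype.equivFinOfCardEq rfl).symm
  choose I hI hmin using fun j => exists_ideal_of_minimal_norm (e j)
  have hI0 : ∀ j, (I j : Ideal (𝓞 K)) ≠ ⊥ := fun j => nonZeroDivisors.ne_zero (I j).2
  choose ρ σ hspan hinf using fun j => exists_generating_pair (hI0 j)
  choose ξ η hξ hη hdet using fun j => exists_det_eq_one (hI0 j) (hspan j)
  have hβ : ∀ j, Nonempty (Basis (Fin (deg K)) ℤ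
      ((((I j : Ideal (𝓞 K)) : FractionalIdeal (𝓞 K)⁰ K)⁻¹ ^ 2 : FractionalIdeal (𝓞 K)⁰ K))) :=
    fun j => nonempty_basis_fractionalIdeal
      (pow_ne_zero 2 (inv_ne_zero (FractionalIdeal.coeIdeal_ne_zero.2 (hI0 j))))
  exact ⟨{
    α := finBasisOfFinrankEq ℤ (𝓞 K) (RingOfIntegers.rank K)
    ε := Units.fundSystem K
    ε_spec := existsUnique_fundSystem
    𝔞 := fun j => I j
    𝔞_mem := fun j => (I j).2
    𝔞_bij := by
      convert e.bijective using 1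
      exact funext hI
    𝔞_min := fun j J hJ => hmin j J (hJ.trans (hI j))
    ρ := ρ
    σ := σ
    span_cusp := hspan
    cusp_infty := hinf
    ξ := ξ
    η := η
    ξ_mem := hξ
    η_mem := hη
    det_cusp := hdet
    β := fun j => Classical.choice (hβ j) }⟩

/-- The covering property is the postcondition of the algorithm with its cost forgotten. -/
theorem ReductionData.isFundamentalDomain [IsTotallyReal K] (D : ReductionData K) :
    IsFundamentalDomain D.fundamentalDomain := by
  obtain ⟨T, -, hT⟩ := D.exists_spec_reduce
  refine ⟨fun z => ?_, fun V W h => D.disjoint_translates h⟩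
  obtain ⟨-, -, -, -, A, -, hA⟩ := hT z
  exact ⟨A, hA⟩

end Field

end

end HilbertReduction

end

/-! ### The main theorem -/

theorem mainTheorem1 (K : Type*) [Field K] [NumberField K] [NumberField.IsTotallyReal K] :
    Nonempty (HilbertReduction.ReductionData K) ∧
    ∀ D : HilbertReduction.ReductionData K,
      HilbertReduction.IsFundamentalDomain D.fundamentalDomain ∧
      ∃ P : MvPolynomial (Fin 3) ℝ, ∀ z : HilbertReduction.HK K,
        ∃ (A : Matrix.SpecialLinearGroup (Fin 2) (𝓞 K)) (t : ℕ),
          (HilbertReduction.toK A, t) ∈ D.reduce z 0 ∧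
          HilbertReduction.act (HilbertReduction.toK A) z ∈ D.fundamentalDomain ∧
          (t : ℝ) ≤ MvPolynomial.eval
            ![‖HilbertReduction.xPart z‖, ‖HilbertReduction.yPart z‖,
              ‖(HilbertReduction.yPart z)⁻¹‖] P := by
  refine ⟨HilbertReduction.nonempty_reductionData, fun D => ⟨D.isFundamentalDomain, ?_⟩⟩
  obtain ⟨T, hT, hspec⟩ := D.exists_spec_reduce
  obtain ⟨P, hP⟩ := hT.exists_mvPolynomial
  refine ⟨P, fun z => ?_⟩
  obtain ⟨_, c, h1, h2, A, rfl, hA⟩ := hspec z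
  have h0 := h1 0
  rw [zero_add] at h0
  exact ⟨A, c, h0, hA, h2.trans (hP z)⟩
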